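/- Let $I=(-1,1)$ and $\mu\in\mathbb{C}$. Let $L^2_m(I)$ and $L^2_d(I)$ be the Hilbert spaces of (classes of) measurable functions $f:I\to\mathbb{C}$ with $\frac1\pi\int_{-1}^1|f(t)|^2\sqrt{1-t^2}\,dt<\infty$ and $\frac1\pi\int_{-1}^1\frac{|f(t)|^2}{\sqrt{1-t^2}}\,dt<\infty$, respectively, normed by the square roots of these integrals. All singular integrals below are Cauchy principal values. The cosh-weighted finite Hilbert transform is $$H_\mu f(s)=\frac1\pi\int_{-1}^1\frac{\cosh[\mu(s-t)]}{s-t}f(t)\,dt .$$ Define $$\mathcal{E}^2_m(I)=\Big\{f\in L^2_m(I):\int_{-1}^1\cosh(\mu t)f(t)\,dt=0\Big\},\qquad \mathcal{E}^2_d(I)=\Big\{f\in L^2_d(I):\int_{-1}^1\frac{\cosh(i\mu\sqrt{1-t^2})}{\sqrt{1-t^2}}f(t)\,dt=0\Big\}.$$ Then, for $f$ in $L^2_d(I)$ or in $L^2_m(I)$, $H_\mu f(s)$ exists for almost every $s\in I$, and $H_\mu$ is a continuous linear operator of $L^2_d(I)$ into itself and of $L^2_m(I)$ into itself. Moreover: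 1. The null space of $H_\mu$ in $L^2_d(I)$ is trivial, and the null space of $H_\mu$ in $L^2_m(I)$ is $\{c\cosh(i\mu\sqrt{1-t^2})/\sqrt{1-t^2}:c\in\mathbb{C}\}$. 2. $H_\mu$ is a continuous bijection of $L^2_d(I)$ onto $\mathcal{E}^2_d(I)$. Its inverse is continuous from $\mathcal{E}^2_d(I)$ to $L^2_d(I)$ and is given, for $F\in\mathcal{E}^2_d(I)$ and almost every $t\in I$, by $$\cosh(i\mu\sqrt{1-t^2})\sqrt{1-t^2}\;\frac1\pi\int_{-1}^1\frac{1}{s-t}\frac{\cosh(i\mu\sqrt{1-s^2})}{\sqrt{1-s^2}}F(s)\,ds-\sinh(i\mu\sqrt{1-t^2})\;\frac1\pi\int_{-1}^1\frac{1}{s-t}\sinh(i\mu\sqrt{1-s^2})F(s)\,ds .$$ 3. $H_\mu$ is a continuous bijection of $\mathcal{E}^2_m(I)$ onto $L^2_m(I)$. Its inverse is continuous from $L^2_m(I)$ to $\mathcal{E}^2_m(I)$ and is given, for $F\in L^2_m(I)$ and almost every $t\in I$, by $$\frac{\cosh(i\mu\sqrt{1-t^2})}{\sqrt{1-t^2}}\;\frac1\pi\int_{-1}^1\frac{1}{s-t}\cosh(i\mu\sqrt{1-s^2})\sqrt{1-s^2}\,F(s)\,ds-\sinh(i\mu\sqrt{1-t^2})\;\frac1\pi\int_{-1}^1\frac{1}{s-t}\sinh(i\mu\sqrt{1-s^2})F(s)\,ds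 .$$ The principal values in both formulas exist for almost every $t\in I$. -/

import Mathlib

open MeasureTheory Set Filter Topology

namespace CoshFHT

noncomputable section

/-! ## Principal values and the cosh-weighted finite Hilbert transform on `(-1, 1)` -/

/-- Lebesgue measure on the open interval `I = (-1, 1)`. -/
def lebI : Measure ℝ := volume.restrict (Ioo (-1 : ℝ) 1)

/-- The principal value at `x` of the integral of `g` over `(-1, 1)` exists and equals `L`:
the integrals over `{t ∈ (-1, 1) : |t - x| > ε}` tend to `L` as `ε → 0+`. -/
def HasPV (g : ℝ → ℂ) (x : ℝ) (L : ℂ) : Prop :=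
  Tendsto (fun ε : ℝ => ∫ t in {t : ℝ | t ∈ Ioo (-1 : ℝ) 1 ∧ ε < |t - x|}, g t)
    (𝓝[>] (0 : ℝ)) (𝓝 L)

/-- The principal value at `x` of the integral of `g` over `(-1, 1)` exists. -/
def PVExists (g : ℝ → ℂ) (x : ℝ) : Prop := ∃ L : ℂ, HasPV g x L

/-- The principal value at `x` of the integral of `g` over `(-1, 1)`
(meaningful when `PVExists g x`). -/
def pv (g : ℝ → ℂ) (x : ℝ) : ℂ :=
  limUnder (𝓝[>] (0 : ℝ))
    (fun ε : ℝ => ∫ t in {t : ℝ | t ∈ Ioo (-1 : ℝ) 1 ∧ ε < |t - x|}, g t)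

/-- The integrand `t ↦ cosh(μ (s - t)) / (s - t) * f t` of the cosh-weighted transform at `s`. -/
def coshKernel (μ : ℂ) (f : ℝ → ℂ) (s t : ℝ) : ℂ :=
  Complex.cosh (μ * ((s : ℂ) - t)) / ((s : ℂ) - t) * f t

/-- The cosh-weighted finite Hilbert transform
`H_μ f (s) = (1/π) p.v. ∫_{-1}^1 cosh(μ (s - t)) / (s - t) f(t) dt`. -/
def H (μ : ℂ) (f : ℝ → ℂ) (s : ℝ) : ℂ :=
  1 / (Real.pi : ℂ) * pv (coshKernel μ f s) s

/-- `√(1 - t²)`. -/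
def root (t : ℝ) : ℝ := √(1 - t ^ 2)

/-- `cosh(i μ √(1 - t²))`. -/
def coshRoot (μ : ℂ) (t : ℝ) : ℂ := Complex.cosh (Complex.I * μ * (root t : ℂ))

/-- `sinh(i μ √(1 - t²))`. -/
def sinhRoot (μ : ℂ) (t : ℝ) : ℂ := Complex.sinh (Complex.I * μ * (root t : ℂ))

/-- The integrand `s ↦ 1 / (s - t) * cosh(i μ √(1 - s²)) / √(1 - s²) * F(s)`. -/
def kerDiv (μ : ℂ) (F : ℝ → ℂ) (t s : ℝ) : ℂ :=
  1 / ((s : ℂ) - t) * (coshRoot μ s / (root s : ℂ)) * F s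

/-- The integrand `s ↦ 1 / (s - t) * cosh(i μ √(1 - s²)) √(1 - s²) * F(s)`. -/
def kerMul (μ : ℂ) (F : ℝ → ℂ) (t s : ℝ) : ℂ :=
  1 / ((s : ℂ) - t) * (coshRoot μ s * (root s : ℂ)) * F s

/-- The integrand `s ↦ 1 / (s - t) * sinh(i μ √(1 - s²)) * F(s)`. -/
def kerSinh (μ : ℂ) (F : ℝ → ℂ) (t s : ℝ) : ℂ :=
  1 / ((s : ℂ) - t) * sinhRoot μ s * F s

/-- The inversion formula on `L²_d`. -/
def invD (μ : ℂ) (F : ℝ → ℂ) (t : ℝ) : ℂ :=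
  coshRoot μ t * (root t : ℂ) * (1 / (Real.pi : ℂ) * pv (kerDiv μ F t) t)
    - sinhRoot μ t * (1 / (Real.pi : ℂ) * pv (kerSinh μ F t) t)

/-- The inversion formula on `L²_m`. -/
def invM (μ : ℂ) (F : ℝ → ℂ) (t : ℝ) : ℂ :=
  coshRoot μ t / (root t : ℂ) * (1 / (Real.pi : ℂ) * pv (kerMul μ F t) t)
    - sinhRoot μ t * (1 / (Real.pi : ℂ) * pv (kerSinh μ F t) t)

/-! ## The weighted spaces -/

/-- The measure `(1/π) √(1 - t²) dt` on `(-1, 1)`. -/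
def measM : Measure ℝ := lebI.withDensity fun t => ENNReal.ofReal (root t / Real.pi)

/-- The measure `(1/π) dt / √(1 - t²)` on `(-1, 1)`. -/
def measD : Measure ℝ := lebI.withDensity fun t => ENNReal.ofReal (1 / (Real.pi * root t))

/-- The Hilbert space `L²_m(I)`, with inner product
`(1/π) ∫ f g* √(1 - t²) dt` (conjugation in Mathlib's order). -/
abbrev L2m : Type := Lp ℂ 2 measM

/-- The Hilbert space `L²_d(I)`, with inner product
`(1/π) ∫ f g* dt / √(1 - t²)` (conjugation in Mathlib's order). -/
abbrev L2d : Type := Lp ℂ 2 measD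

/-- `cosh(i μ √(1 - t²)) / √(1 - t²)`. -/
def nullFun (μ : ℂ) (t : ℝ) : ℂ := coshRoot μ t / (root t : ℂ)

/-! ### Integrability facts needed to form the subspaces -/

theorem continuous_root : Continuous root := by unfold root; fun_prop

theorem continuous_coshRoot (μ : ℂ) : Continuous (coshRoot μ) := by
  have := continuous_root
  unfold coshRoot
  fun_prop

theorem root_pos {t : ℝ} (ht : t ∈ Ioo (-1 : ℝ) 1) : 0 < root t :=
  Real.sqrt_pos.2 (by nlinarith [ht.1, ht.2])

theorem ae_root_pos : ∀ᵐ t ∂lebI, 0 < root t :=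
  (ae_restrict_mem measurableSet_Ioo).mono fun _ ht => root_pos ht

theorem integrable_bdd_div_root {c : ℝ → ℝ} (hc : Continuous c) :
    Integrable (fun t => c t * (root t)⁻¹) lebI := by
  have h0 := Polynomial.Chebyshev.intervalIntegrable_sqrt_one_sub_sq_inv
  rw [intervalIntegrable_iff_integrableOn_Ioo_of_le (by norm_num)] at h0
  obtain ⟨C, hC⟩ := isCompact_Icc (a := (-1 : ℝ)) (b := 1) |>.exists_bound_of_continuousOn
    hc.continuousOn
  have h1 : Integrable (fun t => (root t)⁻¹) lebI := by
    simpa only [root, lebI, IntegrableOn, Real.sqrt_inv] using h0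
  refine Integrable.bdd_mul (c := C) h1 hc.aestronglyMeasurable ?_
  exact (ae_restrict_mem measurableSet_Ioo).mono fun t ht => hC t (Ioo_subset_Icc_self ht)

theorem memLp_withDensity {w : ℝ → ℝ} (hw : Measurable w) (hw0 : ∀ᵐ t ∂lebI, 0 < w t)
    {k : ℝ → ℂ} (hk : Measurable k) (h : Integrable (fun t => w t * ‖k t‖ ^ 2) lebI) :
    MemLp k 2 (lebI.withDensity fun t => ENNReal.ofReal (w t)) := by
  rw [memLp_two_iff_integrable_sq_norm hk.aestronglyMeasurable,
    integrable_withDensity_iff_integrable_smul' (by fun_prop) (by simp)]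
  refine h.congr ?_
  filter_upwards [hw0] with t ht
  simp [ENNReal.toReal_ofReal ht.le]

theorem integrable_mul_of_memLp {w : ℝ → ℝ} (hw : Measurable w) (hw0 : ∀ᵐ t ∂lebI, 0 < w t)
    {k : ℝ → ℂ} (hk : Measurable k) (h : Integrable (fun t => ‖k t‖ ^ 2 / w t) lebI)
    {f : ℝ → ℂ} (hf : MemLp f 2 (lebI.withDensity fun t => ENNReal.ofReal (w t))) :
    Integrable (fun t => k t * f t) lebI := by
  have h1 : MemLp (fun t => k t / (w t : ℂ)) 2
      (lebI.withDensity fun t => ENNReal.ofReal (w t)) := by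
    refine memLp_withDensity hw hw0 (by fun_prop) (h.congr ?_)
    filter_upwards [hw0] with t ht
    simp only [norm_div, Complex.norm_real, Real.norm_eq_abs, abs_of_pos ht]
    field_simp
  have h2 := h1.integrable_mul hf
  rw [integrable_withDensity_iff_integrable_smul' (by fun_prop) (by simp)] at h2
  refine h2.congr ?_
  filter_upwards [hw0] with t ht
  have : (w t : ℂ) ≠ 0 := by exact_mod_cast ht.ne'
  simp only [ENNReal.toReal_ofReal ht.le, Pi.mul_apply, Complex.real_smul]
  field_simp

theorem integrable_cosh_mul (μ : ℂ) (f : L2m) :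
    Integrable (fun t : ℝ => Complex.cosh (μ * (t : ℂ)) * f t) lebI := by
  have hr := continuous_root.measurable
  refine integrable_mul_of_memLp (w := fun t => root t / Real.pi) (by fun_prop)
    (ae_root_pos.mono fun t ht => div_pos ht Real.pi_pos) (by fun_prop) ?_ (Lp.memLp f)
  refine (integrable_bdd_div_root
    (c := fun t : ℝ => ‖Complex.cosh (μ * (t : ℂ))‖ ^ 2 * Real.pi) (by fun_prop)).congr ?_
  filter_upwards [ae_root_pos] with t ht
  field_simp

theorem integrable_nullFun_mul (μ : ℂ) (f : L2d) :
    Integrable (fun t => nullFun μ t * f t) lebI := by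
  have hr := continuous_root.measurable
  have hcr := continuous_coshRoot μ
  have hcm := hcr.measurable
  refine integrable_mul_of_memLp (w := fun t => 1 / (Real.pi * root t)) (by fun_prop)
    (ae_root_pos.mono fun t ht => by have := Real.pi_pos; positivity)
    (by unfold nullFun; fun_prop) ?_ (Lp.memLp f)
  refine (integrable_bdd_div_root
    (c := fun t => ‖coshRoot μ t‖ ^ 2 * Real.pi) (by fun_prop)).congr ?_
  filter_upwards [ae_root_pos] with t ht
  simp only [nullFun, norm_div, Complex.norm_real, Real.norm_eq_abs, abs_of_pos ht]
  field_simp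

theorem memLp_nullFun (μ : ℂ) : MemLp (nullFun μ) 2 measM := by
  have hr := continuous_root.measurable
  have hcr := continuous_coshRoot μ
  have hcm := hcr.measurable
  refine memLp_withDensity (w := fun t => root t / Real.pi) (by fun_prop)
    (ae_root_pos.mono fun t ht => div_pos ht Real.pi_pos) (by unfold nullFun; fun_prop) ?_
  refine (integrable_bdd_div_root
    (c := fun t => ‖coshRoot μ t‖ ^ 2 / Real.pi) (by fun_prop)).congr ?_
  filter_upwards [ae_root_pos] with t ht
  simp only [nullFun, norm_div, Complex.norm_real, Real.norm_eq_abs, abs_of_pos ht]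
  field_simp

theorem ac_measM : lebI ≪ measM :=
  withDensity_absolutelyContinuous' (by have := continuous_root.measurable; fun_prop)
    (ae_root_pos.mono fun t ht => by
      simpa using div_pos ht Real.pi_pos)

theorem ac_measD : lebI ≪ measD :=
  withDensity_absolutelyContinuous' (by have := continuous_root.measurable; fun_prop)
    (ae_root_pos.mono fun t ht => by
      have := Real.pi_pos
      have : 0 < 1 / (Real.pi * root t) := by positivity
      simpa using this)

/-! ### The two subspaces -/

/-- `E²_m(I)`: the `f ∈ L²_m(I)` with `∫_{-1}^1 cosh(μ t) f(t) dt = 0`. -/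
def E2m (μ : ℂ) : Submodule ℂ L2m where
  carrier := {f | ∫ t : ℝ, Complex.cosh (μ * (t : ℂ)) * f t ∂lebI = 0}
  zero_mem' := by
    refine (integral_congr_ae ?_).trans (integral_zero ℝ ℂ)
    filter_upwards [ac_measM.ae_eq (Lp.coeFn_zero ℂ 2 measM)] with t ht
    rw [ht, Pi.zero_apply, mul_zero]
  add_mem' := by
    intro f g hf hg
    simp only [mem_ofPred_eq] at hf hg ⊢
    have h := integral_add (integrable_cosh_mul μ f) (integrable_cosh_mul μ g)
    rw [hf, hg, add_zero] at h
    rw [← h]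
    refine integral_congr_ae ?_
    filter_upwards [ac_measM.ae_eq (Lp.coeFn_add f g)] with t ht
    rw [ht, Pi.add_apply, mul_add]
  smul_mem' := by
    intro c f hf
    simp only [mem_ofPred_eq] at hf ⊢
    rw [← mul_zero c, ← hf, ← integral_const_mul]
    refine integral_congr_ae ?_
    filter_upwards [ac_measM.ae_eq (Lp.coeFn_smul c f)] with t ht
    rw [ht, Pi.smul_apply, smul_eq_mul, mul_left_comm]

/-- `E²_d(I)`: the `f ∈ L²_d(I)` with
`∫_{-1}^1 cosh(i μ √(1 - t²)) / √(1 - t²) f(t) dt = 0`. -/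
def E2d (μ : ℂ) : Submodule ℂ L2d where
  carrier := {f | ∫ t, nullFun μ t * f t ∂lebI = 0}
  zero_mem' := by
    refine (integral_congr_ae ?_).trans (integral_zero ℝ ℂ)
    filter_upwards [ac_measD.ae_eq (Lp.coeFn_zero ℂ 2 measD)] with t ht
    rw [ht, Pi.zero_apply, mul_zero]
  add_mem' := by
    intro f g hf hg
    simp only [mem_ofPred_eq] at hf hg ⊢
    have h := integral_add (integrable_nullFun_mul μ f) (integrable_nullFun_mul μ g)
    rw [hf, hg, add_zero] at h
    rw [← h]
    refine integral_congr_ae ?_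
    filter_upwards [ac_measD.ae_eq (Lp.coeFn_add f g)] with t ht
    rw [ht, Pi.add_apply, mul_add]
  smul_mem' := by
    intro c f hf
    simp only [mem_ofPred_eq] at hf ⊢
    rw [← mul_zero c, ← hf, ← integral_const_mul]
    refine integral_congr_ae ?_
    filter_upwards [ac_measD.ae_eq (Lp.coeFn_smul c f)] with t ht
    rw [ht, Pi.smul_apply, smul_eq_mul, mul_left_comm]

/-- `cosh(i μ √(1 - t²)) / √(1 - t²)` as an element of `L²_m(I)`. -/
def nullVec (μ : ℂ) : L2m := (memLp_nullFun μ).toLp (nullFun μ)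

end

end CoshFHT

namespace CoshFHT

noncomputable section

/-! ## Fourier multipliers and multiplication operators on the circle -/

/-! The substitution t = cos θ folds the circle onto the interval by θ ↦ -θ and carries normalised
Haar measure to dt / (π√(1 - t²)). Functions in L²_d lift isometrically to sgn(sin θ) f(cos θ) (odd)
or f(cos θ) (even); functions in L²_m lift to |sin θ| f(cos θ) (even) or sin θ f(cos θ) (odd). Under
these lifts the unweighted finite Hilbert transform is the conjugation operator 𝓗 = `hilb` with
multiplier i sgn n, which exchanges the parities. Since cosh(μ(s - t)) is a half-sum of products of
exponentials, H_μ becomes `hilbCosh`, that is g ↦ (u 𝓗(u⁻¹g) + u⁻¹ 𝓗(ug)) / 2 with u = exp(μ cos θ).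
The inversion formulas become `-hilbCos`, where `hilbCos` is the same expression with v = exp(iμ sin
θ).

The algebra is in `twist_twist`. The products uv = exp(μ e^{iθ}) and uv⁻¹ = exp(μ e^{-iθ}), and
their inverses, are one-sided power series with constant term 1. Multiplying by one of them
preserves the matching half-line of frequencies, on which 𝓗 is ±i up to the constant term. Hence
`hilbCos ∘ hilbCosh` and `hilbCosh ∘ hilbCos` are both -1 plus a rank-one operator. The two rank-one
functionals are the means against cosh(μ cos θ) and cosh(iμ sin θ). They vanish on odd functions,
which gives an exact one-sided inverse in each space; on even functions their vanishing is the
condition that defines E²_m or E²_d. Kernels and ranges then follow formally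
(`exists_bijection_measD`, `exists_bijection_measM`).

The analysis is in `hasPV_of_hilb`: the value of 𝓗 must be an almost everywhere principal value.
Skew-adjointness moves 𝓗 onto an explicit Poisson kernel of the interval (`integral_abelP_mul`). As
the parameter tends to 0, the Poisson means converge at Lebesgue points, while the conjugate kernel
differs from the truncated 1/(x - t) by a term that tends boundedly to 0 and a mean-zero term
dominated by a Poisson kernel. This covers L²_d; L²_m is reduced to it by multiplying by 1 - t²
(`hilbertPair_measM`). -/

instance fact_two_pi_pos : Fact (0 < 2 * Real.pi) := ⟨Real.two_pi_pos⟩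

/-- The circle of length `2π`. -/
abbrev Torus : Type := AddCircle (2 * Real.pi)

/-- Normalised Haar measure on the circle. -/
abbrev haarT : Measure Torus := AddCircle.haarAddCircle

/-- `L²` of the circle. -/
abbrev L2T : Type := Lp ℂ 2 haarT

/-- The exponential `e^{inθ}` in `L²` of the circle. -/
abbrev expT (n : ℤ) : L2T := fourierLp 2 n

/-- The `n`-th Fourier coefficient as a continuous functional. -/
def coef (n : ℤ) : L2T →L[ℂ] ℂ := innerSL ℂ (expT n)

theorem coef_apply (n : ℤ) (f : L2T) : coef n f = inner ℂ (expT n) f := rfl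

theorem coef_eq_integral (n : ℤ) (f : L2T) : coef n f = ∫ θ, fourier (-n) θ * f θ ∂haarT := by
  have h := fourierBasis_repr f n
  rw [HilbertBasis.repr_apply_apply, coe_fourierBasis] at h
  exact h

theorem ext_coef {f g : L2T} (h : ∀ n, coef n f = coef n g) : f = g := by
  apply fourierBasis.repr.injective
  ext n
  rw [HilbertBasis.repr_apply_apply, HilbertBasis.repr_apply_apply, coe_fourierBasis]
  exact h n

theorem coef_expT (n k : ℤ) : coef n (expT k) = if n = k then 1 else 0 := by
  rw [coef_apply]
  exact orthonormal_iff_ite.1 orthonormal_fourier n k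

/-- The closed span of the exponentials with frequencies in `S`. -/
def freqSpace (S : Set ℤ) : Submodule ℂ L2T := (Submodule.span ℂ (expT '' Sᶜ))ᗮ

theorem mem_freqSpace {S : Set ℤ} {f : L2T} : f ∈ freqSpace S ↔ ∀ n ∉ S, coef n f = 0 := by
  rw [freqSpace, Submodule.mem_orthogonal]
  constructor
  · intro h n hn
    exact h _ (Submodule.subset_span ⟨n, hn, rfl⟩)
  · intro h u hu
    induction hu using Submodule.span_induction with
    | mem x hx => obtain ⟨n, hn, rfl⟩ := hx; exact h n hn
    | zero => simp
    | add x y _ _ hx hy => rw [inner_add_left, hx, hy, add_zero]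
    | smul a x _ hx => rw [inner_smul_left, hx, mul_zero]

instance (S : Set ℤ) : CompleteSpace (freqSpace S) :=
  (Submodule.isClosed_orthogonal _).completeSpace_coe

/-- The orthogonal projection onto the frequencies in `S`. -/
def proj (S : Set ℤ) : L2T →L[ℂ] L2T := (freqSpace S).starProjection

open Classical in
theorem coef_proj (S : Set ℤ) (n : ℤ) (f : L2T) :
    coef n (proj S f) = if n ∈ S then coef n f else 0 := by
  split_ifs with h
  · rw [coef_apply, proj, ← Submodule.inner_starProjection_left_eq_right,
      Submodule.starProjection_eq_self_iff.2]
    · rfl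
    · rw [mem_freqSpace]
      intro m hm
      rw [coef_expT, if_neg (by rintro rfl; exact hm h)]
  · exact mem_freqSpace.1 (Submodule.starProjection_apply_mem _ f) n h

/-- The constant function `1` in `L²` of the circle. -/
abbrev oneT : L2T := expT 0

/-- Half of `1 - i 𝓗`: keeps the positive frequencies and half of the constant term. -/
def anPart : L2T →L[ℂ] L2T := (1 / 2 : ℂ) • (proj {n | 0 ≤ n} + proj {n | 0 < n})

theorem coef_anPart (n : ℤ) (f : L2T) :
    coef n (anPart f) = if 0 < n then coef n f else if n = 0 then coef n f / 2 else 0 := by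
  simp only [anPart, smul_apply, add_apply, map_smul, map_add, coef_proj,
    smul_eq_mul, mem_ofPred_eq]
  rcases lt_trichotomy n 0 with h | h | h
  · simp [h.not_ge, h.not_gt, h.ne]
  · simp [h]; ring
  · simp [h, h.le]; ring

/-- The conjugation operator on the circle, with multiplier `i sgn n`. -/
def hilb : L2T →L[ℂ] L2T := Complex.I • ((2 : ℂ) • anPart - ContinuousLinearMap.id ℂ L2T)

theorem hilb_apply (f : L2T) : hilb f = Complex.I • ((2 : ℂ) • anPart f - f) := rfl

theorem coef_hilb (n : ℤ) (f : L2T) : coef n (hilb f) = Complex.I * (Int.sign n : ℂ) * coef n f := by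
  rw [hilb_apply, map_smul, map_sub, map_smul, coef_anPart]
  rcases lt_trichotomy n 0 with h | h | h
  · simp [h.not_gt, h.ne, Int.sign_eq_neg_one_of_neg h]
  · simp [h, mul_div_cancel₀]
  · simp [h, Int.sign_eq_one_of_pos h]; ring

/-- The multiplier is i on positive frequencies but 0 at frequency 0, so the constant term has to be
removed. This correction is the source of every rank-one term below. -/
theorem hilb_of_nonneg {f : L2T} (hf : ∀ n < 0, coef n f = 0) :
    hilb f = Complex.I • (f - coef 0 f • oneT) := by
  refine ext_coef fun n => ?_
  rw [coef_hilb, map_smul, map_sub, map_smul, coef_expT]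
  rcases lt_trichotomy n 0 with h | h | h
  · simp [hf n h, h.ne]
  · simp [h]
  · simp [h.ne', Int.sign_eq_one_of_pos h]

theorem hilb_of_nonpos {f : L2T} (hf : ∀ n, 0 < n → coef n f = 0) :
    hilb f = -(Complex.I • (f - coef 0 f • oneT)) := by
  refine ext_coef fun n => ?_
  rw [coef_hilb, map_neg, map_smul, map_sub, map_smul, coef_expT]
  rcases lt_trichotomy n 0 with h | h | h
  · simp [h.ne, Int.sign_eq_neg_one_of_neg h]
  · simp [h]
  · simp [h.ne', hf n h]

/-- The multiplier i sgn n is purely imaginary, so the operator is skew-adjoint; compare Fourier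
coefficients in Parseval's formula. -/
theorem inner_hilb (p g : L2T) : inner ℂ p (hilb g) = -inner ℂ (hilb p) g := by
  rw [← HilbertBasis.tsum_inner_mul_inner fourierBasis p (hilb g),
    ← HilbertBasis.tsum_inner_mul_inner fourierBasis (hilb p) g, ← tsum_neg]
  congr 1 with n
  rw [coe_fourierBasis]
  have h1 : inner ℂ (fourierLp 2 n : L2T) (hilb g) = _ := coef_hilb n g
  have h2 : inner ℂ (fourierLp 2 n : L2T) (hilb p) = _ := coef_hilb n p
  rw [h1, ← inner_conj_symm (hilb p), h2, ← inner_conj_symm p, coef_apply, coef_apply]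
  simp
  ring

/-! ### Multiplication by continuous functions -/

theorem memLp_continuous_mul (φ : C(Torus, ℂ)) (f : L2T) :
    MemLp (fun θ => φ θ * f θ) 2 haarT :=
  (Lp.memLp f).of_le_mul (c := ‖φ‖)
    (φ.continuous.aestronglyMeasurable.mul (Lp.aestronglyMeasurable f))
    (ae_of_all _ fun θ => by
      rw [norm_mul]; exact mul_le_mul_of_nonneg_right (φ.norm_coe_le_norm θ) (norm_nonneg _))

/-- Multiplication by a continuous function, as a continuous bilinear map. -/
def mulOp : C(Torus, ℂ) →L[ℂ] L2T →L[ℂ] L2T :=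
  LinearMap.mkContinuous₂
    (LinearMap.mk₂ ℂ (fun φ f => (memLp_continuous_mul φ f).toLp)
      (fun φ ψ f => by
        rw [← MemLp.toLp_add]
        exact MemLp.toLp_congr _ _ (ae_of_all _ fun θ => by simp [add_mul]))
      (fun c φ f => by
        rw [← MemLp.toLp_const_smul]
        exact MemLp.toLp_congr _ _ (ae_of_all _ fun θ => by simp [mul_assoc]))
      (fun φ f g => by
        rw [← MemLp.toLp_add]
        refine MemLp.toLp_congr _ _ ?_
        filter_upwards [Lp.coeFn_add f g] with θ h
        rw [h, Pi.add_apply, Pi.add_apply, mul_add])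
      (fun c φ f => by
        rw [← MemLp.toLp_const_smul]
        refine MemLp.toLp_congr _ _ ?_
        filter_upwards [Lp.coeFn_smul c f] with θ h
        rw [h, Pi.smul_apply, Pi.smul_apply, smul_eq_mul, smul_eq_mul, mul_left_comm]))
    1 (fun φ f => by
      rw [one_mul]
      refine Lp.norm_le_mul_norm_of_ae_le_mul ?_
      filter_upwards [(memLp_continuous_mul φ f).coeFn_toLp] with θ h
      rw [LinearMap.mk₂_apply, h, norm_mul]
      exact mul_le_mul_of_nonneg_right (φ.norm_coe_le_norm θ) (norm_nonneg _))

theorem coeFn_mulOp (φ : C(Torus, ℂ)) (f : L2T) : mulOp φ f =ᵐ[haarT] fun θ => φ θ * f θ :=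
  (memLp_continuous_mul φ f).coeFn_toLp

theorem mulOp_mul (φ ψ : C(Torus, ℂ)) (f : L2T) : mulOp (φ * ψ) f = mulOp φ (mulOp ψ f) := by
  refine Lp.ext ?_
  filter_upwards [coeFn_mulOp (φ * ψ) f, coeFn_mulOp φ (mulOp ψ f), coeFn_mulOp ψ f]
    with θ h1 h2 h3
  rw [h1, h2, h3, ContinuousMap.mul_apply, mul_assoc]

theorem mulOp_one (f : L2T) : mulOp 1 f = f := by
  refine Lp.ext ?_
  filter_upwards [coeFn_mulOp 1 f] with θ h1
  rw [h1, ContinuousMap.one_apply, one_mul]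

theorem coef_mulOp_fourier (n k : ℤ) (f : L2T) :
    coef n (mulOp (fourier k) f) = coef (n - k) f := by
  rw [coef_eq_integral, coef_eq_integral]
  refine integral_congr_ae ?_
  filter_upwards [coeFn_mulOp (fourier k) f] with θ h
  rw [h, ← mul_assoc, ← fourier_add]
  congr 3
  ring

theorem coef_zero_mulOp (φ : C(Torus, ℂ)) (f : L2T) :
    coef 0 (mulOp φ f) = ∫ θ, φ θ * f θ ∂haarT := by
  rw [coef_eq_integral]
  refine integral_congr_ae ?_
  filter_upwards [coeFn_mulOp φ f] with θ h
  rw [h]; simp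

/-- For fixed f and n the functional φ ↦ `coef n (mulOp φ f)` is continuous, so a uniformly
convergent Fourier expansion may be inserted term by term. -/
theorem hasSum_coef_mulOp {c : ℕ → ℂ} {k : ℕ → ℤ} {φ : C(Torus, ℂ)}
    (h : HasSum (fun j => c j • (fourier (k j) : C(Torus, ℂ))) φ) (f : L2T) (n : ℤ) :
    HasSum (fun j => c j * coef (n - k j) f) (coef n (mulOp φ f)) := by
  have := ((coef n).comp ((ContinuousLinearMap.apply ℂ L2T f).comp mulOp)).hasSum h
  simpa [coef_mulOp_fourier] using this

/-- A product of two series in nonnegative powers of e^{iθ} is again one, and its constant term is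
the product of the constant terms. -/
theorem coef_mulOp_of_nonneg {c : ℕ → ℂ} {φ : C(Torus, ℂ)}
    (h : HasSum (fun j : ℕ => c j • (fourier (j : ℤ) : C(Torus, ℂ))) φ) {f : L2T}
    (hf : ∀ n < 0, coef n f = 0) :
    (∀ n < 0, coef n (mulOp φ f) = 0) ∧ coef 0 (mulOp φ f) = c 0 * coef 0 f := by
  constructor
  · intro n hn
    have := hasSum_coef_mulOp h f n
    refine this.unique ?_
    convert hasSum_zero with j
    rw [hf _ (by omega), mul_zero]
  · have := hasSum_coef_mulOp h f 0
    refine this.unique ?_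
    have h2 := hasSum_single (f := fun j : ℕ => c j * coef (0 - (j : ℤ)) f) 0 fun j hj => by
      rw [hf _ (by omega), mul_zero]
    simpa using h2

theorem coef_mulOp_of_nonpos {c : ℕ → ℂ} {φ : C(Torus, ℂ)}
    (h : HasSum (fun j : ℕ => c j • (fourier (-(j : ℤ)) : C(Torus, ℂ))) φ) {f : L2T}
    (hf : ∀ n, 0 < n → coef n f = 0) :
    (∀ n, 0 < n → coef n (mulOp φ f) = 0) ∧ coef 0 (mulOp φ f) = c 0 * coef 0 f := by
  constructor
  · intro n hn
    have := hasSum_coef_mulOp h f n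
    refine this.unique ?_
    convert hasSum_zero with j
    rw [hf _ (by omega), mul_zero]
  · have := hasSum_coef_mulOp h f 0
    refine this.unique ?_
    have h2 := hasSum_single (f := fun j : ℕ => c j * coef (0 - -(j : ℤ)) f) 0 fun j hj => by
      rw [hf _ (by omega), mul_zero]
    simpa using h2

/-! ### Exponentials of cosine and sine as one-sided Fourier series -/

/-- The cosine on the circle. -/
def cosT (θ : Torus) : ℝ := (fourier 1 θ : ℂ).re

/-- The sine on the circle. -/
def sinT (θ : Torus) : ℝ := (fourier 1 θ : ℂ).im

theorem continuous_cosT : Continuous cosT := by unfold cosT; fun_prop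

theorem continuous_sinT : Continuous sinT := by unfold sinT; fun_prop

theorem fourier_one_eq (θ : Torus) : fourier 1 θ = (cosT θ : ℂ) + sinT θ * Complex.I :=
  (Complex.re_add_im _).symm

theorem fourier_neg_one_eq (θ : Torus) : fourier (-1) θ = (cosT θ : ℂ) - sinT θ * Complex.I := by
  rw [fourier_neg, fourier_one_eq]
  simp
  ring

theorem cosT_sq_add_sinT_sq (θ : Torus) : cosT θ ^ 2 + sinT θ ^ 2 = 1 := by
  have : ‖(fourier 1 θ : ℂ)‖ = 1 := Circle.norm_coe _
  have h := Complex.sq_norm (fourier 1 θ : ℂ)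
  rw [this, Complex.normSq_apply] at h
  unfold cosT sinT
  nlinarith

/-- `e^{α cos θ + β sin θ}` as a continuous function. -/
def expMap (α β : ℂ) : C(Torus, ℂ) where
  toFun θ := Complex.exp (α * cosT θ + β * sinT θ)
  continuous_toFun := by
    have := continuous_cosT
    have := continuous_sinT
    fun_prop

theorem expMap_apply (α β : ℂ) (θ : Torus) :
    expMap α β θ = Complex.exp (α * cosT θ + β * sinT θ) := rfl

theorem expMap_mul (α β γ δ : ℂ) : expMap α β * expMap γ δ = expMap (α + γ) (β + δ) := by
  ext θ
  rw [ContinuousMap.mul_apply, expMap_apply, expMap_apply, expMap_apply, ← Complex.exp_add]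
  congr 1
  ring

theorem expMap_zero : expMap 0 0 = 1 := by
  ext θ
  simp [expMap_apply]

theorem fourier_nsmul (j : ℕ) (n : ℤ) : (fourier n : C(Torus, ℂ)) ^ j = fourier (j * n) := by
  induction j with
  | zero => ext θ; simp
  | succ j ih =>
    ext θ
    rw [pow_succ, ih, ContinuousMap.mul_apply, ← fourier_add]
    congr 2
    push_cast
    ring

/-- The exponential series converges in the Banach algebra of continuous functions; evaluation at
each point identifies its sum. -/
theorem hasSum_exp_fourier (α : ℂ) (n : ℤ) {φ : C(Torus, ℂ)}
    (hφ : ∀ θ, φ θ = Complex.exp (α * fourier n θ)) :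
    HasSum (fun j : ℕ => (α ^ j / (j.factorial : ℂ)) • (fourier (j * n) : C(Torus, ℂ))) φ := by
  have h := NormedSpace.exp_series_hasSum_exp' (𝕂 := ℂ) (α • (fourier n : C(Torus, ℂ)))
  have h1 : NormedSpace.exp (α • (fourier n : C(Torus, ℂ))) = φ := by
    ext θ
    have h2 := (ContinuousMap.evalCLM ℂ θ).hasSum h
    rw [hφ, Complex.exp_eq_exp_ℂ]
    refine h2.unique ?_
    have h3 := NormedSpace.exp_series_hasSum_exp' (𝕂 := ℂ) (α * fourier n θ)
    have e : (fun j : ℕ => ContinuousMap.evalCLM ℂ θ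
        (((j.factorial : ℂ))⁻¹ • (α • (fourier n : C(Torus, ℂ))) ^ j))
        = fun j => ((j.factorial : ℂ))⁻¹ • (α * fourier n θ) ^ j := by
      ext j; simp
    rw [e]
    exact h3
  rw [h1] at h
  have e : (fun j : ℕ => (α ^ j / (j.factorial : ℂ)) • (fourier (j * n) : C(Torus, ℂ)))
      = fun j => ((j.factorial : ℂ))⁻¹ • (α • (fourier n : C(Torus, ℂ))) ^ j := by
    ext1 j
    rw [smul_pow, fourier_nsmul, smul_smul]
    congr 1
    field_simp
  rw [e]
  exact h

/-- Here α cos θ + iα sin θ = α e^{iθ}, so this exponential contains only nonnegative frequencies.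
-/
theorem hasSum_expMap_pos (α : ℂ) :
    HasSum (fun j : ℕ => (α ^ j / (j.factorial : ℂ)) • (fourier (j : ℤ) : C(Torus, ℂ)))
      (expMap α (α * Complex.I)) := by
  have := hasSum_exp_fourier α 1 (φ := expMap α (α * Complex.I)) fun θ => by
    rw [expMap_apply, fourier_one_eq]; congr 1; ring
  simpa using this

theorem hasSum_expMap_neg (α : ℂ) :
    HasSum (fun j : ℕ => (α ^ j / (j.factorial : ℂ)) • (fourier (-(j : ℤ)) : C(Torus, ℂ)))
      (expMap α (-(α * Complex.I))) := by
  have := hasSum_exp_fourier α (-1) (φ := expMap α (-(α * Complex.I))) fun θ => by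
    rw [expMap_apply, fourier_neg_one_eq]; congr 1; ring
  simpa using this

/-- The constant term of exp(α e^{iθ}) is 1, so the correction involves only the mean of f and not
α. -/
theorem hilb_expMap_pos (α : ℂ) {f : L2T} (hf : ∀ n < 0, coef n f = 0) :
    hilb (mulOp (expMap α (α * Complex.I)) f)
      = Complex.I • (mulOp (expMap α (α * Complex.I)) f - coef 0 f • oneT) := by
  obtain ⟨h1, h2⟩ := coef_mulOp_of_nonneg (hasSum_expMap_pos α) hf
  rw [hilb_of_nonneg h1, h2]
  simp

theorem hilb_expMap_neg (α : ℂ) {f : L2T} (hf : ∀ n, 0 < n → coef n f = 0) :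
    hilb (mulOp (expMap α (-(α * Complex.I))) f)
      = -(Complex.I • (mulOp (expMap α (-(α * Complex.I))) f - coef 0 f • oneT)) := by
  obtain ⟨h1, h2⟩ := coef_mulOp_of_nonpos (hasSum_expMap_neg α) hf
  rw [hilb_of_nonpos h1, h2]
  simp

/-! ### Conjugating the conjugation operator by exponentials -/

/-- `f ↦ (φ 𝓗(ψ f) + ψ 𝓗(φ f)) / 2`. -/
def twist (φ ψ : C(Torus, ℂ)) : L2T →L[ℂ] L2T :=
  (1 / 2 : ℂ) • (mulOp φ ∘L hilb ∘L mulOp ψ + mulOp ψ ∘L hilb ∘L mulOp φ)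

theorem twist_apply (φ ψ : C(Torus, ℂ)) (f : L2T) :
    twist φ ψ f = (1 / 2 : ℂ) • (mulOp φ (hilb (mulOp ψ f)) + mulOp ψ (hilb (mulOp φ f))) := rfl

/-- Write 𝓗 = i(2P - 1), where P keeps the positive frequencies and half the mean. Splitting u'g and
ug by P expresses v times the inner operator through (vu)·(nonnegative part) and (vu')·(nonpositive
part). By hypothesis 𝓗 acts on these as i and -i up to means, so the two minus signs in i² = -1
reassemble -g. The means leave the rank-one term. -/
theorem twist_twist {u u' v v' : C(Torus, ℂ)} (hu : u * u' = 1) (hv : v * v' = 1)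
    (h1 : ∀ f : L2T, (∀ n < 0, coef n f = 0) →
      hilb (mulOp (v * u) f) = Complex.I • (mulOp (v * u) f - coef 0 f • oneT))
    (h2 : ∀ f : L2T, (∀ n < 0, coef n f = 0) →
      hilb (mulOp (v' * u') f) = Complex.I • (mulOp (v' * u') f - coef 0 f • oneT))
    (h3 : ∀ f : L2T, (∀ n, 0 < n → coef n f = 0) →
      hilb (mulOp (v' * u) f) = -(Complex.I • (mulOp (v' * u) f - coef 0 f • oneT)))
    (h4 : ∀ f : L2T, (∀ n, 0 < n → coef n f = 0) →
      hilb (mulOp (v * u') f) = -(Complex.I • (mulOp (v * u') f - coef 0 f • oneT)))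
    (g : L2T) :
    twist v v' (twist u u' g) = -g +
      (((coef 0 (mulOp u g) + coef 0 (mulOp u' g)) / 2) * (1 / 2)) •
        (mulOp v oneT + mulOp v' oneT) := by
  have hu' : u' * u = 1 := by rw [mul_comm u' u, hu]
  have hv' : v' * v = 1 := by rw [mul_comm v' v, hv]
  have cu : ∀ f, mulOp u (mulOp u' f) = f := fun f => by rw [← mulOp_mul, hu, mulOp_one]
  have cu' : ∀ f, mulOp u' (mulOp u f) = f := fun f => by rw [← mulOp_mul, hu', mulOp_one]
  have cv : ∀ f, mulOp v (mulOp v' f) = f := fun f => by rw [← mulOp_mul, hv, mulOp_one]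
  have cv' : ∀ f, mulOp v' (mulOp v f) = f := fun f => by rw [← mulOp_mul, hv', mulOp_one]
  -- Nonnegative parts `a`, `b` and nonpositive parts `a'`, `b'` of u'g and ug; each part carries
  -- half of the mean.
  obtain ⟨a, ha⟩ : ∃ a, a = anPart (mulOp u' g) := ⟨_, rfl⟩
  obtain ⟨b, hb⟩ : ∃ b, b = anPart (mulOp u g) := ⟨_, rfl⟩
  obtain ⟨a', ha'⟩ : ∃ a', a' = mulOp u' g - a := ⟨_, rfl⟩
  obtain ⟨b', hb'⟩ : ∃ b', b' = mulOp u g - b := ⟨_, rfl⟩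
  have pa : ∀ n < 0, coef n a = 0 := fun n hn => by
    rw [ha, coef_anPart, if_neg (by omega), if_neg (by omega)]
  have pb : ∀ n < 0, coef n b = 0 := fun n hn => by
    rw [hb, coef_anPart, if_neg (by omega), if_neg (by omega)]
  have pa' : ∀ n, 0 < n → coef n a' = 0 := fun n hn => by
    rw [ha', map_sub, ha, coef_anPart, if_pos hn, sub_self]
  have pb' : ∀ n, 0 < n → coef n b' = 0 := fun n hn => by
    rw [hb', map_sub, hb, coef_anPart, if_pos hn, sub_self]
  have ma : coef 0 a = coef 0 (mulOp u' g) / 2 := by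
    rw [ha, coef_anPart, if_neg (by omega), if_pos rfl]
  have mb : coef 0 b = coef 0 (mulOp u g) / 2 := by
    rw [hb, coef_anPart, if_neg (by omega), if_pos rfl]
  have ma' : coef 0 a' = coef 0 (mulOp u' g) / 2 := by rw [ha', map_sub, ma]; ring
  have mb' : coef 0 b' = coef 0 (mulOp u g) / 2 := by rw [hb', map_sub, mb]; ring
  have e0 : twist u u' g = Complex.I • (mulOp u a + mulOp u' b - g) := by
    rw [twist_apply, hilb_apply, hilb_apply, ← ha, ← hb]
    simp only [map_smul, map_sub, cu, cu']
    module
  -- Substituting u'b = g - u'b' cancels g and leaves one term on each side of the spectrum. For v'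
  -- the same is done with ua = g - ua'.
  have ev : mulOp v (twist u u' g) =
      Complex.I • (mulOp (v * u) a - mulOp (v * u') b') := by
    rw [e0, hb']
    simp only [mulOp_mul, map_smul, map_sub, map_add, cu']
    module
  have ev' : mulOp v' (twist u u' g) =
      Complex.I • (mulOp (v' * u') b - mulOp (v' * u) a') := by
    rw [e0, ha']
    simp only [mulOp_mul, map_smul, map_sub, map_add, cu]
    module
  have iI : ∀ f : L2T, Complex.I • Complex.I • f = -f := fun f => by
    rw [smul_smul, Complex.I_mul_I, neg_one_smul]
  have gu : mulOp u a + mulOp u a' = g := by rw [← map_add, ha', add_sub_cancel, cu]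
  have gu' : mulOp u' b + mulOp u' b' = g := by rw [← map_add, hb', add_sub_cancel, cu']
  have fv : mulOp v' (hilb (mulOp v (twist u u' g))) =
      -(mulOp u a + mulOp u' b') + (coef 0 a + coef 0 b') • mulOp v' oneT := by
    rw [ev, map_smul, map_sub, h1 a pa, h4 b' pb']
    simp only [mulOp_mul, map_smul, map_sub, map_neg, cv', smul_sub, iI, smul_neg]
    module
  have fv' : mulOp v (hilb (mulOp v' (twist u u' g))) =
      -(mulOp u a' + mulOp u' b) + (coef 0 a' + coef 0 b) • mulOp v oneT := by
    rw [ev', map_smul, map_sub, h2 b pb, h3 a' pa']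
    simp only [mulOp_mul, map_smul, map_sub, map_neg, cv, smul_sub, iI, smul_neg]
    module
  have key : -(mulOp u a' + mulOp u' b) + -(mulOp u a + mulOp u' b') = -g - g := by
    nth_rewrite 1 [← gu]
    rw [← gu']
    abel
  rw [twist_apply, fv, fv', ma, mb, ma', mb', add_add_add_comm, key]
  module

/-- The cosh-weighted conjugation operator on the circle. -/
def hilbCosh (μ : ℂ) : L2T →L[ℂ] L2T := twist (expMap μ 0) (expMap (-μ) 0)

/-- The negative of the inversion operator on the circle. -/
def hilbCos (μ : ℂ) : L2T →L[ℂ] L2T :=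
  twist (expMap 0 (μ * Complex.I)) (expMap 0 (-(μ * Complex.I)))

theorem expMap_mul_neg_left (α : ℂ) : expMap α 0 * expMap (-α) 0 = 1 := by
  rw [expMap_mul, ← expMap_zero]; congr 1 <;> ring

theorem expMap_mul_neg_right (α : ℂ) : expMap 0 α * expMap 0 (-α) = 1 := by
  rw [expMap_mul, ← expMap_zero]; congr 1 <;> ring

/-- The hypotheses of `twist_twist` hold because (μ cos θ) ± (iμ sin θ) = μ e^{±iθ}, and likewise
with μ replaced by -μ. -/
theorem hilbCos_hilbCosh (μ : ℂ) (g : L2T) :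
    hilbCos μ (hilbCosh μ g) = -g +
      (((coef 0 (mulOp (expMap μ 0) g) + coef 0 (mulOp (expMap (-μ) 0) g)) / 2) * (1 / 2)) •
        (mulOp (expMap 0 (μ * Complex.I)) oneT + mulOp (expMap 0 (-(μ * Complex.I))) oneT) := by
  refine twist_twist (expMap_mul_neg_left μ) (expMap_mul_neg_right _) ?_ ?_ ?_ ?_ g
  · intro f hf
    rw [expMap_mul, zero_add, add_zero]
    exact hilb_expMap_pos μ hf
  · intro f hf
    rw [expMap_mul, zero_add, add_zero, ← neg_mul]
    exact hilb_expMap_pos (-μ) hf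
  · intro f hf
    rw [expMap_mul, zero_add, add_zero]
    exact hilb_expMap_neg μ hf
  · intro f hf
    rw [expMap_mul, zero_add, add_zero]
    simpa using hilb_expMap_neg (-μ) hf

theorem hilbCosh_hilbCos (μ : ℂ) (g : L2T) :
    hilbCosh μ (hilbCos μ g) = -g +
      (((coef 0 (mulOp (expMap 0 (μ * Complex.I)) g) +
        coef 0 (mulOp (expMap 0 (-(μ * Complex.I))) g)) / 2) * (1 / 2)) •
        (mulOp (expMap μ 0) oneT + mulOp (expMap (-μ) 0) oneT) := by
  refine twist_twist (expMap_mul_neg_right _) (expMap_mul_neg_left μ) ?_ ?_ ?_ ?_ g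
  · intro f hf
    rw [expMap_mul, zero_add, add_zero]
    exact hilb_expMap_pos μ hf
  · intro f hf
    rw [expMap_mul, zero_add, add_zero, ← neg_mul]
    exact hilb_expMap_pos (-μ) hf
  · intro f hf
    rw [expMap_mul, zero_add, add_zero]
    simpa using hilb_expMap_neg (-μ) hf
  · intro f hf
    rw [expMap_mul, zero_add, add_zero]
    exact hilb_expMap_neg μ hf

theorem coef_zero_expMap (μ : ℂ) {β : ℂ} (hβ : β = μ * Complex.I ∨ β = -(μ * Complex.I)) :
    coef 0 (mulOp (expMap μ β) oneT) = 1 := by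
  rcases hβ with rfl | rfl
  · rw [(coef_mulOp_of_nonneg (hasSum_expMap_pos μ) fun n hn => by
      rw [coef_expT, if_neg hn.ne]).2, coef_expT]
    simp
  · rw [(coef_mulOp_of_nonpos (hasSum_expMap_neg μ) fun n hn => by
      rw [coef_expT, if_neg hn.ne']).2, coef_expT]
    simp

/-- The mean of `cosh(μ cos θ) cos(μ sin θ)` is `1`. -/
theorem mean_cosh_cos (μ : ℂ) :
    (coef 0 (mulOp (expMap μ 0) ((1 / 2 : ℂ) • (mulOp (expMap 0 (μ * Complex.I)) oneT
        + mulOp (expMap 0 (-(μ * Complex.I))) oneT)))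
      + coef 0 (mulOp (expMap (-μ) 0) ((1 / 2 : ℂ) • (mulOp (expMap 0 (μ * Complex.I)) oneT
        + mulOp (expMap 0 (-(μ * Complex.I))) oneT)))) / 2 = 1 := by
  simp only [map_smul, map_add, ← mulOp_mul, expMap_mul, add_zero, zero_add]
  rw [coef_zero_expMap μ (Or.inl rfl), coef_zero_expMap μ (Or.inr rfl),
    coef_zero_expMap (-μ) (Or.inr (by ring)), coef_zero_expMap (-μ) (Or.inl (by ring))]
  norm_num

/-! ## Transfer between the interval and the circle -/

theorem fourier_one_coe (x : ℝ) : (fourier 1 (x : Torus) : ℂ) = Complex.exp (x * Complex.I) := by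
  rw [fourier_coe_apply]
  congr 1
  push_cast
  have : (Real.pi : ℂ) ≠ 0 := by exact_mod_cast Real.pi_ne_zero
  field_simp

theorem cosT_coe (x : ℝ) : cosT (x : Torus) = Real.cos x := by
  rw [cosT, fourier_one_coe, Complex.exp_ofReal_mul_I_re]

theorem sinT_coe (x : ℝ) : sinT (x : Torus) = Real.sin x := by
  rw [sinT, fourier_one_coe, Complex.exp_ofReal_mul_I_im]

theorem cosT_neg (θ : Torus) : cosT (-θ) = cosT θ := by
  induction θ using QuotientAddGroup.induction_on with
  | H x => rw [← AddCircle.coe_neg, cosT_coe, cosT_coe, Real.cos_neg]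

theorem sinT_neg (θ : Torus) : sinT (-θ) = -sinT θ := by
  induction θ using QuotientAddGroup.induction_on with
  | H x => rw [← AddCircle.coe_neg, sinT_coe, sinT_coe, Real.sin_neg]

theorem root_cosT (θ : Torus) : root (cosT θ) = |sinT θ| := by
  rw [root, ← cosT_sq_add_sinT_sq θ, add_sub_cancel_left, Real.sqrt_sq_eq_abs]

theorem root_sq {t : ℝ} (ht : t ∈ Ioo (-1 : ℝ) 1) : root t ^ 2 = 1 - t ^ 2 :=
  Real.sq_sqrt (by nlinarith [ht.1, ht.2])

/-- The fibre of the cosine through θ is {θ, -θ}; this is how functions of prescribed parity descend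
to the interval. -/
theorem arccos_cosT (θ : Torus) :
    (Real.arccos (cosT θ) : Torus) = θ ∨ (Real.arccos (cosT θ) : Torus) = -θ := by
  obtain ⟨x, hx, rfl⟩ : ∃ x : ℝ, x ∈ Ioc (-Real.pi) Real.pi ∧ (x : Torus) = θ := by
    have h := AddCircle.coe_image_Ioc_eq (2 * Real.pi) (-Real.pi)
    have : θ ∈ (fun x : ℝ => (x : Torus)) '' Ioc (-Real.pi) (-Real.pi + 2 * Real.pi) := by
      rw [h]; trivial
    obtain ⟨x, hx, rfl⟩ := this
    exact ⟨x, ⟨hx.1, by linarith [hx.2]⟩, rfl⟩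
  rw [cosT_coe]
  rcases le_total 0 x with h | h
  · left
    rw [Real.arccos_cos h hx.2]
  · right
    rw [← Real.cos_neg, Real.arccos_cos (by linarith) (by linarith [hx.1]), AddCircle.coe_neg]

theorem lintegral_haarT (F : Torus → ENNReal) :
    ∫⁻ θ, F θ ∂haarT = ENNReal.ofReal (1 / (2 * Real.pi)) *
      ∫⁻ x in Ioc (-Real.pi) Real.pi, F (x : Torus) := by
  have h := AddCircle.lintegral_preimage (2 * Real.pi) (-Real.pi) F
  rw [show -Real.pi + 2 * Real.pi = Real.pi by ring] at h
  rw [h, AddCircle.volume_eq_smul_haarAddCircle, lintegral_smul_measure, smul_eq_mul, ← mul_assoc,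
    ← ENNReal.ofReal_mul (by positivity)]
  have : 1 / (2 * Real.pi) * (2 * Real.pi) = 1 := by
    have := Real.pi_pos
    field_simp
  rw [this, ENNReal.ofReal_one, one_mul]

theorem measurable_root : Measurable root := continuous_root.measurable

theorem lintegral_measD {F : ℝ → ENNReal} (hF : Measurable F) :
    ∫⁻ t, F t ∂measD = ∫⁻ t in Ioo (-1 : ℝ) 1, ENNReal.ofReal (1 / (Real.pi * root t)) * F t := by
  have := measurable_root
  rw [measD, lintegral_withDensity_eq_lintegral_mul _ (by fun_prop) hF]
  rfl

/-- The Jacobian sin x of t = cos x cancels the weight 1/√(1 - t²). -/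
theorem lintegral_cos_upper (F : ℝ → ENNReal) :
    ∫⁻ t in Ioo (-1 : ℝ) 1, ENNReal.ofReal (1 / (Real.pi * root t)) * F t =
      ENNReal.ofReal (1 / Real.pi) * ∫⁻ x in Ioo 0 Real.pi, F (Real.cos x) := by
  have him : Real.cos '' Ioo 0 Real.pi = Ioo (-1 : ℝ) 1 := by
    ext t
    constructor
    · rintro ⟨x, hx, rfl⟩
      refine ⟨?_, ?_⟩
      · rw [← Real.cos_pi]
        exact Real.strictAntiOn_cos ⟨hx.1.le, hx.2.le⟩ ⟨Real.pi_pos.le, le_rfl⟩ hx.2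
      · rw [← Real.cos_zero]
        exact Real.strictAntiOn_cos ⟨le_rfl, Real.pi_pos.le⟩ ⟨hx.1.le, hx.2.le⟩ hx.1
    · intro ht
      refine ⟨Real.arccos t, ⟨Real.arccos_pos.2 ht.2, ?_⟩, Real.cos_arccos ht.1.le ht.2.le⟩
      refine lt_of_le_of_ne (Real.arccos_le_pi t) fun h => ?_
      rw [Real.arccos_eq_pi] at h
      exact absurd ht.1 (not_lt.2 h)
  rw [← him, lintegral_image_eq_lintegral_abs_deriv_mul measurableSet_Ioo
    (fun x _ => (Real.hasDerivAt_cos x).hasDerivWithinAt)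
    (Real.injOn_cos.mono Ioo_subset_Icc_self), ← lintegral_const_mul' _ _ ENNReal.ofReal_ne_top]
  refine setLIntegral_congr_fun measurableSet_Ioo fun x hx => ?_
  have hs : 0 < Real.sin x := Real.sin_pos_of_mem_Ioo hx
  have hr : root (Real.cos x) = Real.sin x := by
    rw [← cosT_coe, root_cosT, sinT_coe, abs_of_pos hs]
  rw [← mul_assoc, ← ENNReal.ofReal_mul (abs_nonneg _), hr, abs_neg, abs_of_pos hs]
  congr 2
  have := Real.pi_pos
  field_simp

/-- The two half circles contribute equally, which turns the factor 1/(2π) of Haar measure into 1/π.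
-/
theorem lintegral_comp_cosT {F : ℝ → ENNReal} (hF : Measurable F) :
    ∫⁻ θ, F (cosT θ) ∂haarT = ∫⁻ t, F t ∂measD := by
  rw [lintegral_haarT, lintegral_measD hF, lintegral_cos_upper]
  have hpi := Real.pi_pos
  simp only [cosT_coe]
  have hsplit : ∫⁻ x in Ioc (-Real.pi) Real.pi, F (Real.cos x) =
      2 * ∫⁻ x in Ioo 0 Real.pi, F (Real.cos x) := by
    rw [← Ioc_union_Ioc_eq_Ioc (neg_nonpos.2 hpi.le) hpi.le,
      lintegral_union measurableSet_Ioc (by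
        rw [Set.disjoint_left]; intro x hx hx'; exact absurd hx.2 (not_le.2 hx'.1)),
      two_mul, restrict_Ioo_eq_restrict_Ioc]
    congr 1
    have h := (Measure.measurePreserving_neg (volume : Measure ℝ)).setLIntegral_comp_preimage
      (s := Ico (0 : ℝ) Real.pi) measurableSet_Ico (f := fun x => F (Real.cos x))
      (hF.comp Real.measurable_cos)
    simp only [Real.cos_neg] at h
    rw [show (Neg.neg ⁻¹' Ico (0 : ℝ) Real.pi) = Ioc (-Real.pi) 0 by
      ext x; simp only [mem_preimage, mem_Ico, mem_Ioc]; constructor <;> rintro ⟨h1, h2⟩ <;>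
        constructor <;> linarith] at h
    rw [h, restrict_Ico_eq_restrict_Ioc]
  rw [hsplit, ← mul_assoc]
  congr 1
  rw [show (2 : ENNReal) = ENNReal.ofReal 2 by simp, ← ENNReal.ofReal_mul (by positivity)]
  congr 1
  field_simp

theorem measurePreserving_cosT : MeasurePreserving cosT haarT measD := by
  have hm := continuous_cosT.measurable
  refine ⟨hm, ?_⟩
  ext s hs
  rw [← lintegral_indicator_one hs, ← lintegral_indicator_one hs,
    lintegral_map (measurable_one.indicator hs) hm,
    lintegral_comp_cosT (measurable_one.indicator hs)]

instance : IsProbabilityMeasure measD := by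
  rw [← measurePreserving_cosT.map_eq]
  exact Measure.isProbabilityMeasure_map continuous_cosT.aemeasurable

theorem measD_ac : measD ≪ lebI := withDensity_absolutelyContinuous _ _

theorem measM_ac : measM ≪ lebI := withDensity_absolutelyContinuous _ _

theorem ae_mem_Ioo : ∀ᵐ t ∂lebI, t ∈ Ioo (-1 : ℝ) 1 := ae_restrict_mem measurableSet_Ioo

theorem ae_cosT {p : ℝ → Prop} (h : ∀ᵐ t ∂lebI, p t) : ∀ᵐ θ ∂haarT, p (cosT θ) :=
  measurePreserving_cosT.quasiMeasurePreserving.ae (measD_ac.ae_le h)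

theorem ae_eq_of_comp_cosT {f g : ℝ → ℂ} (hf : AEStronglyMeasurable f measD)
    (hg : AEStronglyMeasurable g measD)
    (h : ∀ᵐ θ ∂haarT, f (cosT θ) = g (cosT θ)) : f =ᵐ[lebI] g := by
  refine ac_measD.ae_le ?_
  have q := measurePreserving_cosT.quasiMeasurePreserving
  obtain ⟨f', hf', hff'⟩ := hf
  obtain ⟨g', hg', hgg'⟩ := hg
  have hm : ∀ᵐ t ∂measD, f' t = g' t := by
    rw [← measurePreserving_cosT.map_eq]
    refine (ae_map_iff continuous_cosT.aemeasurable (hf'.measurableSet_eq_fun hg')).2 ?_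
    filter_upwards [h, q.ae hff', q.ae hgg'] with θ h1 h2 h3
    rw [← h2, ← h3, h1]
  filter_upwards [hm, hff', hgg'] with t h1 h2 h3
  rw [h2, h3, h1]

theorem integral_comp_cosT {F : ℝ → ℂ} (hF : AEStronglyMeasurable F measD) :
    ∫ θ, F (cosT θ) ∂haarT = ∫ t, F t ∂measD := by
  rw [← measurePreserving_cosT.map_eq] at hF ⊢
  exact (integral_map continuous_cosT.aemeasurable hF).symm

theorem integral_measD (F : ℝ → ℂ) :
    ∫ t, F t ∂measD = 1 / (Real.pi : ℂ) * ∫ t, F t / (root t : ℂ) ∂lebI := by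
  have := measurable_root
  rw [measD, integral_withDensity_eq_integral_toReal_smul (by fun_prop) (by simp),
    ← integral_const_mul]
  refine integral_congr_ae ?_
  filter_upwards [ae_root_pos] with t ht
  have hpi := Real.pi_pos
  rw [ENNReal.toReal_ofReal (by positivity), Complex.real_smul]
  push_cast
  have : (Real.pi : ℂ) ≠ 0 := by exact_mod_cast hpi.ne'
  have : (root t : ℂ) ≠ 0 := by exact_mod_cast ht.ne'
  field_simp

theorem ae_sinT_ne_zero : ∀ᵐ θ ∂haarT, sinT θ ≠ 0 := by
  filter_upwards [ae_cosT ae_root_pos] with θ h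
  rw [root_cosT] at h
  exact abs_pos.1 h

/-! ### Weighted lifts -/

/-- `f ↦ w · (f ∘ cos)` is isometric from `L²(ν)` to `L²` of the circle. -/
structure IsWeight (w : Torus → ℂ) (ν : Measure ℝ) : Prop where
  measurable : Measurable w
  ae_ne_zero : ∀ᵐ θ ∂haarT, w θ ≠ 0
  ac : ν ≪ lebI
  ac' : lebI ≪ ν
  lintegral_eq : ∀ F : ℝ → ENNReal, Measurable F →
    ∫⁻ θ, ‖w θ‖ₑ ^ 2 * F (cosT θ) ∂haarT = ∫⁻ t, F t ∂ν

/-- The sign of the sine. -/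
def sgnT (θ : Torus) : ℂ := sinT θ / |sinT θ|

theorem isWeight_one : IsWeight (fun _ => 1) measD where
  measurable := measurable_const
  ae_ne_zero := by simp
  ac := measD_ac
  ac' := ac_measD
  lintegral_eq F hF := by simpa using lintegral_comp_cosT hF

theorem measurable_sgnT : Measurable sgnT := by
  have := continuous_sinT.measurable
  unfold sgnT
  fun_prop

theorem isWeight_sgnT : IsWeight sgnT measD where
  measurable := measurable_sgnT
  ae_ne_zero := by
    filter_upwards [ae_sinT_ne_zero] with θ h
    simpa [sgnT] using h
  ac := measD_ac
  ac' := ac_measD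
  lintegral_eq F hF := by
    rw [← lintegral_comp_cosT hF]
    refine lintegral_congr_ae ?_
    filter_upwards [ae_sinT_ne_zero] with θ h
    have : ‖sgnT θ‖ₑ = 1 := by
      rw [← ofReal_norm, sgnT, norm_div, Complex.norm_real, Complex.norm_real]
      simp [h]
    simp [this]

/-- The two weights differ by the factor 1 - t² = sin² θ; hence lifts from L²_m carry a weight of
modulus |sin θ|. -/
theorem lintegral_measM {F : ℝ → ENNReal} (hF : Measurable F) :
    ∫⁻ t, F t ∂measM = ∫⁻ t, ENNReal.ofReal (root t ^ 2) * F t ∂measD := by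
  have := measurable_root
  rw [measM, measD, lintegral_withDensity_eq_lintegral_mul _ (by fun_prop) hF,
    lintegral_withDensity_eq_lintegral_mul _ (by fun_prop) (by fun_prop)]
  refine lintegral_congr_ae ?_
  filter_upwards [ae_root_pos] with t ht
  have hpi := Real.pi_pos
  simp only [Pi.mul_apply]
  rw [← mul_assoc, ← ENNReal.ofReal_mul (by positivity)]
  congr 2
  field_simp

theorem isWeight_of_norm {w : Torus → ℂ} (hw : Measurable w) (h : ∀ θ, ‖w θ‖ = |sinT θ|) :
    IsWeight w measM where
  measurable := hw
  ae_ne_zero := by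
    filter_upwards [ae_sinT_ne_zero] with θ h'
    rw [← norm_ne_zero_iff, h]
    simpa using h'
  ac := measM_ac
  ac' := ac_measM
  lintegral_eq F hF := by
    have hr := measurable_root
    rw [lintegral_measM hF, ← lintegral_comp_cosT (by fun_prop)]
    refine lintegral_congr fun θ => ?_
    rw [← ofReal_norm, h, root_cosT, ENNReal.ofReal_pow (abs_nonneg _)]

theorem isWeight_sinT : IsWeight (fun θ => (sinT θ : ℂ)) measM :=
  isWeight_of_norm (by have := continuous_sinT.measurable; fun_prop) fun θ => by simp

theorem isWeight_abs_sinT : IsWeight (fun θ => ((|sinT θ| : ℝ) : ℂ)) measM :=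
  isWeight_of_norm (by have := continuous_sinT.measurable; fun_prop) fun θ => by simp

namespace IsWeight

variable {w : Torus → ℂ} {ν : Measure ℝ}

theorem ae_comp (h : IsWeight w ν) {p : ℝ → Prop} (hp : ∀ᵐ t ∂ν, p t) :
    ∀ᵐ θ ∂haarT, p (cosT θ) := ae_cosT (h.ac'.ae_le hp)

theorem aestronglyMeasurable (h : IsWeight w ν) {f : ℝ → ℂ} (hf : AEStronglyMeasurable f ν) :
    AEStronglyMeasurable (fun θ => w θ * f (cosT θ)) haarT := by
  refine ⟨fun θ => w θ * hf.mk f (cosT θ), ?_, ?_⟩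
  · exact (h.measurable.mul
      (hf.stronglyMeasurable_mk.measurable.comp continuous_cosT.measurable)).stronglyMeasurable
  · filter_upwards [h.ae_comp hf.ae_eq_mk] with θ h1
    rw [h1]

theorem eLpNorm_eq (h : IsWeight w ν) {f : ℝ → ℂ} (hf : AEStronglyMeasurable f ν) :
    eLpNorm (fun θ => w θ * f (cosT θ)) 2 haarT = eLpNorm f 2 ν := by
  rw [eLpNorm_congr_ae hf.ae_eq_mk, eLpNorm_congr_ae (g := fun θ => w θ * hf.mk f (cosT θ))
    (by filter_upwards [h.ae_comp hf.ae_eq_mk] with θ h1; rw [h1])]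
  have hm := hf.stronglyMeasurable_mk.measurable
  rw [eLpNorm_eq_lintegral_rpow_enorm_toReal (by simp) (by simp),
    eLpNorm_eq_lintegral_rpow_enorm_toReal (by simp) (by simp)]
  congr 1
  simp only [ENNReal.toReal_ofNat, ENNReal.rpow_ofNat]
  rw [← h.lintegral_eq _ (by fun_prop)]
  refine lintegral_congr fun θ => ?_
  rw [enorm_mul, mul_pow]

theorem memLp (h : IsWeight w ν) {f : ℝ → ℂ} (hf : MemLp f 2 ν) :
    MemLp (fun θ => w θ * f (cosT θ)) 2 haarT :=
  ⟨h.aestronglyMeasurable hf.1, by rw [h.eLpNorm_eq hf.1]; exact hf.2⟩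

/-- `f ↦ w · (f ∘ cos)` as a linear isometry. -/
def lift (h : IsWeight w ν) : Lp ℂ 2 ν →ₗᵢ[ℂ] L2T where
  toFun f := (h.memLp (Lp.memLp f)).toLp
  map_add' f g := by
    rw [← MemLp.toLp_add]
    refine MemLp.toLp_congr _ _ ?_
    filter_upwards [h.ae_comp (Lp.coeFn_add f g)] with θ h1
    rw [h1, Pi.add_apply, Pi.add_apply, mul_add]
  map_smul' c f := by
    rw [RingHom.id_apply, ← MemLp.toLp_const_smul]
    refine MemLp.toLp_congr _ _ ?_
    filter_upwards [h.ae_comp (Lp.coeFn_smul c f)] with θ h1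
    rw [h1, Pi.smul_apply, Pi.smul_apply, smul_eq_mul, smul_eq_mul, mul_left_comm]
  norm_map' f := by
    change ‖(h.memLp (Lp.memLp f)).toLp‖ = ‖f‖
    rw [Lp.norm_toLp, h.eLpNorm_eq (Lp.aestronglyMeasurable f), Lp.norm_def]

theorem coeFn_lift (h : IsWeight w ν) (f : Lp ℂ 2 ν) :
    h.lift f =ᵐ[haarT] fun θ => w θ * f (cosT θ) := (h.memLp (Lp.memLp f)).coeFn_toLp

theorem exists_eq_mul_comp (h : IsWeight w ν) {g : L2T} {κ : ℂ} (hκ : κ ≠ 0)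
    (hw : ∀ θ, w (-θ) = κ * w θ) (hg : ∀ᵐ θ ∂haarT, g (-θ) = κ * g θ) :
    ∃ f : ℝ → ℂ, MemLp f 2 ν ∧ g =ᵐ[haarT] fun θ => w θ * f (cosT θ) := by
  have harc : Continuous fun t : ℝ => (Real.arccos t : Torus) :=
    (AddCircle.continuous_mk' _).comp Real.continuous_arccos
  -- The quotient g / w is even because g and w have the same parity, so it is determined by its
  -- values on the upper half circle.
  obtain ⟨f, hf⟩ : ∃ f : ℝ → ℂ, f = fun t => g (Real.arccos t : Torus) / w (Real.arccos t : Torus) :=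
    ⟨_, rfl⟩
  have hfm : Measurable f := by
    rw [hf]
    exact ((Lp.stronglyMeasurable g).measurable.comp harc.measurable).div
      (h.measurable.comp harc.measurable)
  have hfg : g =ᵐ[haarT] fun θ => w θ * f (cosT θ) := by
    filter_upwards [hg, h.ae_ne_zero] with θ h1 h2
    rw [hf]
    rcases arccos_cosT θ with h3 | h3
    · simp only [h3]
      field_simp
    · simp only [h3, h1, hw]
      field_simp
  refine ⟨f, ⟨hfm.aestronglyMeasurable, ?_⟩, hfg⟩
  rw [← h.eLpNorm_eq hfm.aestronglyMeasurable, ← eLpNorm_congr_ae hfg]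
  exact (Lp.memLp g).2

theorem exists_lift_eq (h : IsWeight w ν) {g : L2T} {κ : ℂ} (hκ : κ ≠ 0)
    (hw : ∀ θ, w (-θ) = κ * w θ) (hg : ∀ᵐ θ ∂haarT, g (-θ) = κ * g θ) :
    ∃ f : Lp ℂ 2 ν, h.lift f = g := by
  obtain ⟨f, hf, hfg⟩ := h.exists_eq_mul_comp hκ hw hg
  refine ⟨hf.toLp, Lp.ext ?_⟩
  filter_upwards [h.coeFn_lift hf.toLp, hfg, h.ae_comp hf.coeFn_toLp] with θ h1 h2 h3
  rw [h1, h2, h3]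

end IsWeight

/-! ### Reflection -/

theorem measurePreserving_negT : MeasurePreserving (fun θ : Torus => -θ) haarT haarT :=
  Measure.measurePreserving_neg haarT

/-- `f ↦ f(-θ)`. -/
def reflT : L2T →ₗᵢ[ℂ] L2T := Lp.compMeasurePreservingₗᵢ ℂ _ measurePreserving_negT

theorem coeFn_reflT (f : L2T) : reflT f =ᵐ[haarT] fun θ => f (-θ) :=
  Lp.coeFn_compMeasurePreserving f measurePreserving_negT

theorem coef_reflT (n : ℤ) (f : L2T) : coef n (reflT f) = coef (-n) f := by
  rw [coef_eq_integral, coef_eq_integral, ← integral_neg_eq_self _ haarT]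
  refine integral_congr_ae ?_
  filter_upwards [measurePreserving_negT.quasiMeasurePreserving.ae (coeFn_reflT f)] with θ h
  rw [h, neg_neg, fourier_apply, fourier_apply]
  simp

/-- Reflection sends frequency n to -n, and sgn is odd. -/
theorem hilb_reflT (f : L2T) : hilb (reflT f) = -reflT (hilb f) := by
  refine ext_coef fun n => ?_
  rw [map_neg, coef_reflT, coef_hilb, coef_hilb, coef_reflT, Int.sign_neg]
  push_cast
  ring

theorem reflT_mulOp {φ ψ : C(Torus, ℂ)} (h : ∀ θ, φ (-θ) = ψ θ) (f : L2T) :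
    reflT (mulOp φ f) = mulOp ψ (reflT f) := by
  refine Lp.ext ?_
  filter_upwards [coeFn_reflT (mulOp φ f), coeFn_mulOp ψ (reflT f), coeFn_reflT f,
    measurePreserving_negT.quasiMeasurePreserving.ae (coeFn_mulOp φ f)] with θ h1 h2 h3 h4
  rw [h1, h2, h3, h4, h]

theorem ae_neg_eq_of_reflT {g : L2T} {κ : ℂ} (h : reflT g = κ • g) :
    ∀ᵐ θ ∂haarT, g (-θ) = κ * g θ := by
  filter_upwards [coeFn_reflT g, Lp.coeFn_smul κ g] with θ h1 h2
  rw [← h1, h, h2, Pi.smul_apply, smul_eq_mul]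

theorem reflT_eq_of_ae {g : L2T} {κ : ℂ} {f : Torus → ℂ} (hg : g =ᵐ[haarT] f)
    (h : ∀ θ, f (-θ) = κ * f θ) : reflT g = κ • g := by
  refine Lp.ext ?_
  filter_upwards [coeFn_reflT g, Lp.coeFn_smul κ g, hg,
    measurePreserving_negT.quasiMeasurePreserving.ae hg] with θ h1 h2 h3 h4
  rw [h1, h2, h4, Pi.smul_apply, smul_eq_mul, h3, h]

theorem sgnT_neg (θ : Torus) : sgnT (-θ) = -1 * sgnT θ := by
  rw [sgnT, sgnT, sinT_neg, abs_neg]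
  push_cast
  ring

/-! ## Poisson integrals at Lebesgue points -/

/-- `δ / ((t - x)² + δ²)`. -/
def poissonK (δ x t : ℝ) : ℝ := δ / ((t - x) ^ 2 + δ ^ 2)

theorem poissonK_nonneg {δ : ℝ} (hδ : 0 < δ) (x t : ℝ) : 0 ≤ poissonK δ x t := by
  unfold poissonK; positivity

theorem poissonK_le {δ : ℝ} (hδ : 0 < δ) (x t : ℝ) : poissonK δ x t ≤ 1 / δ := by
  unfold poissonK
  rw [div_le_div_iff₀ (by positivity) hδ]
  nlinarith [sq_nonneg (t - x)]

theorem continuous_poissonK {δ : ℝ} (hδ : 0 < δ) (x : ℝ) : Continuous (poissonK δ x) := by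
  unfold poissonK
  exact continuous_const.div (by fun_prop) fun t => by positivity

theorem integrable_poissonK {δ : ℝ} (hδ : 0 < δ) (x : ℝ) : Integrable (poissonK δ x) := by
  have h := ((integrable_inv_one_add_sq.comp_mul_left' (R := δ⁻¹) (by positivity)).comp_sub_right
    x).const_mul δ⁻¹
  refine h.congr (ae_of_all _ fun t => ?_)
  simp only [poissonK]
  field_simp
  ring

/-- The mean of `‖F - F x‖` over the interval of radius `R` about `x`. -/
def meanOsc (F : ℝ → ℂ) (x R : ℝ) : ℝ := ⨍ t in Metric.closedBall x R, ‖F t - F x‖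

theorem ae_tendsto_meanOsc {F : ℝ → ℂ} (hF : Integrable F) :
    ∀ᵐ x, Tendsto (meanOsc F x) (𝓝[>] 0) (𝓝 0) := by
  filter_upwards [IsUnifLocDoublingMeasure.ae_tendsto_average_norm_sub volume
    hF.locallyIntegrable 1] with x hx
  refine hx (fun _ => x) id tendsto_id ?_
  filter_upwards [self_mem_nhdsWithin] with R hR
  exact Metric.mem_closedBall_self (by simpa using (le_of_lt hR))

theorem integrableOn_norm_sub {F : ℝ → ℂ} (hF : Integrable F) (x R : ℝ) :
    IntegrableOn (fun t => ‖F t - F x‖) (Metric.closedBall x R) :=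
  (hF.integrableOn.sub (integrableOn_const measure_closedBall_lt_top.ne)).norm

theorem meanOsc_eq (F : ℝ → ℂ) (x : ℝ) {R : ℝ} (hR : 0 < R) :
    meanOsc F x R = (1 / (2 * R)) * ∫ t in Metric.closedBall x R, ‖F t - F x‖ := by
  rw [meanOsc, setAverage_eq, smul_eq_mul, measureReal_def, Real.volume_closedBall,
    ENNReal.toReal_ofReal (by positivity), one_div]

theorem meanOsc_nonneg (F : ℝ → ℂ) (x : ℝ) {R : ℝ} (hR : 0 < R) : 0 ≤ meanOsc F x R := by
  rw [meanOsc_eq F x hR]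
  have := integral_nonneg (μ := volume.restrict (Metric.closedBall x R))
    (f := fun t => ‖F t - F x‖) fun t => norm_nonneg _
  positivity

theorem meanOsc_le {F : ℝ → ℂ} (hF : Integrable F) (x : ℝ) {R : ℝ} (hR : 0 < R) :
    meanOsc F x R ≤ (1 / (2 * R)) * (∫ t, ‖F t‖) + ‖F x‖ := by
  have h1 : ∫ t in Metric.closedBall x R, ‖F t - F x‖ ≤
      (∫ t, ‖F t‖) + 2 * R * ‖F x‖ := by
    calc ∫ t in Metric.closedBall x R, ‖F t - F x‖
        ≤ ∫ t in Metric.closedBall x R, (‖F t‖ + ‖F x‖) := by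
          refine integral_mono (integrableOn_norm_sub hF x R)
            (hF.norm.integrableOn.add (integrableOn_const measure_closedBall_lt_top.ne)) fun t => norm_sub_le _ _
      _ = (∫ t in Metric.closedBall x R, ‖F t‖) + 2 * R * ‖F x‖ := by
          rw [integral_add hF.norm.integrableOn (integrableOn_const measure_closedBall_lt_top.ne), setIntegral_const,
            measureReal_def, Real.volume_closedBall, ENNReal.toReal_ofReal (by positivity),
            smul_eq_mul]
      _ ≤ _ := by
          gcongr
          · exact ae_of_all _ fun t => norm_nonneg _
          · exact hF.norm
          · exact Measure.restrict_le_self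
  rw [meanOsc_eq F x hR]
  calc _ ≤ (1 / (2 * R)) * ((∫ t, ‖F t‖) + 2 * R * ‖F x‖) := by gcongr
    _ = _ := by field_simp

/-- Small radii are controlled by the Lebesgue point, large ones by the L¹ norm. The uniform bound
supplies the domination in `tendsto_poissonK_osc`. -/
theorem exists_meanOsc_le {F : ℝ → ℂ} (hF : Integrable F) {x : ℝ}
    (hx : Tendsto (meanOsc F x) (𝓝[>] 0) (𝓝 0)) : ∃ C, ∀ R, 0 < R → meanOsc F x R ≤ C := by
  have h1 : ∀ᶠ R in 𝓝[>] (0 : ℝ), meanOsc F x R < 1 := hx.eventually_lt_const one_pos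
  obtain ⟨R₀, hR₀, h2⟩ := mem_nhdsGT_iff_exists_Ioo_subset.1 h1
  have hR₀' : (0 : ℝ) < R₀ := hR₀
  have hI : 0 ≤ ∫ t, ‖F t‖ := integral_nonneg fun t => norm_nonneg _
  refine ⟨max 1 ((1 / (2 * R₀)) * (∫ t, ‖F t‖) + ‖F x‖), fun R hR => ?_⟩
  rcases lt_or_ge R R₀ with h | h
  · exact le_max_of_le_left (le_of_lt (h2 ⟨hR, h⟩))
  · refine le_max_of_le_right ((meanOsc_le hF x hR).trans ?_)
    gcongr

theorem exists_dyadic_poissonK_le {δ : ℝ} (hδ : 0 < δ) (x t : ℝ) :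
    ∃ k : ℕ, t ∈ Metric.closedBall x (2 ^ k * δ) ∧ poissonK δ x t ≤ 4 / δ * (1 / 4) ^ k := by
  have hex : ∃ k : ℕ, |t - x| ≤ 2 ^ k * δ := by
    obtain ⟨k, hk⟩ := pow_unbounded_of_one_lt (|t - x| / δ) (one_lt_two (α := ℝ))
    exact ⟨k, by rw [div_lt_iff₀ hδ] at hk; exact hk.le⟩
  classical
  -- Take the least k with |t - x| ≤ 2^k δ. If k = j + 1, then |t - x| > 2^j δ, so the kernel is at
  -- most 1 / (4^j δ) = (4/δ) 4^{-k}.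
  refine ⟨Nat.find hex, ?_, ?_⟩
  · rw [Metric.mem_closedBall, Real.dist_eq]; exact Nat.find_spec hex
  · rcases Nat.eq_zero_or_pos (Nat.find hex) with h | h
    · rw [h, pow_zero, mul_one]
      refine (poissonK_le hδ x t).trans ?_
      gcongr
      norm_num
    · obtain ⟨j, hj⟩ := Nat.exists_eq_succ_of_ne_zero h.ne'
      have h1 := Nat.find_min hex (m := j) (by omega)
      rw [not_le] at h1
      rw [hj, poissonK, Nat.succ_eq_add_one, div_le_iff₀ (by positivity)]
      have h2 : (2 ^ j * δ) ^ 2 ≤ (t - x) ^ 2 := by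
        rw [← sq_abs (t - x)]
        gcongr
      have h3 : ((1 : ℝ) / 4) ^ j * (2 ^ j) ^ 2 = 1 := by
        rw [← pow_mul, mul_comm j 2, pow_mul, ← mul_pow]; norm_num
      calc δ = 4 / δ * (1 / 4) ^ (j + 1) * (2 ^ j * δ) ^ 2 := by
            rw [pow_succ, mul_pow]
            field_simp
            linear_combination (-1 : ℝ) * h3
        _ ≤ 4 / δ * (1 / 4) ^ (j + 1) * ((t - x) ^ 2 + δ ^ 2) := by
            gcongr
            nlinarith [sq_nonneg δ]

/-- The kernel is majorised by the sum of (4/δ) 4^{-k} times the indicators of the balls of radius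
2^k δ. Each ball has length 2·2^k δ, which gives the coefficient 8·2^{-k}. -/
theorem lintegral_poissonK_le {F : ℝ → ℂ} (hF : Integrable F) (x : ℝ) {δ : ℝ} (hδ : 0 < δ) :
    ∫⁻ t, ENNReal.ofReal (poissonK δ x t * ‖F t - F x‖) ≤
      ∑' k : ℕ, ENNReal.ofReal (8 * (1 / 2) ^ k * meanOsc F x (2 ^ k * δ)) := by
  have hm : ∀ k : ℕ, ENNReal.ofReal (8 * (1 / 2) ^ k * meanOsc F x (2 ^ k * δ)) =
      ∫⁻ t, (Metric.closedBall x (2 ^ k * δ)).indicator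
        (fun t => ENNReal.ofReal (4 / δ * (1 / 4) ^ k * ‖F t - F x‖)) t := by
    intro k
    rw [lintegral_indicator Metric.isClosed_closedBall.measurableSet,
      ← ofReal_integral_eq_lintegral_ofReal ((integrableOn_norm_sub hF x _).const_mul _)
        (ae_of_all _ fun t => by positivity), integral_const_mul, meanOsc_eq F x (by positivity)]
    congr 1
    have h4 : ((1 : ℝ) / 4) ^ k = (1 / 2) ^ k * (1 / 2) ^ k := by
      rw [← mul_pow]; norm_num
    have h2 : ((1 : ℝ) / 2) ^ k * 2 ^ k = 1 := by rw [← mul_pow]; norm_num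
    have h2' : ((1 : ℝ) / 2) ^ k = 1 / 2 ^ k := by rw [div_pow, one_pow]
    rw [h4, h2']
    field_simp
    ring
  simp only [hm]
  have hmeas : ∀ k : ℕ, AEMeasurable ((Metric.closedBall x (2 ^ k * δ)).indicator
      (fun t => ENNReal.ofReal (4 / δ * (1 / 4) ^ k * ‖F t - F x‖))) volume := fun k =>
    (((hF.aestronglyMeasurable.sub aestronglyMeasurable_const).norm.aemeasurable.const_mul
      _).ennreal_ofReal).indicator Metric.isClosed_closedBall.measurableSet
  rw [← lintegral_tsum hmeas]
  refine lintegral_mono fun t => ?_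
  obtain ⟨k, hk, hk'⟩ := exists_dyadic_poissonK_le hδ x t
  refine le_trans ?_ (ENNReal.le_tsum k)
  rw [indicator_of_mem hk]
  refine ENNReal.ofReal_le_ofReal ?_
  gcongr

/-- The dyadic majorant of the Poisson integral of `‖F - F x‖` is summable. -/
theorem summable_meanOsc {F : ℝ → ℂ} {x C : ℝ} (hC : ∀ R, 0 < R → meanOsc F x R ≤ C)
    {δ : ℝ} (hδ : 0 < δ) :
    Summable fun k : ℕ => 8 * (1 / 2) ^ k * meanOsc F x (2 ^ k * δ) := by
  refine Summable.of_nonneg_of_le (fun k => ?_) (fun k => ?_)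
    ((summable_geometric_two.mul_left 8).mul_right C)
  · have := meanOsc_nonneg F x (R := 2 ^ k * δ) (by positivity)
    positivity
  · gcongr
    exact hC _ (by positivity)

theorem integrable_poissonK_mul {F : ℝ → ℂ} (hF : Integrable F) (x : ℝ) {δ : ℝ} (hδ : 0 < δ) :
    Integrable fun t => poissonK δ x t * ‖F t - F x‖ := by
  have h1 : Integrable fun t => (poissonK δ x t : ℂ) * (F t - F x) := by
    simp only [mul_sub]
    refine Integrable.sub ?_ ?_
    · refine hF.bdd_mul (c := 1 / δ) ?_ (ae_of_all _ fun t => ?_)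
      · exact (Complex.continuous_ofReal.comp (continuous_poissonK hδ x)).aestronglyMeasurable
      · rw [Complex.norm_real, Real.norm_eq_abs, abs_of_nonneg (poissonK_nonneg hδ x t)]
        exact poissonK_le hδ x t
    · exact (integrable_poissonK hδ x).ofReal.mul_const _
  refine h1.norm.congr (ae_of_all _ fun t => ?_)
  simp only [norm_mul, Complex.norm_real, Real.norm_eq_abs,
    abs_of_nonneg (poissonK_nonneg hδ x t)]

/-- For each fixed k the radius 2^k δ shrinks to 0 and the oscillation tends to 0. The geometric
factor permits dominated convergence in the dyadic sum. -/
theorem tendsto_poissonK_osc {F : ℝ → ℂ} (hF : Integrable F) {x : ℝ}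
    (hx : Tendsto (meanOsc F x) (𝓝[>] 0) (𝓝 0)) :
    Tendsto (fun δ => ∫ t, poissonK δ x t * ‖F t - F x‖) (𝓝[>] 0) (𝓝 0) := by
  obtain ⟨C, hC⟩ := exists_meanOsc_le hF hx
  have hS : Tendsto (fun δ : ℝ => ∑' k : ℕ, 8 * (1 / 2) ^ k * meanOsc F x (2 ^ k * δ)) (𝓝[>] 0)
      (𝓝 (∑' k : ℕ, (0 : ℝ))) := by
    refine tendsto_tsum_of_dominated_convergence
      (bound := fun k : ℕ => 8 * (1 / 2) ^ k * C)
      ((summable_geometric_two.mul_left 8).mul_right C) (fun k => ?_) ?_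
    · have h1 : Tendsto (fun δ : ℝ => (2 : ℝ) ^ k * δ) (𝓝[>] 0) (𝓝[>] 0) := by
        refine tendsto_nhdsWithin_iff.2 ⟨?_, ?_⟩
        · have : Tendsto (fun δ : ℝ => (2 : ℝ) ^ k * δ) (𝓝 0) (𝓝 (2 ^ k * 0)) :=
            tendsto_id.const_mul _
          rw [mul_zero] at this
          exact this.mono_left nhdsWithin_le_nhds
        · filter_upwards [self_mem_nhdsWithin] with δ hδ
          have : (0 : ℝ) < δ := hδ
          exact mul_pos (by positivity) this
      have h2 := (hx.comp h1).const_mul (8 * (1 / 2) ^ k)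
      rwa [mul_zero] at h2
    · filter_upwards [self_mem_nhdsWithin] with δ hδ k
      have hδ' : (0 : ℝ) < δ := hδ
      have h0 := meanOsc_nonneg F x (R := 2 ^ k * δ) (by positivity)
      rw [Real.norm_eq_abs, abs_of_nonneg (by positivity)]
      gcongr
      exact hC _ (by positivity)
  rw [tsum_zero] at hS
  refine tendsto_of_tendsto_of_tendsto_of_le_of_le' tendsto_const_nhds hS ?_ ?_
  · filter_upwards [self_mem_nhdsWithin] with δ hδ
    exact integral_nonneg fun t => mul_nonneg (poissonK_nonneg hδ x t) (norm_nonneg _)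
  · filter_upwards [self_mem_nhdsWithin] with δ hδ
    have hδ' : (0 : ℝ) < δ := hδ
    have h0 : ∀ k : ℕ, 0 ≤ 8 * (1 / 2) ^ k * meanOsc F x (2 ^ k * δ) := fun k => by
      have := meanOsc_nonneg F x (R := 2 ^ k * δ) (by positivity)
      positivity
    have h1 := lintegral_poissonK_le hF x hδ'
    rw [← ofReal_integral_eq_lintegral_ofReal (integrable_poissonK_mul hF x hδ')
      (ae_of_all _ fun t => mul_nonneg (poissonK_nonneg hδ' x t) (norm_nonneg _)),
      ← ENNReal.ofReal_tsum_of_nonneg h0 (summable_meanOsc hC hδ')] at h1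
    exact (ENNReal.ofReal_le_ofReal_iff (tsum_nonneg h0)).1 h1

/-- Kernels dominated by the Poisson kernel do not see `F - F x` at a Lebesgue point `x`. -/
theorem tendsto_kernel_osc {ι : Type*} {l : Filter ι} {δ : ι → ℝ} (hδ : Tendsto δ l (𝓝[>] 0))
    {D : ι → ℝ → ℂ} {C : ℝ} {x : ℝ}
    (hD : ∀ᶠ i in l, ∀ᵐ t, ‖D i t‖ ≤ C * poissonK (δ i) x t) {F : ℝ → ℂ} (hF : Integrable F)
    (hx : Tendsto (meanOsc F x) (𝓝[>] 0) (𝓝 0)) :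
    Tendsto (fun i => ∫ t, D i t * (F t - F x)) l (𝓝 0) := by
  have h1 := ((tendsto_poissonK_osc hF hx).comp hδ).const_mul C
  rw [mul_zero] at h1
  refine squeeze_zero_norm' ?_ h1
  have hpos : ∀ᶠ i in l, 0 < δ i := (tendsto_nhdsWithin_iff.1 hδ).2
  filter_upwards [hD, hpos] with i hi hi'
  simp only [Function.comp]
  rw [← integral_const_mul]
  refine norm_integral_le_of_norm_le ((integrable_poissonK_mul hF x hi').const_mul C) ?_
  filter_upwards [hi] with t ht
  rw [norm_mul, ← mul_assoc]
  gcongr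

/-! ### Truncated kernels -/

/-- The difference of a smooth regularisation of `1 / (x - t)` and its truncation. -/
def truncDiff (δ x t : ℝ) : ℝ :=
  (x - t) / ((x - t) ^ 2 + δ ^ 2) - if δ < |t - x| then 1 / (x - t) else 0

/-- With u = x - t, outside the truncation the difference is -δ² / (u(u² + δ²)) and |u| > δ; inside
it is u / (u² + δ²) and |u| ≤ δ. -/
theorem abs_truncDiff_le {δ : ℝ} (hδ : 0 < δ) (x t : ℝ) :
    |truncDiff δ x t| ≤ poissonK δ x t := by
  rw [truncDiff, poissonK, ← neg_sub x t, abs_neg, neg_sq]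
  obtain ⟨u, hu⟩ : ∃ u, u = x - t := ⟨_, rfl⟩
  rw [← hu]
  split_ifs with h
  · have hu0 : u ≠ 0 := by rintro rfl; simp at h; linarith
    have : u / (u ^ 2 + δ ^ 2) - 1 / u = -(δ ^ 2 / (u * (u ^ 2 + δ ^ 2))) := by
      field_simp
      ring
    rw [this, abs_neg, abs_div, abs_mul, abs_of_pos (by positivity : 0 < δ ^ 2),
      abs_of_pos (by positivity : 0 < u ^ 2 + δ ^ 2), div_le_div_iff₀ (by positivity)
      (by positivity)]
    have : δ ^ 2 ≤ δ * |u| := by nlinarith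
    nlinarith [mul_le_mul_of_nonneg_right this (by positivity : 0 ≤ u ^ 2 + δ ^ 2)]
  · rw [sub_zero, abs_div, abs_of_pos (by positivity : 0 < u ^ 2 + δ ^ 2)]
    gcongr
    exact not_lt.1 h

theorem measurable_truncDiff (δ x : ℝ) : Measurable (truncDiff δ x) := by
  unfold truncDiff
  refine Measurable.sub (by fun_prop) (Measurable.ite ?_ (by fun_prop) measurable_const)
  exact measurableSet_lt measurable_const (by fun_prop)

/-- The kernel is odd about x. -/
theorem integral_truncDiff (δ x : ℝ) : ∫ t, truncDiff δ x t = 0 := by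
  have h1 : ∫ t, truncDiff δ x t = ∫ u, truncDiff δ 0 u := by
    rw [← integral_sub_right_eq_self (truncDiff δ 0) x]
    congr 1 with t
    simp only [truncDiff]
    rw [show 0 - (t - x) = x - t by ring, sub_zero]
  have h2 : ∫ u, truncDiff δ 0 u = -∫ u, truncDiff δ 0 u := by
    conv_lhs => rw [← integral_neg_eq_self]
    rw [← integral_neg]
    congr 1 with u
    simp only [truncDiff, sub_zero, zero_sub, neg_neg, abs_neg, neg_sq, neg_sub]
    split_ifs <;> ring
  rw [h1]
  linarith

theorem integrable_truncDiff {δ : ℝ} (hδ : 0 < δ) (x : ℝ) : Integrable (truncDiff δ x) :=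
  (integrable_poissonK hδ x).mono' (measurable_truncDiff δ x).aestronglyMeasurable
    (ae_of_all _ fun t => abs_truncDiff_le hδ x t)

/-- Since the kernel has mean zero, F may be replaced by F - F x, and then Poisson domination
suffices at a Lebesgue point. -/
theorem tendsto_truncDiff {F : ℝ → ℂ} (hF : Integrable F) {x : ℝ}
    (hx : Tendsto (meanOsc F x) (𝓝[>] 0) (𝓝 0)) :
    Tendsto (fun δ => ∫ t, (truncDiff δ x t : ℂ) * F t) (𝓝[>] 0) (𝓝 0) := by
  have h := tendsto_kernel_osc (l := 𝓝[>] (0 : ℝ)) (δ := id) tendsto_id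
    (D := fun δ t => (truncDiff δ x t : ℂ)) (C := 1) (x := x) (by
      filter_upwards [self_mem_nhdsWithin] with δ hδ
      refine ae_of_all _ fun t => ?_
      rw [Complex.norm_real, one_mul]
      exact abs_truncDiff_le hδ x t) hF hx
  refine h.congr' ?_
  filter_upwards [self_mem_nhdsWithin] with δ hδ
  have hi : Integrable fun t => ((truncDiff δ x t : ℝ) : ℂ) := (integrable_truncDiff hδ x).ofReal
  have hi' : Integrable fun t => ((truncDiff δ x t : ℝ) : ℂ) * F t := by
    refine hF.bdd_mul (c := 1 / δ) hi.aestronglyMeasurable (ae_of_all _ fun t => ?_)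
    rw [Complex.norm_real]
    exact (abs_truncDiff_le hδ x t).trans (poissonK_le hδ x t)
  have h0 : ∫ t, ((truncDiff δ x t : ℝ) : ℂ) = 0 := by
    rw [integral_complex_ofReal, integral_truncDiff, Complex.ofReal_zero]
  simp only [mul_sub]
  rw [integral_sub hi' (hi.mul_const _), integral_mul_const, h0, zero_mul, sub_zero]

/-! ## Abel means of the conjugation operator -/

/-- `1 / (1 - w e^{inθ})` as a continuous function, for `‖w‖ < 1`. -/
def cauchyMap (w : ℂ) (n : ℤ) : C(Torus, ℂ) := ∑' k : ℕ, (w • (fourier n : C(Torus, ℂ))) ^ k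

theorem hasSum_cauchyMap {w : ℂ} (hw : ‖w‖ < 1) (n : ℤ) :
    HasSum (fun k : ℕ => (w • (fourier n : C(Torus, ℂ))) ^ k) (cauchyMap w n) := by
  refine (summable_geometric_of_norm_lt_one ?_).hasSum
  rw [norm_smul, fourier_norm, mul_one]
  exact hw

theorem hasSum_cauchyMap' {w : ℂ} (hw : ‖w‖ < 1) (n : ℤ) :
    HasSum (fun k : ℕ => w ^ k • (fourier (k * n) : C(Torus, ℂ))) (cauchyMap w n) := by
  have h := hasSum_cauchyMap hw n
  simpa only [smul_pow, fourier_nsmul] using h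

theorem norm_fourier_apply (n : ℤ) (θ : Torus) : ‖(fourier n θ : ℂ)‖ = 1 := Circle.norm_coe _

theorem cauchyMap_apply {w : ℂ} (hw : ‖w‖ < 1) (n : ℤ) (θ : Torus) :
    cauchyMap w n θ = (1 - w * fourier n θ)⁻¹ := by
  have h := (ContinuousMap.evalCLM ℂ θ).hasSum (hasSum_cauchyMap hw n)
  have h2 := hasSum_geometric_of_norm_lt_one (ξ := w * fourier n θ) (by
    rw [norm_mul, norm_fourier_apply, mul_one]; exact hw)
  refine h.unique ?_
  have e : (fun k : ℕ => ContinuousMap.evalCLM ℂ θ ((w • (fourier n : C(Torus, ℂ))) ^ k))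
      = fun k => (w * fourier n θ) ^ k := by
    ext k; simp
  rw [e]
  exact h2

theorem coef_oneT_ne {n : ℤ} (hn : n ≠ 0) : coef n oneT = 0 := by rw [coef_expT, if_neg hn]

theorem coef_oneT : coef 0 oneT = 1 := by rw [coef_expT, if_pos rfl]

/-- The geometric series 1 / (1 - w e^{iθ}) has only nonnegative frequencies and constant term 1, so
conjugation of it is explicit. -/
theorem cauchyMap_pos {w : ℂ} (hw : ‖w‖ < 1) :
    coef 0 (mulOp (cauchyMap w 1) oneT) = 1 ∧
    hilb (mulOp (cauchyMap w 1) oneT) = Complex.I • (mulOp (cauchyMap w 1) oneT - oneT) := by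
  have h := hasSum_cauchyMap' hw 1
  simp only [mul_one] at h
  obtain ⟨h1, h2⟩ := coef_mulOp_of_nonneg h (f := oneT) fun n hn => coef_oneT_ne hn.ne
  rw [coef_oneT, pow_zero, mul_one] at h2
  exact ⟨h2, by rw [hilb_of_nonneg h1, h2, one_smul]⟩

theorem cauchyMap_neg {w : ℂ} (hw : ‖w‖ < 1) :
    coef 0 (mulOp (cauchyMap w (-1)) oneT) = 1 ∧
    hilb (mulOp (cauchyMap w (-1)) oneT) =
      -(Complex.I • (mulOp (cauchyMap w (-1)) oneT - oneT)) := by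
  have h := hasSum_cauchyMap' hw (-1)
  simp only [mul_neg, mul_one] at h
  obtain ⟨h1, h2⟩ := coef_mulOp_of_nonpos h (f := oneT) fun n hn => coef_oneT_ne hn.ne'
  rw [coef_oneT, pow_zero, mul_one] at h2
  exact ⟨h2, by rw [hilb_of_nonpos h1, h2, one_smul]⟩

/-! ### Poisson and conjugate Poisson kernels in the variable t = cos θ -/

/-- The common denominator of the Abel kernels. -/
def abelDen (η s t : ℝ) : ℝ := (s - t) ^ 2 + η * (η + 2 - 2 * s * t)

/-- The Poisson kernel of the interval. -/
def abelP (η s t : ℝ) : ℝ := √(η * (η + 2)) * (1 + η - s * t) / abelDen η s t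

/-- The conjugate Poisson kernel of the interval. -/
def abelK (η s t : ℝ) : ℝ := (s - t + η * s) / abelDen η s t

theorem abelDen_ge {η s t : ℝ} (hη : 0 < η) (ht : t ∈ Icc (-1 : ℝ) 1) :
    (s - t) ^ 2 + 2 * (1 - |s|) * η ≤ abelDen η s t := by
  have h1 : s * t ≤ |s| := by
    calc s * t ≤ |s * t| := le_abs_self _
      _ = |s| * |t| := abs_mul _ _
      _ ≤ |s| * 1 := by gcongr; exact abs_le.2 ht
      _ = |s| := mul_one _
  unfold abelDen
  nlinarith [mul_le_mul_of_nonneg_right h1 hη.le, sq_nonneg η]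

theorem one_sub_abs_pos {s : ℝ} (hs : s ∈ Ioo (-1 : ℝ) 1) : 0 < 1 - |s| := by
  have : |s| < 1 := abs_lt.2 hs
  linarith

theorem abelDen_pos {η s t : ℝ} (hη : 0 < η) (hs : s ∈ Ioo (-1 : ℝ) 1)
    (ht : t ∈ Icc (-1 : ℝ) 1) : 0 < abelDen η s t := by
  have := one_sub_abs_pos hs
  refine lt_of_lt_of_le ?_ (abelDen_ge hη ht)
  positivity

/-- The witness ρ = 1 + η - √(η(η + 2)) is the smaller root of ρ² - 2(1 + η)ρ + 1 = 0. Using η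
instead of ρ as parameter makes the kernels rational in s and t, apart from a factor √(η(η + 2)). -/
theorem exists_abel_radius {η : ℝ} (hη : 0 < η) :
    ∃ ρ : ℝ, 0 < ρ ∧ ρ < 1 ∧ (1 - ρ) ^ 2 = 2 * ρ * η ∧ 1 - ρ ^ 2 = 2 * ρ * √(η * (η + 2)) := by
  have hq : √(η * (η + 2)) ^ 2 = η * (η + 2) := Real.sq_sqrt (by positivity)
  have hq0 : 0 < √(η * (η + 2)) := Real.sqrt_pos.2 (by positivity)
  obtain ⟨q, hqq⟩ : ∃ q, q = √(η * (η + 2)) := ⟨_, rfl⟩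
  rw [← hqq] at hq hq0 ⊢
  refine ⟨1 + η - q, ?_, ?_, ?_, ?_⟩
  · nlinarith
  · nlinarith
  · nlinarith
  · nlinarith

/-- With s = cos φ and x = cos θ, the four terms are Cauchy kernels at ±θ ± φ. Their first
combination is the average of the Poisson kernels at θ + φ and θ - φ; the second is its conjugate.
The denominators a d and b c multiply to 4ρ² times `abelDen`. -/
theorem abel_kernels_aux {ρ η s t x y q : ℝ} (hρ : 0 < ρ)
    (h1 : (1 - ρ) ^ 2 = 2 * ρ * η) (h2 : 1 - ρ ^ 2 = 2 * ρ * q)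
    (hs : s ^ 2 + t ^ 2 = 1) (hx : x ^ 2 + y ^ 2 = 1)
    {a b c d : ℂ} (ha : a = 1 - (ρ * (s + t * Complex.I)) * (x + y * Complex.I))
    (hb : b = 1 - (ρ * (s - t * Complex.I)) * (x + y * Complex.I))
    (hc : c = 1 - (ρ * (s + t * Complex.I)) * (x - y * Complex.I))
    (hd : d = 1 - (ρ * (s - t * Complex.I)) * (x - y * Complex.I))
    (ha0 : a ≠ 0) (hb0 : b ≠ 0) (hc0 : c ≠ 0) (hd0 : d ≠ 0) :
    (1 / 2 : ℂ) * (a⁻¹ + b⁻¹ + c⁻¹ + d⁻¹) - 1 =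
        ((q * (1 + η - s * x) / abelDen η s x : ℝ) : ℂ) ∧
      Complex.I * (1 / 2 : ℂ) * (a⁻¹ + b⁻¹ - c⁻¹ - d⁻¹) = ((-(y * abelK η s x) : ℝ) : ℂ) := by
  have hI : Complex.I ^ 2 = -1 := Complex.I_sq
  have hs' : (s : ℂ) ^ 2 + (t : ℂ) ^ 2 = 1 := by exact_mod_cast hs
  have hx' : (x : ℂ) ^ 2 + (y : ℂ) ^ 2 = 1 := by exact_mod_cast hx
  have h1' : (1 - (ρ : ℂ)) ^ 2 = 2 * ρ * η := by exact_mod_cast h1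
  have h2' : 1 - (ρ : ℂ) ^ 2 = 2 * ρ * q := by exact_mod_cast h2
  have hρ' : (ρ : ℂ) ≠ 0 := by exact_mod_cast hρ.ne'
  have had : a * d = 1 - 2 * ρ * (s * x - t * y) + ρ ^ 2 := by
    rw [ha, hd]
    linear_combination (ρ : ℂ) ^ 2 * ((s : ℂ) ^ 2 + (t : ℂ) ^ 2) * hx' + (ρ : ℂ) ^ 2 * hs' +
      (-2 * (ρ : ℂ) * t * y - (ρ : ℂ) ^ 2 * s ^ 2 * y ^ 2 - (ρ : ℂ) ^ 2 * t ^ 2 * x ^ 2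
        + (ρ : ℂ) ^ 2 * t ^ 2 * y ^ 2 * (Complex.I ^ 2 - 1)) * hI
  have hbc : b * c = 1 - 2 * ρ * (s * x + t * y) + ρ ^ 2 := by
    rw [hb, hc]
    linear_combination (ρ : ℂ) ^ 2 * ((s : ℂ) ^ 2 + (t : ℂ) ^ 2) * hx' + (ρ : ℂ) ^ 2 * hs' +
      (2 * (ρ : ℂ) * t * y - (ρ : ℂ) ^ 2 * s ^ 2 * y ^ 2 - (ρ : ℂ) ^ 2 * t ^ 2 * x ^ 2
        + (ρ : ℂ) ^ 2 * t ^ 2 * y ^ 2 * (Complex.I ^ 2 - 1)) * hI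
  have hE : (a * d) * (b * c) = 4 * ρ ^ 2 * (abelDen η s x : ℂ) := by
    rw [had, hbc, abelDen]
    push_cast
    have hη : (η : ℂ) = (1 - ρ) ^ 2 / (2 * ρ) := by rw [h1']; field_simp
    have ht2 : (t : ℂ) ^ 2 = 1 - s ^ 2 := by linear_combination hs'
    have hy2 : (y : ℂ) ^ 2 = 1 - x ^ 2 := by linear_combination hx'
    have hty : (t : ℂ) ^ 2 * y ^ 2 = (1 - s ^ 2) * (1 - x ^ 2) := by rw [ht2, hy2]
    rw [hη]
    field_simp
    linear_combination (-16 * (ρ : ℂ) ^ 2) * hty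
  have hE0 : (abelDen η s x : ℂ) ≠ 0 := by
    intro h
    rw [h, mul_zero] at hE
    exact mul_ne_zero (mul_ne_zero ha0 hd0) (mul_ne_zero hb0 hc0) hE
  have hA0 := mul_ne_zero ha0 hd0
  have hB0 := mul_ne_zero hb0 hc0
  obtain ⟨A, hA⟩ : ∃ A, A = a * d := ⟨_, rfl⟩
  obtain ⟨B, hB⟩ : ∃ B, B = b * c := ⟨_, rfl⟩
  have ia : a⁻¹ = d / A := by rw [hA]; field_simp
  have id : d⁻¹ = a / A := by rw [hA]; field_simp
  have ib : b⁻¹ = c / B := by rw [hB]; field_simp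
  have ic : c⁻¹ = b / B := by rw [hB]; field_simp
  rw [← hA, ← hB] at hE
  rw [← hA] at had hA0
  rw [← hB] at hbc hB0
  have hE' : (abelDen η s x : ℂ) = A * B / (4 * ρ ^ 2) := by rw [hE]; field_simp
  have hη : (η : ℂ) = (1 - ρ) ^ 2 / (2 * ρ) := by rw [h1']; field_simp
  have hq : (q : ℂ) = (1 - ρ ^ 2) / (2 * ρ) := by rw [h2']; field_simp
  rw [ia, ib, ic, id]
  constructor
  · push_cast
    rw [hE', hη, hq, ha, hb, hc, hd]
    field_simp
    rw [had, hbc]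
    ring_nf
    simp only [hI]
    ring
  · rw [abelK]
    push_cast
    rw [hE', hη, ha, hb, hc, hd]
    field_simp
    rw [had, hbc]
    ring_nf
    simp only [hI]
    linear_combination (8 * (ρ : ℂ) ^ 2 * y * x) * hs'

theorem coeFn_oneT : (oneT : L2T) =ᵐ[haarT] fun _ => 1 := by
  filter_upwards [coeFn_fourierLp 2 0] with θ h
  rw [h, fourier_zero]

theorem coeFn_mulOp_oneT (φ : C(Torus, ℂ)) : mulOp φ oneT =ᵐ[haarT] φ := by
  filter_upwards [coeFn_mulOp φ oneT, coeFn_oneT] with θ h1 h2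
  rw [h1, h2, mul_one]

/-- The Poisson kernel of the interval, lifted to the circle, and its conjugate. -/
theorem exists_abel_vector {η s : ℝ} (hη : 0 < η) (hs : s ∈ Ioo (-1 : ℝ) 1) :
    ∃ p : L2T, coef 0 p = 1 ∧ (p =ᵐ[haarT] fun θ => (abelP η s (cosT θ) : ℂ)) ∧
      hilb p =ᵐ[haarT] fun θ => ((-(sinT θ * abelK η s (cosT θ)) : ℝ) : ℂ) := by
  obtain ⟨ρ, hρ, hρ1, h1, h2⟩ := exists_abel_radius hη
  have hrs := root_sq hs
  have hsr : s ^ 2 + root s ^ 2 = 1 := by rw [hrs]; ring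
  have hnorm : ∀ σ : ℝ, s ^ 2 + σ ^ 2 = 1 → ‖(ρ : ℂ) * (s + σ * Complex.I)‖ < 1 := by
    intro σ hσ
    rw [norm_mul, Complex.norm_add_mul_I, hσ, Real.sqrt_one, mul_one, Complex.norm_real,
      Real.norm_eq_abs, abs_of_pos hρ]
    exact hρ1
  have hw : ‖(ρ : ℂ) * (s + root s * Complex.I)‖ < 1 := hnorm _ hsr
  have hw' : ‖(ρ : ℂ) * (s - root s * Complex.I)‖ < 1 := by
    have := hnorm (-root s) (by rw [neg_sq, hsr])
    simpa [sub_eq_add_neg] using this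
  obtain ⟨w, hwe⟩ : ∃ w, w = (ρ : ℂ) * (s + root s * Complex.I) := ⟨_, rfl⟩
  obtain ⟨w', hwe'⟩ : ∃ w', w' = (ρ : ℂ) * (s - root s * Complex.I) := ⟨_, rfl⟩
  rw [← hwe] at hw
  rw [← hwe'] at hw'
  obtain ⟨a0, ah⟩ := cauchyMap_pos hw
  obtain ⟨b0, bh⟩ := cauchyMap_pos hw'
  obtain ⟨c0, ch⟩ := cauchyMap_neg hw
  obtain ⟨d0, dh⟩ := cauchyMap_neg hw'
  have fa := coeFn_mulOp_oneT (cauchyMap w 1)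
  have fb := coeFn_mulOp_oneT (cauchyMap w' 1)
  have fc := coeFn_mulOp_oneT (cauchyMap w (-1))
  have fd := coeFn_mulOp_oneT (cauchyMap w' (-1))
  have hne : ∀ {v : ℂ} (hv : ‖v‖ < 1) (n : ℤ) (θ : Torus), 1 - v * fourier n θ ≠ 0 := by
    intro v hv n θ h
    have : ‖v * fourier n θ‖ = 1 := by rw [← sub_eq_zero.1 h, norm_one]
    rw [norm_mul, norm_fourier_apply, mul_one] at this
    linarith
  have key := fun θ => abel_kernels_aux (q := √(η * (η + 2))) hρ h1 h2 hsr
    (cosT_sq_add_sinT_sq θ) (a := 1 - w * fourier 1 θ) (b := 1 - w' * fourier 1 θ)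
    (c := 1 - w * fourier (-1) θ) (d := 1 - w' * fourier (-1) θ)
    (by rw [hwe, fourier_one_eq]) (by rw [hwe', fourier_one_eq])
    (by rw [hwe, fourier_neg_one_eq]) (by rw [hwe', fourier_neg_one_eq])
    (hne hw 1 θ) (hne hw' 1 θ) (hne hw (-1) θ) (hne hw' (-1) θ)
  obtain ⟨A, hA⟩ : ∃ A, A = mulOp (cauchyMap w 1) oneT := ⟨_, rfl⟩
  obtain ⟨B, hB⟩ : ∃ B, B = mulOp (cauchyMap w' 1) oneT := ⟨_, rfl⟩
  obtain ⟨C, hC⟩ : ∃ C, C = mulOp (cauchyMap w (-1)) oneT := ⟨_, rfl⟩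
  obtain ⟨D, hD⟩ : ∃ D, D = mulOp (cauchyMap w' (-1)) oneT := ⟨_, rfl⟩
  rw [← hA] at a0 ah fa
  rw [← hB] at b0 bh fb
  rw [← hC] at c0 ch fc
  rw [← hD] at d0 dh fd
  have hh1 : hilb (oneT : L2T) = 0 := by
    rw [hilb_of_nonneg fun n hn => coef_oneT_ne hn.ne, coef_oneT, one_smul, sub_self, smul_zero]
  -- Conjugation acts on `A`, `B` as i and on `C`, `D` as -i, up to constants; the constants cancel
  -- in the sum.
  refine ⟨(1 / 2 : ℂ) • (A + B + C + D) - oneT, ?_, ?_, ?_⟩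
  · rw [map_sub, map_smul, map_add, map_add, map_add, a0, b0, c0, d0, coef_oneT]
    norm_num
  · filter_upwards [Lp.coeFn_sub ((1 / 2 : ℂ) • (A + B + C + D)) oneT,
      Lp.coeFn_smul (1 / 2 : ℂ) (A + B + C + D), Lp.coeFn_add (A + B + C) D,
      Lp.coeFn_add (A + B) C, Lp.coeFn_add A B, fa, fb, fc, fd, coeFn_oneT]
      with θ e1 e2 e3 e4 e5 e6 e7 e8 e9 e10
    rw [e1, Pi.sub_apply, e2, Pi.smul_apply, e3, Pi.add_apply, e4, Pi.add_apply, e5, Pi.add_apply,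
      e6, e7, e8, e9, e10, cauchyMap_apply hw, cauchyMap_apply hw', cauchyMap_apply hw,
      cauchyMap_apply hw', smul_eq_mul, (key θ).1]
    rfl
  · have e : hilb ((1 / 2 : ℂ) • (A + B + C + D) - oneT) =
        (Complex.I * (1 / 2) : ℂ) • (A + B - C - D) := by
      rw [map_sub, map_smul, map_add, map_add, map_add, ah, bh, ch, dh, hh1]
      module
    rw [e]
    filter_upwards [Lp.coeFn_smul (Complex.I * (1 / 2) : ℂ) (A + B - C - D),
      Lp.coeFn_sub (A + B - C) D, Lp.coeFn_sub (A + B) C, Lp.coeFn_add A B, fa, fb, fc, fd]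
      with θ e1 e2 e3 e4 e5 e6 e7 e8
    rw [e1, Pi.smul_apply, e2, Pi.sub_apply, e3, Pi.sub_apply, e4, Pi.add_apply,
      e5, e6, e7, e8, cauchyMap_apply hw, cauchyMap_apply hw', cauchyMap_apply hw,
      cauchyMap_apply hw', smul_eq_mul, (key θ).2]

theorem measurable_abelP (η s : ℝ) : Measurable (abelP η s) := by
  unfold abelP abelDen; fun_prop

theorem measurable_abelK (η s : ℝ) : Measurable (abelK η s) := by
  unfold abelK abelDen; fun_prop

theorem integral_abelP {η s : ℝ} (hη : 0 < η) (hs : s ∈ Ioo (-1 : ℝ) 1) :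
    ∫ t, (abelP η s t : ℂ) ∂measD = 1 := by
  have hm := measurable_abelP η s
  obtain ⟨p, h0, hp, -⟩ := exists_abel_vector hη hs
  rw [← integral_comp_cosT (F := fun t => (abelP η s t : ℂ))
    (by fun_prop : Measurable fun t => (abelP η s t : ℂ)).aestronglyMeasurable, ← h0,
    coef_eq_integral]
  refine integral_congr_ae ?_
  filter_upwards [hp] with θ h
  rw [h]
  simp

/-- Skew-adjointness of `hilb`, applied to the Poisson vector and g. The factor sin θ in the
conjugate kernel meets the sign weight to give √(1 - t²), which cancels the density of `measD`. -/
theorem integral_abelP_mul {η s : ℝ} (hη : 0 < η) (hs : s ∈ Ioo (-1 : ℝ) 1) {f h : ℝ → ℂ}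
    (hf : AEStronglyMeasurable f measD) (hh : AEStronglyMeasurable h measD) {g : L2T}
    (hg : g =ᵐ[haarT] fun θ => sgnT θ * f (cosT θ))
    (hk : hilb g =ᵐ[haarT] fun θ => h (cosT θ)) :
    ∫ t, (abelP η s t : ℂ) * h t ∂measD =
      1 / (Real.pi : ℂ) * ∫ t, (abelK η s t : ℂ) * f t ∂lebI := by
  have hm := measurable_abelP η s
  have hmK := measurable_abelK η s
  have hr := measurable_root
  obtain ⟨p, h0, hp, hp'⟩ := exists_abel_vector hη hs
  have key := inner_hilb p g
  rw [L2.inner_def, L2.inner_def] at key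
  have e1 : ∫ t, (abelP η s t : ℂ) * h t ∂measD = ∫ θ, inner ℂ (p θ) (hilb g θ) ∂haarT := by
    rw [← integral_comp_cosT (F := fun t => (abelP η s t : ℂ) * h t)
      ((by fun_prop : Measurable fun t => (abelP η s t : ℂ)).aestronglyMeasurable.mul hh)]
    refine integral_congr_ae ?_
    filter_upwards [hp, hk] with θ h1 h2
    rw [h1, h2, RCLike.inner_apply, Complex.conj_ofReal, mul_comm]
  have e2 : ∫ t, ((root t * abelK η s t : ℝ) : ℂ) * f t ∂measD =
      -∫ θ, inner ℂ (hilb p θ) (g θ) ∂haarT := by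
    rw [← integral_comp_cosT (F := fun t => ((root t * abelK η s t : ℝ) : ℂ) * f t)
      ((by fun_prop : Measurable fun t =>
        ((root t * abelK η s t : ℝ) : ℂ)).aestronglyMeasurable.mul hf), ← integral_neg]
    refine integral_congr_ae ?_
    filter_upwards [hp', hg, ae_sinT_ne_zero] with θ h1 h2 h3
    rw [h1, h2, RCLike.inner_apply, Complex.conj_ofReal, root_cosT, sgnT]
    have h4 : ((|sinT θ| : ℝ) : ℂ) ≠ 0 := by exact_mod_cast abs_ne_zero.2 h3
    have h5 : ((|sinT θ| : ℝ) : ℂ) ^ 2 = (sinT θ : ℂ) ^ 2 := by exact_mod_cast sq_abs (sinT θ)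
    push_cast
    field_simp
    rw [h5]
    ring
  rw [e1, key, ← e2, integral_measD]
  congr 1
  refine integral_congr_ae ?_
  filter_upwards [ae_root_pos] with t ht
  have : (root t : ℂ) ≠ 0 := by exact_mod_cast ht.ne'
  push_cast
  field_simp

/-! ### Kernel comparisons -/

/-- The denominator is comparable to (t - s)² + η, so the natural Poisson scale is √η. For η < 1 the
numerator is at most 2√η · 3. The constant degenerates only as s approaches ±1. -/
theorem abs_abelP_le {η s t : ℝ} (hη : 0 < η) (hη1 : η < 1) (hs : s ∈ Ioo (-1 : ℝ) 1)
    (ht : t ∈ Icc (-1 : ℝ) 1) :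
    |abelP η s t| ≤ 6 / min 1 (2 * (1 - |s|)) * poissonK (√η) s t := by
  have hm := one_sub_abs_pos hs
  have hE := abelDen_ge (s := s) hη ht
  have hE0 := abelDen_pos hη hs ht
  obtain ⟨m, hmm⟩ : ∃ m, m = min 1 (2 * (1 - |s|)) := ⟨_, rfl⟩
  have hm0 : 0 < m := by rw [hmm]; positivity
  have hm1 : m ≤ 1 := by rw [hmm]; exact min_le_left _ _
  have hm2 : m ≤ 2 * (1 - |s|) := by rw [hmm]; exact min_le_right _ _
  have hst : |s * t| ≤ 1 := by
    rw [abs_mul]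
    exact mul_le_one₀ (abs_le.2 ⟨hs.1.le, hs.2.le⟩) (abs_nonneg _) (abs_le.2 ht)
  have hst' := abs_le.1 hst
  have hq : √(η * (η + 2)) ≤ 2 * √η := by
    rw [show (2 : ℝ) * √η = √(4 * η) by
      rw [Real.sqrt_mul (by norm_num), show (4 : ℝ) = 2 ^ 2 by norm_num, Real.sqrt_sq (by norm_num)]]
    exact Real.sqrt_le_sqrt (by nlinarith)
  have hnum : 0 ≤ 1 + η - s * t := by linarith
  have hden : m * ((t - s) ^ 2 + η) ≤ abelDen η s t := by
    nlinarith [sq_nonneg (t - s)]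
  rw [← hmm, abelP, poissonK, Real.sq_sqrt hη.le,
    abs_of_nonneg (div_nonneg (mul_nonneg (Real.sqrt_nonneg _) hnum) hE0.le)]
  calc √(η * (η + 2)) * (1 + η - s * t) / abelDen η s t
      ≤ 2 * √η * 3 / (m * ((t - s) ^ 2 + η)) := by
        gcongr
        linarith
    _ = 6 / m * (√η / ((t - s) ^ 2 + η)) := by field_simp; norm_num

/-- The two denominators differ by η(η + 2s(s - t)). Each of η and (s - t)² is bounded by a multiple
of either denominator, so the difference of the fractions stays bounded uniformly in η and t.
Together with pointwise convergence this allows dominated convergence. -/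
theorem abs_abelK_sub_le {η s t : ℝ} (hη : 0 < η) (hη1 : η < 1) (hs : s ∈ Ioo (-1 : ℝ) 1)
    (ht : t ∈ Icc (-1 : ℝ) 1) :
    |abelK η s t - (s - t) / ((s - t) ^ 2 + 2 * η * (1 - s ^ 2))| ≤
      1 / (2 * (1 - |s|)) + 1 / (2 * (1 - |s|) ^ 2) + 1 / (1 - |s|) := by
  have hm := one_sub_abs_pos hs
  have hE := abelDen_ge (s := s) hη ht
  have hE0 := abelDen_pos hη hs ht
  obtain ⟨m, hmm⟩ : ∃ m, m = 1 - |s| := ⟨_, rfl⟩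
  rw [← hmm] at hm hE ⊢
  have hsq : m ≤ 1 - s ^ 2 := by
    rw [hmm, ← sq_abs s]
    nlinarith [abs_nonneg s]
  obtain ⟨E', hE'⟩ : ∃ E', E' = (s - t) ^ 2 + 2 * η * (1 - s ^ 2) := ⟨_, rfl⟩
  have hE'1 : (s - t) ^ 2 + 2 * m * η ≤ E' := by rw [hE']; nlinarith
  have hE'0 : 0 < E' := by
    have : 0 < 2 * m * η := by positivity
    nlinarith [sq_nonneg (s - t)]
  have hdiff : abelDen η s t - E' = η * (η + 2 * s * (s - t)) := by rw [hE', abelDen]; ring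
  rw [← hE', abelK]
  obtain ⟨E, hEE⟩ : ∃ E, E = abelDen η s t := ⟨_, rfl⟩
  rw [← hEE] at hE hE0 hdiff ⊢
  obtain ⟨u, hu⟩ : ∃ u, u = s - t := ⟨_, rfl⟩
  have hu2 : |u| ≤ 2 := by rw [hu]; exact abs_le.2 ⟨by linarith [hs.1, ht.2], by linarith [hs.2, ht.1]⟩
  rw [← hu] at hE hE'1 hdiff ⊢
  have heq : (u + η * s) / E - u / E' = (η * s * E' - u * (η * (η + 2 * s * u))) / (E * E') := by
    rw [← hdiff]
    field_simp
    ring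
  have hs1 : |s| ≤ 1 := by linarith
  have hηE : η ≤ E / (2 * m) := by
    rw [le_div_iff₀ (by positivity)]; nlinarith [sq_nonneg u]
  have hηE' : η ≤ E' / (2 * m) := by
    rw [le_div_iff₀ (by positivity)]; nlinarith [sq_nonneg u]
  have huE' : u ^ 2 ≤ E' := by
    have : 0 < 2 * m * η := by positivity
    linarith
  have hnum : |η * s * E' - u * (η * (η + 2 * s * u))| ≤ η * E' + (2 * (η * η) + 2 * (η * u ^ 2)) := by
    have t1 : |η * s * E'| ≤ η * E' := by
      rw [abs_mul, abs_mul, abs_of_pos hη, abs_of_pos hE'0]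
      nlinarith [mul_pos hη hE'0]
    have t2 : |u * (η * (η + 2 * s * u))| ≤ 2 * (η * η) + 2 * (η * u ^ 2) := by
      rw [show u * (η * (η + 2 * s * u)) = u * (η * η) + s * (2 * (η * u ^ 2)) by ring]
      refine (abs_add_le _ _).trans ?_
      rw [abs_mul, abs_mul s, abs_of_nonneg (by positivity : 0 ≤ η * η),
        abs_of_nonneg (by positivity : 0 ≤ 2 * (η * u ^ 2))]
      have : 0 ≤ 2 * (η * u ^ 2) := by positivity
      have : 0 ≤ η * η := by positivity
      nlinarith
    exact (abs_sub _ _).trans (add_le_add t1 t2)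
  rw [heq, abs_div, abs_of_pos (mul_pos hE0 hE'0), div_le_iff₀ (mul_pos hE0 hE'0)]
  refine hnum.trans ?_
  have b1 : η * E' ≤ E / (2 * m) * E' := by gcongr
  have b2 : η * η ≤ E / (2 * m) * (E' / (2 * m)) := by gcongr
  have b3 : η * u ^ 2 ≤ E / (2 * m) * E' := by gcongr
  calc η * E' + (2 * (η * η) + 2 * (η * u ^ 2))
      ≤ E / (2 * m) * E' + (2 * (E / (2 * m) * (E' / (2 * m))) + 2 * (E / (2 * m) * E')) := by
        gcongr
    _ = _ := by field_simp; ring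

theorem tendsto_abelK_sub {s t : ℝ} (hst : t ≠ s) :
    Tendsto (fun η => abelK η s t - (s - t) / ((s - t) ^ 2 + 2 * η * (1 - s ^ 2))) (𝓝 0) (𝓝 0) := by
  have h0 : (s - t) ^ 2 ≠ 0 := pow_ne_zero 2 (sub_ne_zero.2 hst.symm)
  have h : ContinuousAt
      (fun η => abelK η s t - (s - t) / ((s - t) ^ 2 + 2 * η * (1 - s ^ 2))) 0 := by
    unfold abelK abelDen
    refine ContinuousAt.sub (ContinuousAt.div (by fun_prop) (by fun_prop) ?_)
      (ContinuousAt.div (by fun_prop) (by fun_prop) ?_)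
    · simpa using h0
    · simpa using h0
  have h2 := h.tendsto
  simpa [abelK, abelDen] using h2

/-! ## Almost everywhere existence of principal values -/

theorem integrable_of_memLp_measD {f : ℝ → ℂ} (hf : MemLp f 2 measD) : Integrable f lebI := by
  have hr := measurable_root
  have hrc := continuous_root
  have h := integrable_mul_of_memLp (w := fun t => 1 / (Real.pi * root t)) (k := fun _ => 1)
    (by fun_prop) (ae_root_pos.mono fun t ht => by have := Real.pi_pos; positivity)
    measurable_const ?_ hf
  · simpa using h
  · refine (integrable_bdd_div_root (c := fun t => Real.pi * root t ^ 2) (by fun_prop)).congr ?_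
    filter_upwards [ae_root_pos] with t ht
    simp
    field_simp

theorem integrable_div_root_of_memLp_measD {f : ℝ → ℂ} (hf : MemLp f 2 measD) :
    Integrable (fun t => f t / (root t : ℂ)) lebI := by
  have hr := measurable_root
  have h := integrable_mul_of_memLp (w := fun t => 1 / (Real.pi * root t))
    (k := fun t => 1 / (root t : ℂ))
    (by fun_prop) (ae_root_pos.mono fun t ht => by have := Real.pi_pos; positivity)
    (by fun_prop) ?_ hf
  · refine h.congr (ae_of_all _ fun t => ?_)
    simp only
    ring
  · refine (integrable_bdd_div_root (c := fun t => Real.pi) (by fun_prop)).congr ?_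
    filter_upwards [ae_root_pos] with t ht
    simp only [norm_div, norm_one, Complex.norm_real, Real.norm_eq_abs, abs_of_pos ht]
    field_simp

theorem integrable_of_memLp_measM {f : ℝ → ℂ} (hf : MemLp f 2 measM) : Integrable f lebI := by
  have hr := measurable_root
  have h := integrable_mul_of_memLp (w := fun t => root t / Real.pi) (k := fun _ => 1)
    (by fun_prop) (ae_root_pos.mono fun t ht => div_pos ht Real.pi_pos)
    measurable_const ?_ hf
  · simpa using h
  · refine (integrable_bdd_div_root (c := fun t => Real.pi) (by fun_prop)).congr ?_
    filter_upwards [ae_root_pos] with t ht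
    simp
    field_simp

/-- The punctured interval `{t ∈ (-1, 1) : ε < |t - x|}`. -/
abbrev punctured (x ε : ℝ) : Set ℝ := {t : ℝ | t ∈ Ioo (-1 : ℝ) 1 ∧ ε < |t - x|}

theorem measurableSet_punctured (x ε : ℝ) : MeasurableSet (punctured x ε) :=
  measurableSet_Ioo.inter (measurableSet_lt measurable_const
    (by fun_prop : Measurable fun t : ℝ => |t - x|))

theorem integrableOn_cauchy {f : ℝ → ℂ} (hf : Integrable f lebI) (x : ℝ) {ε : ℝ} (hε : 0 < ε) :
    IntegrableOn (fun t : ℝ => 1 / ((x : ℂ) - t) * f t) (punctured x ε) := by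
  have h1 : IntegrableOn f (punctured x ε) := by
    have h2 : IntegrableOn f (Ioo (-1 : ℝ) 1) := hf
    exact h2.mono_set fun t ht => ht.1
  refine Integrable.bdd_mul (c := 1 / ε) h1
    (by fun_prop : Measurable fun t : ℝ => 1 / ((x : ℂ) - t)).aestronglyMeasurable ?_
  filter_upwards [ae_restrict_mem (measurableSet_punctured x ε)] with t ht
  rw [norm_div, norm_one, ← Complex.ofReal_sub, Complex.norm_real, Real.norm_eq_abs, abs_sub_comm]
  gcongr
  exact ht.2.le

theorem hasPV_linear {f₁ f₂ : ℝ → ℂ} (h₁ : Integrable f₁ lebI) (h₂ : Integrable f₂ lebI)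
    {x : ℝ} {L₁ L₂ : ℂ} (p₁ : HasPV (fun t => 1 / ((x : ℂ) - t) * f₁ t) x L₁)
    (p₂ : HasPV (fun t => 1 / ((x : ℂ) - t) * f₂ t) x L₂) (a b : ℂ) :
    HasPV (fun t => 1 / ((x : ℂ) - t) * (a * f₁ t + b * f₂ t)) x (a * L₁ + b * L₂) := by
  refine ((p₁.const_mul a).add (p₂.const_mul b)).congr' ?_
  filter_upwards [self_mem_nhdsWithin] with ε hε
  rw [← integral_const_mul, ← integral_const_mul,
    ← integral_add ((integrableOn_cauchy h₁ x hε).const_mul a)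
      ((integrableOn_cauchy h₂ x hε).const_mul b)]
  congr 1 with t
  ring

theorem HasPV.pv_eq {g : ℝ → ℂ} {x : ℝ} {L : ℂ} (h : HasPV g x L) : pv g x = L := h.limUnder_eq

theorem integrable_indicator_Ioo {f : ℝ → ℂ} (hf : Integrable f lebI) :
    Integrable ((Ioo (-1 : ℝ) 1).indicator f) := by
  rw [integrable_indicator_iff measurableSet_Ioo]
  exact hf

theorem integral_lebI_eq (f : ℝ → ℂ) : ∫ t, f t ∂lebI = ∫ t, (Ioo (-1 : ℝ) 1).indicator f t := by
  rw [integral_indicator measurableSet_Ioo]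
  rfl

theorem integrable_bdd_mul_lebI {k : ℝ → ℝ} (hk : Measurable k) {C : ℝ}
    (hC : ∀ t ∈ Ioo (-1 : ℝ) 1, |k t| ≤ C) {f : ℝ → ℂ} (hf : Integrable f lebI) :
    Integrable (fun t => (k t : ℂ) * f t) lebI := by
  refine hf.bdd_mul (c := C) (by fun_prop) ?_
  filter_upwards [ae_mem_Ioo] with t ht
  rw [Complex.norm_real]
  exact hC t ht

/-- Abel means converge at Lebesgue points. -/
theorem tendsto_abelP {h : ℝ → ℂ} (hh : MemLp h 2 measD) :
    ∀ᵐ x ∂lebI, Tendsto (fun η => ∫ t, (abelP η x t : ℂ) * h t ∂measD) (𝓝[>] 0) (𝓝 (h x)) := by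
  have i1 := integrable_div_root_of_memLp_measD hh
  have i2 := integrable_div_root_of_memLp_measD (memLp_const (1 : ℂ))
  have l1 := ae_restrict_of_ae (s := Ioo (-1 : ℝ) 1)
    (ae_tendsto_meanOsc (integrable_indicator_Ioo i1))
  have l2 := ae_restrict_of_ae (s := Ioo (-1 : ℝ) 1)
    (ae_tendsto_meanOsc (integrable_indicator_Ioo i2))
  filter_upwards [l1, l2, ae_mem_Ioo] with x h1 h2 hx
  -- `measD` has the density 1 / (π√(1 - t²)), so the point x is taken to be a Lebesgue point of
  -- both h/√(1 - t²) and 1/√(1 - t²).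
  obtain ⟨A, hA⟩ : ∃ A, A = (Ioo (-1 : ℝ) 1).indicator fun t => h t / (root t : ℂ) := ⟨_, rfl⟩
  obtain ⟨R, hR⟩ : ∃ R, R = (Ioo (-1 : ℝ) 1).indicator fun t => 1 / (root t : ℂ) := ⟨_, rfl⟩
  have jA := integrable_indicator_Ioo i1
  have jR := integrable_indicator_Ioo i2
  rw [← hA] at h1 jA
  rw [← hR] at h2 jR
  obtain ⟨D, hD⟩ : ∃ D : ℝ → ℝ → ℂ, D = fun η => (Ioo (-1 : ℝ) 1).indicator
    fun t => (abelP η x t : ℂ) := ⟨_, rfl⟩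
  have hpos : ∀ᶠ η in 𝓝[>] (0 : ℝ), 0 < η ∧ η < 1 := by
    filter_upwards [Ioo_mem_nhdsGT (zero_lt_one' ℝ)] with η hη using hη
  have hsqrt : Tendsto (fun η : ℝ => √η) (𝓝[>] 0) (𝓝[>] 0) := by
    refine tendsto_nhdsWithin_iff.2 ⟨?_, ?_⟩
    · have := Real.continuous_sqrt.tendsto 0
      rw [Real.sqrt_zero] at this
      exact this.mono_left nhdsWithin_le_nhds
    · filter_upwards [self_mem_nhdsWithin] with η hη
      exact Real.sqrt_pos.2 hη
  have hC0 : 0 ≤ 6 / min 1 (2 * (1 - |x|)) := by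
    have := one_sub_abs_pos hx
    positivity
  have hDb : ∀ᶠ η in 𝓝[>] (0 : ℝ), ∀ᵐ t, ‖D η t‖ ≤
      6 / min 1 (2 * (1 - |x|)) * poissonK (√η) x t := by
    filter_upwards [hpos] with η hη
    refine ae_of_all _ fun t => ?_
    rw [hD]
    by_cases ht : t ∈ Ioo (-1 : ℝ) 1
    · simp only [indicator_of_mem ht, Complex.norm_real]
      exact abs_abelP_le hη.1 hη.2 hx (Ioo_subset_Icc_self ht)
    · simp only [indicator_of_notMem ht, norm_zero]
      exact mul_nonneg hC0 (poissonK_nonneg (Real.sqrt_pos.2 hη.1) x t)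
  have t1 := tendsto_kernel_osc hsqrt hDb jA h1
  have t2 := (tendsto_kernel_osc hsqrt hDb jR h2).const_mul (h x)
  have t3 := ((t1.sub t2).const_mul (1 / (Real.pi : ℂ))).const_add (h x)
  simp only [mul_zero, sub_zero, add_zero] at t3
  refine t3.congr' ?_
  filter_upwards [hpos] with η hη
  have hm := measurable_abelP η x
  have hDm : AEStronglyMeasurable (D η) volume := by
    rw [hD]
    exact ((by fun_prop : Measurable fun t => (abelP η x t : ℂ)).indicator
      measurableSet_Ioo).aestronglyMeasurable
  have hbd : ∀ t ∈ Ioo (-1 : ℝ) 1, |abelP η x t| ≤ 6 / min 1 (2 * (1 - |x|)) * (1 / √η) :=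
    fun t ht => (abs_abelP_le hη.1 hη.2 hx (Ioo_subset_Icc_self ht)).trans
      (mul_le_mul_of_nonneg_left (poissonK_le (Real.sqrt_pos.2 hη.1) x t) hC0)
  have hbdD : ∀ t, ‖D η t‖ ≤ 6 / min 1 (2 * (1 - |x|)) * (1 / √η) := by
    intro t
    rw [hD]
    by_cases ht : t ∈ Ioo (-1 : ℝ) 1
    · simp only [indicator_of_mem ht, Complex.norm_real]
      exact hbd t ht
    · simp only [indicator_of_notMem ht, norm_zero]
      positivity
  have DI : Integrable (D η) := by
    rw [hD]
    refine integrable_indicator_Ioo ?_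
    have h0 : Integrable (fun _ : ℝ => (1 : ℂ)) lebI :=
      integrableOn_const (μ := volume) (s := Ioo (-1 : ℝ) 1) (by simp)
    simpa using integrable_bdd_mul_lebI hm hbd h0
  have k1 : Integrable fun t => D η t * (A t - A x) := by
    simp only [mul_sub]
    exact (jA.bdd_mul hDm (ae_of_all _ hbdD)).sub (DI.mul_const _)
  have k2 : Integrable fun t => D η t * (R t - R x) := by
    simp only [mul_sub]
    exact (jR.bdd_mul hDm (ae_of_all _ hbdD)).sub (DI.mul_const _)
  have hmem : ∀ {f : ℝ → ℂ}, Integrable (fun t => f t / (root t : ℂ)) lebI →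
      Integrable (fun t => (abelP η x t : ℂ) * (f t / (root t : ℂ))) lebI := fun hf =>
    integrable_bdd_mul_lebI hm hbd hf
  have e1 := integral_measD fun t => (abelP η x t : ℂ) * h t
  have e2 := integral_measD fun t => (abelP η x t : ℂ)
  rw [integral_abelP hη.1 hx] at e2
  -- The constants subtracted on the right cancel because `A x = h x * R x`.
  have e3 : ∫ t, (abelP η x t : ℂ) * h t / (root t : ℂ) ∂lebI
      - h x * ∫ t, (abelP η x t : ℂ) / (root t : ℂ) ∂lebI =
      (∫ t, D η t * (A t - A x)) - h x * ∫ t, D η t * (R t - R x) := by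
    have g1 := hmem i1
    have g2 := hmem i2
    rw [← integral_const_mul, ← integral_const_mul, ← integral_sub k1 (k2.const_mul _),
      ← integral_sub, integral_lebI_eq]
    · congr 1 with t
      by_cases ht : t ∈ Ioo (-1 : ℝ) 1
      · simp only [indicator_of_mem ht, hD, hA, hR, indicator_of_mem hx]
        ring
      · simp only [indicator_of_notMem ht, hD]
        ring
    · exact g1.congr (ae_of_all _ fun t => by simp only; ring)
    · exact (g2.const_mul (h x)).congr (ae_of_all _ fun t => by simp only; ring)
  rw [e1, ← e3]
  linear_combination (h x) * e2

theorem tendsto_abelK_sub_integral {f : ℝ → ℂ} (hf : Integrable f lebI) {x : ℝ}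
    (hx : x ∈ Ioo (-1 : ℝ) 1) :
    Tendsto (fun η => ∫ t, ((abelK η x t -
      (x - t) / ((x - t) ^ 2 + 2 * η * (1 - x ^ 2)) : ℝ) : ℂ) * f t ∂lebI) (𝓝[>] 0) (𝓝 0) := by
  have hz : (0 : ℂ) = ∫ t, (0 : ℂ) ∂lebI := by simp
  rw [hz]
  refine tendsto_integral_filter_of_dominated_convergence
    (fun t => (1 / (2 * (1 - |x|)) + 1 / (2 * (1 - |x|) ^ 2) + 1 / (1 - |x|)) * ‖f t‖) ?_ ?_
    (hf.norm.const_mul _) ?_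
  · refine Eventually.of_forall fun η => ?_
    have := measurable_abelK η x
    exact (by fun_prop : Measurable fun t => ((abelK η x t -
      (x - t) / ((x - t) ^ 2 + 2 * η * (1 - x ^ 2)) : ℝ) : ℂ)).aestronglyMeasurable.mul
        hf.aestronglyMeasurable
  · filter_upwards [Ioo_mem_nhdsGT (zero_lt_one' ℝ)] with η hη
    filter_upwards [ae_mem_Ioo] with t ht
    rw [norm_mul, Complex.norm_real, Real.norm_eq_abs]
    gcongr
    exact abs_abelK_sub_le hη.1 hη.2 hx (Ioo_subset_Icc_self ht)
  · have hne : ∀ᵐ t ∂lebI, t ≠ x := ae_restrict_of_ae (Measure.ae_ne volume x)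
    filter_upwards [hne] with t ht
    have h1 := ((Complex.continuous_ofReal.tendsto 0).comp (tendsto_abelK_sub ht)).mono_left
      (nhdsWithin_le_nhds (s := Ioi 0))
    have h2 := h1.mul_const (f t)
    simpa using h2

/-- The principal value of the Hilbert transform is given by conjugation on the circle. -/
theorem hasPV_of_hilb {f h : ℝ → ℂ} (hf : MemLp f 2 measD) (hh : MemLp h 2 measD) {g : L2T}
    (hg : g =ᵐ[haarT] fun θ => sgnT θ * f (cosT θ))
    (hk : hilb g =ᵐ[haarT] fun θ => h (cosT θ)) :
    ∀ᵐ x : ℝ ∂lebI, HasPV (fun t => 1 / ((x : ℂ) - t) * f t) x (Real.pi * h x) := by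
  have iF := integrable_of_memLp_measD hf
  have l1 := ae_restrict_of_ae (s := Ioo (-1 : ℝ) 1)
    (ae_tendsto_meanOsc (integrable_indicator_Ioo iF))
  filter_upwards [l1, ae_mem_Ioo, tendsto_abelP hh] with x h1 hx h2
  have hpi : (Real.pi : ℂ) ≠ 0 := by exact_mod_cast Real.pi_ne_zero
  have hx2 : 0 < 1 - x ^ 2 := by nlinarith [hx.1, hx.2]
  -- Abel means of h are integrals of f against the conjugate kernel, so these converge to π h(x).
  have t1 : Tendsto (fun η => ∫ t, (abelK η x t : ℂ) * f t ∂lebI) (𝓝[>] 0)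
      (𝓝 (Real.pi * h x)) := by
    refine (h2.const_mul (Real.pi : ℂ)).congr' ?_
    filter_upwards [self_mem_nhdsWithin] with η hη
    rw [integral_abelP_mul hη hx hf.1 hh.1 hg hk]
    field_simp
  have t2 := t1.sub (tendsto_abelK_sub_integral iF hx)
  rw [sub_zero] at t2
  -- This choice makes 2η(1 - x²) = δ², so the comparison kernel is exactly the smooth part of
  -- `truncDiff`.
  have hη : Tendsto (fun δ : ℝ => δ ^ 2 / (2 * (1 - x ^ 2))) (𝓝[>] 0) (𝓝[>] 0) := by
    refine tendsto_nhdsWithin_iff.2 ⟨?_, ?_⟩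
    · have hc : Continuous fun δ : ℝ => δ ^ 2 / (2 * (1 - x ^ 2)) := by fun_prop
      have := hc.tendsto 0
      simp only [ne_eq, OfNat.ofNat_ne_zero, not_false_eq_true, zero_pow, zero_div] at this
      exact this.mono_left nhdsWithin_le_nhds
    · filter_upwards [self_mem_nhdsWithin] with δ hδ
      have : (0 : ℝ) < δ := hδ
      exact div_pos (pow_pos this 2) (mul_pos two_pos hx2)
  have t3 := (t2.comp hη).sub (tendsto_truncDiff (integrable_indicator_Ioo iF) h1)
  rw [sub_zero] at t3
  refine t3.congr' ?_
  have hev : ∀ᶠ δ : ℝ in 𝓝[>] 0, δ ^ 2 / (2 * (1 - x ^ 2)) ∈ Ioo (0 : ℝ) 1 :=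
    hη.eventually (Ioo_mem_nhdsGT (zero_lt_one' ℝ))
  filter_upwards [self_mem_nhdsWithin, hev] with δ hδ hδ'
  have hδ0 : (0 : ℝ) < δ := hδ
  obtain ⟨η, hηe⟩ : ∃ η, η = δ ^ 2 / (2 * (1 - x ^ 2)) := ⟨_, rfl⟩
  have hη0 : 0 < η := by rw [hηe]; exact hδ'.1
  have hη1 : η < 1 := by rw [hηe]; exact hδ'.2
  have hηδ : 2 * η * (1 - x ^ 2) = δ ^ 2 := by rw [hηe]; field_simp
  simp only [Function.comp, ← hηe]
  rw [hηδ]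
  have hmK := measurable_abelK η x
  have b1 : Integrable (fun t => ((abelK η x t - (x - t) / ((x - t) ^ 2 + δ ^ 2) : ℝ) : ℂ) * f t)
      lebI := by
    refine integrable_bdd_mul_lebI
      (C := 1 / (2 * (1 - |x|)) + 1 / (2 * (1 - |x|) ^ 2) + 1 / (1 - |x|)) (by fun_prop)
      (fun t ht => ?_) iF
    rw [← hηδ]
    exact abs_abelK_sub_le hη0 hη1 hx (Ioo_subset_Icc_self ht)
  have b2 : Integrable (fun t => (truncDiff δ x t : ℂ) * f t) lebI :=
    integrable_bdd_mul_lebI (measurable_truncDiff δ x)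
      (fun t ht => (abs_truncDiff_le hδ0 x t).trans (poissonK_le hδ0 x t)) iF
  have b3 : Integrable ((punctured x δ).indicator fun t => 1 / ((x : ℂ) - t) * f t) lebI := by
    refine (IntegrableOn.integrable_indicator ?_ (measurableSet_punctured x δ)).mono_measure
      Measure.restrict_le_self
    exact integrableOn_cauchy iF x hδ0
  have e0 : ∀ t ∈ Ioo (-1 : ℝ) 1, (abelK η x t : ℂ) * f t =
      ((abelK η x t - (x - t) / ((x - t) ^ 2 + δ ^ 2) : ℝ) : ℂ) * f t +
        (truncDiff δ x t : ℂ) * f t +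
        (punctured x δ).indicator (fun t => 1 / ((x : ℂ) - t) * f t) t := by
    intro t ht
    rw [truncDiff]
    by_cases h3 : δ < |t - x|
    · rw [indicator_of_mem (show t ∈ punctured x δ from ⟨ht, h3⟩), if_pos h3]
      push_cast
      ring
    · rw [indicator_of_notMem (fun h4 : t ∈ punctured x δ => h3 h4.2), if_neg h3]
      push_cast
      ring
  have e1 : ∫ t, (abelK η x t : ℂ) * f t ∂lebI =
      (∫ t, ((abelK η x t - (x - t) / ((x - t) ^ 2 + δ ^ 2) : ℝ) : ℂ) * f t ∂lebI) +
        (∫ t, (truncDiff δ x t : ℂ) * f t ∂lebI) +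
        ∫ t, (punctured x δ).indicator (fun t => 1 / ((x : ℂ) - t) * f t) t ∂lebI := by
    have b12 : Integrable (fun t => ((abelK η x t - (x - t) / ((x - t) ^ 2 + δ ^ 2) : ℝ) : ℂ) * f t
        + (truncDiff δ x t : ℂ) * f t) lebI := b1.add b2
    rw [← integral_add b1 b2, ← integral_add b12 b3]
    refine integral_congr_ae ?_
    filter_upwards [ae_mem_Ioo] with t ht
    exact e0 t ht
  have e2 : ∫ t, (truncDiff δ x t : ℂ) * f t ∂lebI =
      ∫ t, (truncDiff δ x t : ℂ) * (Ioo (-1 : ℝ) 1).indicator f t := by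
    rw [integral_lebI_eq]
    congr 1 with t
    by_cases ht : t ∈ Ioo (-1 : ℝ) 1
    · simp only [indicator_of_mem ht]
    · simp only [indicator_of_notMem ht, mul_zero]
  have e3 : ∫ t, (punctured x δ).indicator (fun t => 1 / ((x : ℂ) - t) * f t) t ∂lebI =
      ∫ t in punctured x δ, 1 / ((x : ℂ) - t) * f t := by
    rw [integral_lebI_eq, indicator_indicator, integral_indicator
      (measurableSet_Ioo.inter (measurableSet_punctured x δ))]
    congr 2
    ext t
    exact ⟨fun h => h.2, fun h => ⟨h.1, h⟩⟩
  rw [e1, e2, e3]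
  ring

/-! ### The finite Hilbert transform on the two weighted spaces -/

theorem IsWeight.memLp_of_ae_eq {w : Torus → ℂ} {ν : Measure ℝ} (h : IsWeight w ν) {f : ℝ → ℂ}
    (hf : AEStronglyMeasurable f lebI) {g : L2T}
    (hg : g =ᵐ[haarT] fun θ => w θ * f (cosT θ)) : MemLp f 2 ν := by
  have hf' := hf.mono_ac h.ac
  refine ⟨hf', ?_⟩
  rw [← h.eLpNorm_eq hf', ← eLpNorm_congr_ae hg]
  exact (Lp.memLp g).2

/-- Conjugation on the circle maps `w₁ · (f ∘ cos)` to `w₂ · (h ∘ cos)`, where `h` is the finite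
Hilbert transform of `f`. -/
def HilbertPair (w₁ : Torus → ℂ) (ν₁ : Measure ℝ) (w₂ : Torus → ℂ) (ν₂ : Measure ℝ) : Prop :=
  ∀ (f : ℝ → ℂ), MemLp f 2 ν₁ → ∀ g : L2T, (g =ᵐ[haarT] fun θ => w₁ θ * f (cosT θ)) →
    ∃ h : ℝ → ℂ, MemLp h 2 ν₂ ∧ (hilb g =ᵐ[haarT] fun θ => w₂ θ * h (cosT θ)) ∧
      ∀ᵐ x : ℝ ∂lebI, HasPV (fun t => 1 / ((x : ℂ) - t) * f t) x (Real.pi * h x)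

theorem reflT_of_odd {T : L2T →L[ℂ] L2T} (hT : ∀ f, T (reflT f) = -reflT (T f)) {g : L2T} {κ : ℂ}
    (h : reflT g = κ • g) : reflT (T g) = (-κ) • T g := by
  rw [neg_smul, ← map_smul, ← h, hT, neg_neg]

theorem hilbertPair_measD : HilbertPair sgnT measD (fun _ => 1) measD := by
  intro f hf g hg
  have hr : reflT g = (-1 : ℂ) • g := reflT_eq_of_ae hg fun θ => by
    rw [sgnT_neg, cosT_neg]; ring
  have hr' := reflT_of_odd hilb_reflT hr
  rw [neg_neg] at hr'
  obtain ⟨h, hh, hh'⟩ := isWeight_one.exists_eq_mul_comp one_ne_zero (by simp)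
    (ae_neg_eq_of_reflT hr')
  refine ⟨h, hh, hh', hasPV_of_hilb hf hh hg ?_⟩
  filter_upwards [hh'] with θ h1
  rw [h1, one_mul]

/-- The cosine as a continuous complex function on the circle. -/
def cosMap : C(Torus, ℂ) := ⟨fun θ => (cosT θ : ℂ), by have := continuous_cosT; fun_prop⟩

/-- The sine as a continuous complex function on the circle. -/
def sinMap : C(Torus, ℂ) := ⟨fun θ => (sinT θ : ℂ), by have := continuous_sinT; fun_prop⟩

theorem cosMap_eq : cosMap = (1 / 2 : ℂ) • (fourier 1 + fourier (-1)) := by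
  ext θ
  simp only [cosMap, ContinuousMap.coe_mk, ContinuousMap.smul_apply, ContinuousMap.add_apply,
    fourier_one_eq, fourier_neg_one_eq, smul_eq_mul]
  ring

theorem sinMap_eq : sinMap = (-(Complex.I / 2) : ℂ) • (fourier 1 - fourier (-1)) := by
  ext θ
  simp only [sinMap, ContinuousMap.coe_mk, ContinuousMap.smul_apply, ContinuousMap.sub_apply,
    fourier_one_eq, fourier_neg_one_eq, smul_eq_mul]
  linear_combination (sinT θ : ℂ) * Complex.I_sq

/-- Multiplication by the sine shifts frequencies by ±1, so its commutator with i sgn n is supported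
on the output frequencies -1, 0, 1. -/
theorem hilb_mulOp_sinMap (g : L2T) :
    hilb (mulOp sinMap g) = mulOp sinMap (hilb g) + coef 0 g • mulOp cosMap oneT +
      coef 0 (mulOp cosMap g) • oneT := by
  refine ext_coef fun n => ?_
  rw [sinMap_eq, cosMap_eq]
  simp only [map_add, map_sub, map_smul, coef_hilb, smul_eq_mul, coef_mulOp_fourier,
    smul_apply, add_apply, sub_apply, coef_expT, zero_sub, sub_neg_eq_add]
  have hI := Complex.I_sq
  rcases lt_trichotomy n 0 with h | rfl | h
  · obtain rfl | h' := eq_or_lt_of_le (show n ≤ -1 by omega)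
    · simp [show Int.sign 2 = 1 from rfl]
      linear_combination (-(1 / 2 : ℂ) * coef 0 g) * hI
    · have e1 : Int.sign (n - 1) = -1 := Int.sign_eq_neg_one_of_neg (by omega)
      have e2 : Int.sign (n + 1) = -1 := Int.sign_eq_neg_one_of_neg (by omega)
      have e3 : Int.sign n = -1 := Int.sign_eq_neg_one_of_neg h
      rw [e1, e2, e3, if_neg (by omega), if_neg (by omega), if_neg (by omega)]
      push_cast
      ring
  · simp
    linear_combination (-(1 / 2 : ℂ) * (coef (-1) g + coef 1 g)) * hI
  · obtain rfl | h' := eq_or_lt_of_le (show 1 ≤ n by omega)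
    · simp [show Int.sign 2 = 1 from rfl]
      linear_combination (-(1 / 2 : ℂ) * coef 0 g) * hI
    · have e1 : Int.sign (n - 1) = 1 := Int.sign_eq_one_of_pos (by omega)
      have e2 : Int.sign (n + 1) = 1 := Int.sign_eq_one_of_pos (by omega)
      have e3 : Int.sign n = 1 := Int.sign_eq_one_of_pos h
      rw [e1, e2, e3, if_neg (by omega), if_neg (by omega), if_neg (by omega)]
      push_cast
      ring

theorem tendsto_integral_punctured {f : ℝ → ℂ} (hf : Integrable f lebI) (x : ℝ) :
    Tendsto (fun ε => ∫ t in punctured x ε, f t) (𝓝[>] 0) (𝓝 (∫ t, f t ∂lebI)) := by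
  have h1 : ∀ ε, ∫ t in punctured x ε, f t = ∫ t, (punctured x ε).indicator f t ∂lebI := by
    intro ε
    rw [integral_lebI_eq, indicator_indicator, integral_indicator
      (measurableSet_Ioo.inter (measurableSet_punctured x ε))]
    congr 2
    ext t
    exact ⟨fun h => ⟨h.1, h⟩, fun h => h.2⟩
  simp only [h1]
  refine tendsto_integral_filter_of_dominated_convergence (fun t => ‖f t‖) ?_ ?_ hf.norm ?_
  · exact Eventually.of_forall fun ε =>
      hf.aestronglyMeasurable.indicator (measurableSet_punctured x ε)
  · exact Eventually.of_forall fun ε => ae_of_all _ fun t => norm_indicator_le_norm_self _ _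
  · have hne : ∀ᵐ t ∂lebI, t ≠ x := ae_restrict_of_ae (Measure.ae_ne volume x)
    filter_upwards [hne, ae_mem_Ioo] with t ht ht'
    refine tendsto_const_nhds.congr' ?_
    filter_upwards [Ioo_mem_nhdsGT (abs_pos.2 (sub_ne_zero.2 ht))] with ε hε
    rw [indicator_of_mem (show t ∈ punctured x ε from ⟨ht', hε.2⟩)]

/-- A function f in L²_m is too singular for the L²_d argument, but (1 - t²) f is not: its odd lift
is sin θ times the lift of f. On the circle `hilb_mulOp_sinMap` accounts for the factor sin θ. On
the line (1 - t²)/(x - t) = (1 - x²)/(x - t) + x + t does so. The two corrections agree. -/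
theorem hilbertPair_measM :
    HilbertPair (fun θ => ((|sinT θ| : ℝ) : ℂ)) measM (fun θ => (sinT θ : ℂ)) measM := by
  intro f hf g hg
  have hr : reflT g = (1 : ℂ) • g := reflT_eq_of_ae hg fun θ => by
    beta_reduce
    rw [sinT_neg, abs_neg, cosT_neg, one_mul]
  have hr' := reflT_of_odd hilb_reflT hr
  obtain ⟨h, hh, hh'⟩ := isWeight_sinT.exists_eq_mul_comp (κ := -1) (by simp)
    (fun θ => by rw [sinT_neg]; push_cast; ring) (ae_neg_eq_of_reflT hr')
  refine ⟨h, hh, hh', ?_⟩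
  have hfl := hf.1.mono_ac ac_measM
  have hfi := integrable_of_memLp_measM hf
  have hs : mulOp sinMap g =ᵐ[haarT]
      fun θ => sgnT θ * ((1 - (cosT θ : ℂ) ^ 2) * f (cosT θ)) := by
    filter_upwards [coeFn_mulOp sinMap g, hg, ae_sinT_ne_zero] with θ h1 h2 h3
    rw [h1, h2, sgnT]
    have h4 : ((|sinT θ| : ℝ) : ℂ) ≠ 0 := by exact_mod_cast abs_ne_zero.2 h3
    have h5 : ((|sinT θ| : ℝ) : ℂ) ^ 2 = 1 - (cosT θ : ℂ) ^ 2 := by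
      have := cosT_sq_add_sinT_sq θ
      rw [← Complex.ofReal_pow, sq_abs, show sinT θ ^ 2 = 1 - cosT θ ^ 2 by linarith]
      push_cast
      ring
    rw [← h5]
    simp only [sinMap, ContinuousMap.coe_mk]
    field_simp
  have hm : AEStronglyMeasurable (fun t : ℝ => (1 - (t : ℂ) ^ 2) * f t) lebI :=
    (by fun_prop : Measurable fun t : ℝ => 1 - (t : ℂ) ^ 2).aestronglyMeasurable.mul hfl
  have hD := isWeight_sgnT.memLp_of_ae_eq hm hs
  obtain ⟨h₀, hh₀, hh₀', hpv⟩ := hilbertPair_measD _ hD _ hs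
  obtain ⟨c₀, hc₀⟩ : ∃ c, c = coef 0 g := ⟨_, rfl⟩
  obtain ⟨c₁, hc₁⟩ : ∃ c, c = coef 0 (mulOp cosMap g) := ⟨_, rfl⟩
  -- The transform of (1 - t²) f is (1 - t²) h plus the affine function coming from the commutator.
  have hrel : h₀ =ᵐ[lebI] fun t => (1 - (t : ℂ) ^ 2) * h t + (c₀ * t + c₁) := by
    refine ae_eq_of_comp_cosT hh₀.1 ?_ ?_
    · refine AEStronglyMeasurable.add ?_ (by fun_prop : Measurable fun t : ℝ =>
        c₀ * (t : ℂ) + c₁).aestronglyMeasurable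
      exact (by fun_prop : Measurable fun t : ℝ => 1 - (t : ℂ) ^ 2).aestronglyMeasurable.mul
        (hh.1.mono_ac (measD_ac.trans ac_measM))
    · have e := hilb_mulOp_sinMap g
      rw [← hc₀, ← hc₁] at e
      rw [e] at hh₀'
      filter_upwards [hh₀', Lp.coeFn_add (mulOp sinMap (hilb g) + c₀ • mulOp cosMap oneT)
          (c₁ • oneT), Lp.coeFn_add (mulOp sinMap (hilb g)) (c₀ • mulOp cosMap oneT),
        Lp.coeFn_smul c₀ (mulOp cosMap oneT), Lp.coeFn_smul c₁ oneT, coeFn_oneT,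
        coeFn_mulOp_oneT cosMap, coeFn_mulOp sinMap (hilb g), hh']
        with θ a1 a2 a3 a4 a5 a6 a7 a8 a9
      rw [one_mul] at a1
      rw [← a1, a2, Pi.add_apply, a3, Pi.add_apply, a4, a5, Pi.smul_apply, Pi.smul_apply, a6, a7,
        a8, a9]
      have h5 : (sinT θ : ℂ) ^ 2 = 1 - (cosT θ : ℂ) ^ 2 := by
        have := cosT_sq_add_sinT_sq θ
        rw [← Complex.ofReal_pow, show sinT θ ^ 2 = 1 - cosT θ ^ 2 by linarith]
        push_cast
        ring
      rw [← h5]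
      simp only [sinMap, cosMap, ContinuousMap.coe_mk, smul_eq_mul]
      ring
  -- The commutator coefficients are moments of f: k = 1 gives `c₀` and k = t gives `c₁`.
  have hmean : ∀ k : ℝ → ℂ, Continuous k → ∀ φ : C(Torus, ℂ), (∀ θ, φ θ = k (cosT θ)) →
      coef 0 (mulOp φ g) = 1 / (Real.pi : ℂ) * ∫ t, k t * f t ∂lebI := by
    intro k hk φ hφ
    have hr := continuous_root
    rw [coef_zero_mulOp]
    have e1 : ∫ θ, φ θ * g θ ∂haarT = ∫ t, (root t : ℂ) * (k t * f t) ∂measD := by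
      rw [← integral_comp_cosT]
      · refine integral_congr_ae ?_
        filter_upwards [hg] with θ h1
        rw [h1, hφ, root_cosT]
        ring
      · exact (by fun_prop : Continuous fun t => (root t : ℂ)).aestronglyMeasurable.mul
          (hk.aestronglyMeasurable.mul (hfl.mono_ac measD_ac))
    rw [e1, integral_measD]
    congr 1
    refine integral_congr_ae ?_
    filter_upwards [ae_root_pos] with t ht
    have : (root t : ℂ) ≠ 0 := by exact_mod_cast ht.ne'
    field_simp
  have hpi : (Real.pi : ℂ) ≠ 0 := by exact_mod_cast Real.pi_ne_zero
  have ec₀ : ∫ t, f t ∂lebI = Real.pi * c₀ := by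
    have := hmean (fun _ => 1) continuous_const 1 fun θ => rfl
    rw [mulOp_one, ← hc₀] at this
    rw [this]
    simp only [one_mul]
    field_simp
  have ec₁ : ∫ t : ℝ, (t : ℂ) * f t ∂lebI = Real.pi * c₁ := by
    have := hmean (fun t => (t : ℂ)) (by fun_prop) cosMap fun θ => rfl
    rw [← hc₁] at this
    rw [this]
    field_simp
  have i1 : Integrable (fun t : ℝ => (t : ℂ) * f t) lebI := by
    refine integrable_bdd_mul_lebI (k := fun t => t) measurable_id (C := 1) (fun t ht => ?_) hfi
    exact abs_le.2 ⟨ht.1.le, ht.2.le⟩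
  have iD := integrable_of_memLp_measD hD
  filter_upwards [hpv, hrel, ae_mem_Ioo] with x p1 p2 hx
  have hx2 : (1 - (x : ℂ) ^ 2) ≠ 0 := by
    have : (1 - x ^ 2 : ℝ) ≠ 0 := by nlinarith [hx.1, hx.2]
    exact_mod_cast this
  have i2 : Integrable (fun t : ℝ => (x : ℂ) * f t + (t : ℂ) * f t) lebI :=
    (hfi.const_mul _).add i1
  have t1 := tendsto_integral_punctured i2 x
  rw [integral_add (hfi.const_mul _) i1, integral_const_mul, ec₀, ec₁] at t1
  -- Subtract the ordinary integral of (x + t) f from the principal value for (1 - t²) f, then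
  -- divide by 1 - x².
  have t2 := (Tendsto.sub p1 t1).const_mul (1 / (1 - (x : ℂ) ^ 2))
  have hval : 1 / (1 - (x : ℂ) ^ 2) * (Real.pi * h₀ x - (x * (Real.pi * c₀) + Real.pi * c₁)) =
      Real.pi * h x := by
    rw [p2]
    field_simp
    ring
  rw [hval] at t2
  refine t2.congr' ?_
  filter_upwards [self_mem_nhdsWithin] with ε hε
  have j1 := integrableOn_cauchy iD x hε
  have j2 : IntegrableOn (fun t : ℝ => (x : ℂ) * f t + (t : ℂ) * f t) (punctured x ε) :=
    IntegrableOn.mono_set (t := Ioo (-1 : ℝ) 1) i2 fun t ht => ht.1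
  rw [← integral_sub j1 j2, ← integral_const_mul]
  refine setIntegral_congr_fun (measurableSet_punctured x ε) fun t ht => ?_
  have hne : (x : ℂ) - t ≠ 0 := by
    rw [← Complex.ofReal_sub]
    have h3 : 0 < |t - x| := lt_trans hε ht.2
    have : x - t ≠ 0 := by
      rw [← abs_pos, abs_sub_comm]; exact h3
    exact_mod_cast this
  field_simp
  ring

/-! ## The cosh-weighted transform and its inverse -/

/-- `cosh(iμ sin θ)` as a continuous function on the circle. -/
def coshMap (μ : ℂ) : C(Torus, ℂ) :=
  (1 / 2 : ℂ) • (expMap 0 (μ * Complex.I) + expMap 0 (-(μ * Complex.I)))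

/-- `sinh(iμ sin θ)` as a continuous function on the circle. -/
def sinhMap (μ : ℂ) : C(Torus, ℂ) :=
  (1 / 2 : ℂ) • (expMap 0 (μ * Complex.I) - expMap 0 (-(μ * Complex.I)))

theorem coshMap_apply (μ : ℂ) (θ : Torus) : coshMap μ θ = coshRoot μ (cosT θ) := by
  have h : coshMap μ θ = Complex.cosh (Complex.I * μ * sinT θ) := by
    rw [Complex.cosh]
    simp only [coshMap, ContinuousMap.smul_apply, ContinuousMap.add_apply, expMap_apply,
      smul_eq_mul]
    ring_nf
  rw [h, coshRoot, root_cosT]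
  rcases abs_choice (sinT θ) with h1 | h1
  · rw [h1]
  · rw [h1, Complex.ofReal_neg, mul_neg, Complex.cosh_neg]

theorem sinhMap_apply {θ : Torus} (μ : ℂ) (hθ : sinT θ ≠ 0) :
    sinhMap μ θ = sgnT θ * sinhRoot μ (cosT θ) := by
  have h : sinhMap μ θ = Complex.sinh (Complex.I * μ * sinT θ) := by
    rw [Complex.sinh]
    simp only [sinhMap, ContinuousMap.smul_apply, ContinuousMap.sub_apply, expMap_apply,
      smul_eq_mul]
    ring_nf
  have h0 : (sinT θ : ℂ) ≠ 0 := by exact_mod_cast hθ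
  rw [h, sinhRoot, root_cosT, sgnT]
  rcases abs_choice (sinT θ) with h1 | h1
  · rw [h1, div_self h0, one_mul]
  · rw [h1, Complex.ofReal_neg, mul_neg, Complex.sinh_neg, div_neg, div_self h0]
    ring

theorem sgnT_mul_self {θ : Torus} (hθ : sinT θ ≠ 0) : sgnT θ * sgnT θ = 1 := by
  have h4 : ((|sinT θ| : ℝ) : ℂ) ≠ 0 := by exact_mod_cast abs_ne_zero.2 hθ
  have h5 : ((|sinT θ| : ℝ) : ℂ) ^ 2 = (sinT θ : ℂ) ^ 2 := by exact_mod_cast sq_abs (sinT θ)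
  rw [sgnT]
  field_simp
  exact h5.symm

theorem sgnT_mul_abs {θ : Torus} (hθ : sinT θ ≠ 0) :
    sgnT θ * ((|sinT θ| : ℝ) : ℂ) = sinT θ := by
  have h4 : ((|sinT θ| : ℝ) : ℂ) ≠ 0 := by exact_mod_cast abs_ne_zero.2 hθ
  rw [sgnT]
  field_simp

theorem sgnT_mul_sinT {θ : Torus} (hθ : sinT θ ≠ 0) :
    sgnT θ * sinT θ = ((|sinT θ| : ℝ) : ℂ) := by
  rw [← sgnT_mul_abs hθ, ← mul_assoc, sgnT_mul_self hθ, one_mul]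

/-- With exponentials C + S and C - S the mixed terms cancel in the symmetrised product, leaving C𝓗C
- S𝓗S, the shape of the inversion formulas. -/
theorem hilbCos_apply (μ : ℂ) (f : L2T) :
    hilbCos μ f = mulOp (coshMap μ) (hilb (mulOp (coshMap μ) f))
      - mulOp (sinhMap μ) (hilb (mulOp (sinhMap μ) f)) := by
  have h1 : expMap 0 (μ * Complex.I) = coshMap μ + sinhMap μ := by
    unfold coshMap sinhMap; module
  have h2 : expMap 0 (-(μ * Complex.I)) = coshMap μ - sinhMap μ := by
    unfold coshMap sinhMap; module
  rw [hilbCos, twist_apply, h1, h2]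
  simp only [map_add, map_sub, add_apply, sub_apply]
  module

/-! ### Parity -/

theorem expMap_neg (α β : ℂ) (θ : Torus) : expMap α β (-θ) = expMap α (-β) θ := by
  rw [expMap_apply, expMap_apply, cosT_neg, sinT_neg]
  push_cast
  congr 1
  ring

theorem hilbCosh_reflT (μ : ℂ) (f : L2T) : hilbCosh μ (reflT f) = -reflT (hilbCosh μ f) := by
  have h : ∀ (α : ℂ) (f : L2T), mulOp (expMap α 0) (reflT f) = reflT (mulOp (expMap α 0) f) :=
    fun α f => (reflT_mulOp (fun θ => by rw [expMap_neg, neg_zero]) f).symm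
  rw [hilbCosh, twist_apply, twist_apply]
  simp only [h, hilb_reflT, map_neg, map_smul, map_add]
  module

theorem hilbCos_reflT (μ : ℂ) (f : L2T) : hilbCos μ (reflT f) = -reflT (hilbCos μ f) := by
  have h : ∀ (β : ℂ) (f : L2T), mulOp (expMap 0 β) (reflT f) = reflT (mulOp (expMap 0 (-β)) f) :=
    fun β f => (reflT_mulOp (fun θ => by rw [expMap_neg, neg_neg]) f).symm
  rw [hilbCos, twist_apply, twist_apply]
  simp only [h, hilb_reflT, map_neg, map_smul, map_add, neg_neg]
  module

/-! ### Descent of parity-reversing operators to the interval -/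

theorem adjoint_isometry_apply {E F : Type*} [NormedAddCommGroup E] [InnerProductSpace ℂ E]
    [CompleteSpace E] [NormedAddCommGroup F] [InnerProductSpace ℂ F] [CompleteSpace F]
    (J : E →ₗᵢ[ℂ] F) (x : E) :
    ContinuousLinearMap.adjoint J.toContinuousLinearMap (J x) = x := by
  refine ext_inner_left ℂ fun v => ?_
  rw [ContinuousLinearMap.adjoint_inner_right]
  exact J.inner_map_map v x

theorem exists_descent {T : L2T →L[ℂ] L2T} (hT : ∀ f, T (reflT f) = -reflT (T f))
    {w₁ w₂ : Torus → ℂ} {ν₁ ν₂ : Measure ℝ} (h₁ : IsWeight w₁ ν₁) (h₂ : IsWeight w₂ ν₂) {κ : ℂ}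
    (hκ : κ ≠ 0) (p₁ : ∀ θ, w₁ (-θ) = κ * w₁ θ) (p₂ : ∀ θ, w₂ (-θ) = -κ * w₂ θ) :
    ∃ S : Lp ℂ 2 ν₁ →L[ℂ] Lp ℂ 2 ν₂, ∀ f, h₂.lift (S f) = T (h₁.lift f) := by
  -- S = J₂* T J₁. By parity T J₁ f lies in the range of J₂, where J₂J₂* is the identity; taking the
  -- adjoint gives linearity and continuity at once.
  refine ⟨ContinuousLinearMap.adjoint h₂.lift.toContinuousLinearMap ∘L T ∘L
    h₁.lift.toContinuousLinearMap, fun f => ?_⟩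
  have hr : reflT (h₁.lift f) = κ • h₁.lift f := reflT_eq_of_ae (h₁.coeFn_lift f) fun θ => by
    rw [p₁, cosT_neg, mul_assoc]
  obtain ⟨F, hF⟩ := h₂.exists_lift_eq (neg_ne_zero.2 hκ) p₂
    (ae_neg_eq_of_reflT (reflT_of_odd hT hr))
  simp only [ContinuousLinearMap.comp_apply, LinearIsometry.coe_toContinuousLinearMap]
  rw [← hF, adjoint_isometry_apply]

theorem reflT_lift {w : Torus → ℂ} {ν : Measure ℝ} (h : IsWeight w ν) {κ : ℂ}
    (p : ∀ θ, w (-θ) = κ * w θ) (f : Lp ℂ 2 ν) : reflT (h.lift f) = κ • h.lift f :=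
  reflT_eq_of_ae (h.coeFn_lift f) fun θ => by rw [p, cosT_neg, mul_assoc]

/-! ### Means -/

/-- `cosh(μ cos θ)` in `L²` of the circle. -/
def coshVec (μ : ℂ) : L2T := (1 / 2 : ℂ) • (mulOp (expMap μ 0) oneT + mulOp (expMap (-μ) 0) oneT)

/-- `cosh(iμ sin θ)` in `L²` of the circle. -/
def cosVec (μ : ℂ) : L2T := (1 / 2 : ℂ) • (mulOp (expMap 0 (μ * Complex.I)) oneT
  + mulOp (expMap 0 (-(μ * Complex.I))) oneT)

/-- The mean of `cosh(μ cos θ) g`. -/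
def meanCosh (μ : ℂ) (g : L2T) : ℂ :=
  (coef 0 (mulOp (expMap μ 0) g) + coef 0 (mulOp (expMap (-μ) 0) g)) / 2

/-- The mean of `cosh(iμ sin θ) g`. -/
def meanCos (μ : ℂ) (g : L2T) : ℂ :=
  (coef 0 (mulOp (expMap 0 (μ * Complex.I)) g)
    + coef 0 (mulOp (expMap 0 (-(μ * Complex.I))) g)) / 2

theorem neg_hilbCos_hilbCosh (μ : ℂ) (g : L2T) :
    -hilbCos μ (hilbCosh μ g) = g - meanCosh μ g • cosVec μ := by
  rw [hilbCos_hilbCosh, cosVec, meanCosh]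
  module

theorem neg_hilbCosh_hilbCos (μ : ℂ) (g : L2T) :
    -hilbCosh μ (hilbCos μ g) = g - meanCos μ g • coshVec μ := by
  rw [hilbCosh_hilbCos, coshVec, meanCos]
  module

theorem meanCosh_cosVec (μ : ℂ) : meanCosh μ (cosVec μ) = 1 := mean_cosh_cos μ

theorem meanCos_coshVec (μ : ℂ) : meanCos μ (coshVec μ) = 1 := by
  rw [meanCos, coshVec]
  simp only [map_smul, map_add, ← mulOp_mul, expMap_mul, add_zero, zero_add]
  rw [coef_zero_expMap μ (Or.inl rfl), coef_zero_expMap μ (Or.inr rfl),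
    coef_zero_expMap (-μ) (Or.inr (by ring)), coef_zero_expMap (-μ) (Or.inl (by ring))]
  norm_num

theorem cosVec_ne_zero (μ : ℂ) : cosVec μ ≠ 0 := by
  intro h
  have := meanCosh_cosVec μ
  rw [h] at this
  simp [meanCosh] at this

theorem coshVec_ne_zero (μ : ℂ) : coshVec μ ≠ 0 := by
  intro h
  have := meanCos_coshVec μ
  rw [h] at this
  simp [meanCos] at this

theorem coef_zero_reflT (f : L2T) : coef 0 (reflT f) = coef 0 f := by
  rw [coef_reflT, neg_zero]

theorem meanCosh_of_odd (μ : ℂ) {g : L2T} (hg : reflT g = (-1 : ℂ) • g) : meanCosh μ g = 0 := by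
  have h : ∀ α : ℂ, coef 0 (mulOp (expMap α 0) g) = 0 := by
    intro α
    have h1 := coef_zero_reflT (mulOp (expMap α 0) g)
    rw [reflT_mulOp (ψ := expMap α 0) (fun θ => by rw [expMap_neg, neg_zero]), hg, map_smul,
      map_smul, smul_eq_mul] at h1
    linear_combination (-1 / 2 : ℂ) * h1
  rw [meanCosh, h, h, add_zero, zero_div]

/-- Reflection exchanges the two exponentials, so the two terms of the mean are opposite rather than
separately zero. -/
theorem meanCos_of_odd (μ : ℂ) {g : L2T} (hg : reflT g = (-1 : ℂ) • g) : meanCos μ g = 0 := by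
  have h1 := coef_zero_reflT (mulOp (expMap 0 (μ * Complex.I)) g)
  rw [reflT_mulOp (ψ := expMap 0 (-(μ * Complex.I))) (fun θ => by rw [expMap_neg]), hg, map_smul,
    map_smul, smul_eq_mul] at h1
  rw [meanCos]
  linear_combination (-1 / 2 : ℂ) * h1

theorem meanCos_eq (μ : ℂ) (g : L2T) : meanCos μ g = ∫ θ, coshRoot μ (cosT θ) * g θ ∂haarT := by
  have h : meanCos μ g = coef 0 (mulOp (coshMap μ) g) := by
    rw [meanCos, coshMap]
    simp only [map_smul, map_add, smul_apply, add_apply, smul_eq_mul]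
    ring
  rw [h, coef_zero_mulOp]
  simp only [coshMap_apply]

theorem meanCosh_eq (μ : ℂ) (g : L2T) :
    meanCosh μ g = ∫ θ, Complex.cosh (μ * cosT θ) * g θ ∂haarT := by
  have h : meanCosh μ g =
      coef 0 (mulOp ((1 / 2 : ℂ) • (expMap μ 0 + expMap (-μ) 0)) g) := by
    rw [meanCosh]
    simp only [map_smul, map_add, smul_apply, add_apply, smul_eq_mul]
    ring
  rw [h, coef_zero_mulOp]
  refine integral_congr_ae (ae_of_all _ fun θ => ?_)
  simp only [ContinuousMap.smul_apply, ContinuousMap.add_apply, expMap_apply, smul_eq_mul,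
    Complex.cosh]
  ring_nf

theorem meanCos_lift (μ : ℂ) (F : L2d) :
    meanCos μ (isWeight_one.lift F) = 1 / (Real.pi : ℂ) * ∫ t, nullFun μ t * F t ∂lebI := by
  have hc := continuous_coshRoot μ
  have e1 : meanCos μ (isWeight_one.lift F) = ∫ t, coshRoot μ t * F t ∂measD := by
    rw [meanCos_eq, ← integral_comp_cosT (F := fun t => coshRoot μ t * F t)
      (hc.aestronglyMeasurable.mul (Lp.aestronglyMeasurable F))]
    refine integral_congr_ae ?_
    filter_upwards [isWeight_one.coeFn_lift F] with θ h
    rw [h, one_mul]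
  rw [e1, integral_measD]
  congr 1
  refine integral_congr_ae (ae_of_all _ fun t => ?_)
  simp only [nullFun]
  ring

theorem meanCosh_lift (μ : ℂ) (f : L2m) :
    meanCosh μ (isWeight_abs_sinT.lift f) =
      1 / (Real.pi : ℂ) * ∫ t : ℝ, Complex.cosh (μ * (t : ℂ)) * f t ∂lebI := by
  have hr := continuous_root
  have hf := (Lp.aestronglyMeasurable f).mono_ac (measD_ac.trans ac_measM)
  have e1 : meanCosh μ (isWeight_abs_sinT.lift f) =
      ∫ t : ℝ, Complex.cosh (μ * (t : ℂ)) * (root t : ℂ) * f t ∂measD := by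
    rw [meanCosh_eq, ← integral_comp_cosT (F := fun t : ℝ =>
      Complex.cosh (μ * (t : ℂ)) * (root t : ℂ) * f t) ((by fun_prop : Continuous fun t : ℝ =>
      Complex.cosh (μ * (t : ℂ)) * (root t : ℂ)).aestronglyMeasurable.mul hf)]
    refine integral_congr_ae ?_
    filter_upwards [isWeight_abs_sinT.coeFn_lift f] with θ h
    rw [h, root_cosT, mul_assoc]
  rw [e1, integral_measD]
  congr 1
  refine integral_congr_ae ?_
  filter_upwards [ae_root_pos] with t ht
  have : (root t : ℂ) ≠ 0 := by exact_mod_cast ht.ne'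
  field_simp

theorem lift_nullVec (μ : ℂ) : isWeight_abs_sinT.lift (nullVec μ) = cosVec μ := by
  have h0 : cosVec μ = mulOp (coshMap μ) oneT := by
    rw [cosVec, coshMap]
    simp only [map_smul, map_add, smul_apply, add_apply]
  rw [h0]
  refine Lp.ext ?_
  filter_upwards [isWeight_abs_sinT.coeFn_lift (nullVec μ), coeFn_mulOp_oneT (coshMap μ),
    isWeight_abs_sinT.ae_comp (memLp_nullFun μ).coeFn_toLp, ae_sinT_ne_zero] with θ h1 h2 h3 h4
  have h5 : ((|sinT θ| : ℝ) : ℂ) ≠ 0 := by exact_mod_cast abs_ne_zero.2 h4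
  rw [h1, h2, nullVec, h3, nullFun, root_cosT, coshMap_apply]
  field_simp

/-! ### The transform on functions -/

theorem aestronglyMeasurable_lebI {w : Torus → ℂ} {ν : Measure ℝ} (h : IsWeight w ν) {f : ℝ → ℂ}
    (hf : AEStronglyMeasurable f ν) : AEStronglyMeasurable f lebI := hf.mono_ac h.ac'

theorem ae_eq_of_mul_comp {w : Torus → ℂ} {ν : Measure ℝ} (h : IsWeight w ν) {f g : ℝ → ℂ}
    (hf : AEStronglyMeasurable f lebI) (hg : AEStronglyMeasurable g lebI)
    (hfg : ∀ᵐ θ ∂haarT, w θ * f (cosT θ) = w θ * g (cosT θ)) : f =ᵐ[lebI] g := by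
  refine ae_eq_of_comp_cosT (hf.mono_ac measD_ac) (hg.mono_ac measD_ac) ?_
  filter_upwards [hfg, h.ae_ne_zero] with θ h1 h2
  exact mul_left_cancel₀ h2 h1

/-! ### Identification with the principal-value formulas -/

/-- Expanding cosh(μ(s - t)) as (e^{μs} e^{-μt} + e^{-μs} e^{μt}) / 2 reduces H_μ to unweighted
transforms of e^{-μt} f and e^{μt} f, which match the two summands of `hilbCosh`. -/
theorem hilbCosh_eq_H {w₁ w₂ : Torus → ℂ} {ν₁ ν₂ : Measure ℝ} (h₁ : IsWeight w₁ ν₁)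
    (h₂ : IsWeight w₂ ν₂) (hp : HilbertPair w₁ ν₁ w₂ ν₂)
    (hi : ∀ f : ℝ → ℂ, MemLp f 2 ν₁ → Integrable f lebI) (μ : ℂ)
    {S : Lp ℂ 2 ν₁ →L[ℂ] Lp ℂ 2 ν₂} (hS : ∀ f, h₂.lift (S f) = hilbCosh μ (h₁.lift f))
    (f : Lp ℂ 2 ν₁) :
    (∀ᵐ s ∂lebI, PVExists (coshKernel μ f s) s) ∧ S f =ᵐ[lebI] H μ f := by
  have hfl := aestronglyMeasurable_lebI h₁ (Lp.aestronglyMeasurable f)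
  have hg : ∀ α : ℂ, mulOp (expMap α 0) (h₁.lift f) =ᵐ[haarT]
      fun θ => w₁ θ * (Complex.exp (α * cosT θ) * f (cosT θ)) := by
    intro α
    filter_upwards [coeFn_mulOp (expMap α 0) (h₁.lift f), h₁.coeFn_lift f] with θ a1 a2
    rw [a1, a2, expMap_apply, zero_mul, add_zero]
    ring
  have hm : ∀ α : ℂ, MemLp (fun t : ℝ => Complex.exp (α * t) * f t) 2 ν₁ := fun α =>
    h₁.memLp_of_ae_eq ((by fun_prop : Continuous fun t : ℝ =>
      Complex.exp (α * t)).aestronglyMeasurable.mul hfl) (hg α)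
  obtain ⟨k₁, hk₁, e₁, p₁⟩ := hp _ (hm (-μ)) _ (hg (-μ))
  obtain ⟨k₂, hk₂, e₂, p₂⟩ := hp _ (hm μ) _ (hg μ)
  have hSf : S f =ᵐ[lebI] fun t : ℝ =>
      (1 / 2 : ℂ) * (Complex.exp (μ * t) * k₁ t + Complex.exp (-μ * t) * k₂ t) := by
    have hk₁' := aestronglyMeasurable_lebI h₂ hk₁.1
    have hk₂' := aestronglyMeasurable_lebI h₂ hk₂.1
    refine ae_eq_of_mul_comp h₂ (aestronglyMeasurable_lebI h₂ (Lp.aestronglyMeasurable _)) ?_ ?_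
    · refine AEStronglyMeasurable.const_mul (AEStronglyMeasurable.add ?_ ?_) _
      · exact (by fun_prop : Continuous fun t : ℝ =>
          Complex.exp (μ * t)).aestronglyMeasurable.mul hk₁'
      · exact (by fun_prop : Continuous fun t : ℝ =>
          Complex.exp (-μ * t)).aestronglyMeasurable.mul hk₂'
    · have hl := hS f
      rw [hilbCosh, twist_apply] at hl
      filter_upwards [h₂.coeFn_lift (S f), e₁, e₂,
        Lp.coeFn_smul (1 / 2 : ℂ) (mulOp (expMap μ 0) (hilb (mulOp (expMap (-μ) 0) (h₁.lift f)))
          + mulOp (expMap (-μ) 0) (hilb (mulOp (expMap μ 0) (h₁.lift f)))),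
        Lp.coeFn_add (mulOp (expMap μ 0) (hilb (mulOp (expMap (-μ) 0) (h₁.lift f))))
          (mulOp (expMap (-μ) 0) (hilb (mulOp (expMap μ 0) (h₁.lift f)))),
        coeFn_mulOp (expMap μ 0) (hilb (mulOp (expMap (-μ) 0) (h₁.lift f))),
        coeFn_mulOp (expMap (-μ) 0) (hilb (mulOp (expMap μ 0) (h₁.lift f)))]
        with θ a1 a2 a3 a4 a5 a6 a7
      rw [← a1, hl, a4, Pi.smul_apply, a5, Pi.add_apply, a6, a7, a2, a3, expMap_apply,
        expMap_apply, smul_eq_mul, zero_mul, add_zero, add_zero]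
      ring
  have hpv : ∀ᵐ s : ℝ ∂lebI, HasPV (coshKernel μ f s) s (Real.pi *
      ((1 / 2 : ℂ) * (Complex.exp (μ * s) * k₁ s + Complex.exp (-μ * s) * k₂ s))) := by
    filter_upwards [p₁, p₂] with s q₁ q₂
    have := hasPV_linear (hi _ (hm (-μ))) (hi _ (hm μ)) q₁ q₂
      (1 / 2 * Complex.exp (μ * s)) (1 / 2 * Complex.exp (-μ * s))
    convert this using 1
    · ext t
      rw [coshKernel, Complex.cosh]
      have x1 : Complex.exp (μ * ((s : ℂ) - t)) = Complex.exp (μ * s) * Complex.exp (-μ * t) := by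
        rw [← Complex.exp_add]; ring_nf
      have x2 : Complex.exp (-(μ * ((s : ℂ) - t))) =
          Complex.exp (-μ * s) * Complex.exp (μ * t) := by
        rw [← Complex.exp_add]; ring_nf
      rw [x1, x2]
      ring
    · ring
  refine ⟨hpv.mono fun s hs => ⟨_, hs⟩, ?_⟩
  filter_upwards [hSf, hpv] with s a1 a2
  have hpi : (Real.pi : ℂ) ≠ 0 := by exact_mod_cast Real.pi_ne_zero
  rw [a1, H, a2.pv_eq]
  field_simp

theorem HasPV.neg_swap {k : ℝ → ℂ} {x : ℝ} {L : ℂ}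
    (h : HasPV (fun t => 1 / ((x : ℂ) - t) * k t) x L) :
    HasPV (fun t => 1 / ((t : ℂ) - x) * k t) x (-L) := by
  have h2 := Tendsto.neg h
  simp only [← integral_neg] at h2
  refine h2.congr fun ε => ?_
  congr 1 with t
  rw [← neg_mul, ← div_neg, neg_sub]

/-- From the even lift of F, the cosh factor gives an even function, transformed as an L²_m function
after division by √(1 - t²). The sinh factor gives an odd one, transformed in L²_d. The kernel 1/(s
- t) has the opposite sign to that of `HilbertPair`, which absorbs the minus sign in front of
`hilbCos`. -/
theorem hilbCos_eq_invD (μ : ℂ) {A : L2d →L[ℂ] L2d}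
    (hA : ∀ F, isWeight_sgnT.lift (A F) = -hilbCos μ (isWeight_one.lift F)) (F : L2d) :
    (∀ᵐ t ∂lebI, PVExists (kerDiv μ F t) t ∧ PVExists (kerSinh μ F t) t) ∧
      A F =ᵐ[lebI] invD μ F := by
  have hr := continuous_root
  have hcr := continuous_coshRoot μ
  have hsr : Continuous (sinhRoot μ) := by unfold sinhRoot; fun_prop
  have hF := aestronglyMeasurable_lebI isWeight_one (Lp.aestronglyMeasurable F)
  obtain ⟨G, hG⟩ : ∃ G, G = isWeight_one.lift F := ⟨_, rfl⟩
  have hGF := isWeight_one.coeFn_lift F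
  rw [← hG] at hGF
  have g₁ : mulOp (coshMap μ) G =ᵐ[haarT] fun θ =>
      ((|sinT θ| : ℝ) : ℂ) * (coshRoot μ (cosT θ) / (root (cosT θ) : ℂ) * F (cosT θ)) := by
    filter_upwards [coeFn_mulOp (coshMap μ) G, hGF, ae_sinT_ne_zero] with θ a1 a2 a3
    have h5 : ((|sinT θ| : ℝ) : ℂ) ≠ 0 := by exact_mod_cast abs_ne_zero.2 a3
    rw [a1, a2, coshMap_apply, root_cosT]
    field_simp
  have g₂ : mulOp (sinhMap μ) G =ᵐ[haarT] fun θ =>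
      sgnT θ * (sinhRoot μ (cosT θ) * F (cosT θ)) := by
    filter_upwards [coeFn_mulOp (sinhMap μ) G, hGF, ae_sinT_ne_zero] with θ a1 a2 a3
    rw [a1, a2, sinhMap_apply μ a3]
    ring
  have m₁ : MemLp (fun t => coshRoot μ t / (root t : ℂ) * F t) 2 measM := by
    have hcm := hcr.measurable
    have hrm := hr.measurable
    exact isWeight_abs_sinT.memLp_of_ae_eq ((by fun_prop : Measurable fun t =>
      coshRoot μ t / (root t : ℂ)).aestronglyMeasurable.mul hF) g₁
  have m₂ : MemLp (fun t => sinhRoot μ t * F t) 2 measD :=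
    isWeight_sgnT.memLp_of_ae_eq (hsr.aestronglyMeasurable.mul hF) g₂
  obtain ⟨k₁, hk₁, e₁, p₁⟩ := hilbertPair_measM _ m₁ _ g₁
  obtain ⟨k₂, hk₂, e₂, p₂⟩ := hilbertPair_measD _ m₂ _ g₂
  have hAF : A F =ᵐ[lebI] fun t =>
      -(coshRoot μ t * (root t : ℂ) * k₁ t) + sinhRoot μ t * k₂ t := by
    have hk₁' := aestronglyMeasurable_lebI isWeight_sinT hk₁.1
    have hk₂' := aestronglyMeasurable_lebI isWeight_one hk₂.1
    refine ae_eq_of_mul_comp isWeight_sgnT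
      (aestronglyMeasurable_lebI isWeight_sgnT (Lp.aestronglyMeasurable _)) ?_ ?_
    · exact ((by fun_prop : Continuous fun t => coshRoot μ t *
        (root t : ℂ)).aestronglyMeasurable.mul hk₁').neg.add (hsr.aestronglyMeasurable.mul hk₂')
    · have hl := hA F
      rw [← hG, hilbCos_apply] at hl
      filter_upwards [isWeight_sgnT.coeFn_lift (A F), e₁, e₂, ae_sinT_ne_zero,
        Lp.coeFn_neg (mulOp (coshMap μ) (hilb (mulOp (coshMap μ) G))
          - mulOp (sinhMap μ) (hilb (mulOp (sinhMap μ) G))),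
        Lp.coeFn_sub (mulOp (coshMap μ) (hilb (mulOp (coshMap μ) G)))
          (mulOp (sinhMap μ) (hilb (mulOp (sinhMap μ) G))),
        coeFn_mulOp (coshMap μ) (hilb (mulOp (coshMap μ) G)),
        coeFn_mulOp (sinhMap μ) (hilb (mulOp (sinhMap μ) G))] with θ a1 a2 a3 a4 a5 a6 a7 a8
      rw [← a1, hl, a5, Pi.neg_apply, a6, Pi.sub_apply, a7, a8, a2, a3, coshMap_apply,
        sinhMap_apply μ a4, root_cosT, ← sgnT_mul_abs a4]
      ring
  have q₁ : ∀ᵐ t ∂lebI, HasPV (kerDiv μ F t) t (-(Real.pi * k₁ t)) := by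
    filter_upwards [p₁] with t h
    convert h.neg_swap using 1
    ext s
    rw [kerDiv]
    ring
  have q₂ : ∀ᵐ t ∂lebI, HasPV (kerSinh μ F t) t (-(Real.pi * k₂ t)) := by
    filter_upwards [p₂] with t h
    convert h.neg_swap using 1
    ext s
    rw [kerSinh]
    ring
  refine ⟨by filter_upwards [q₁, q₂] with t b1 b2 using ⟨⟨_, b1⟩, ⟨_, b2⟩⟩, ?_⟩
  filter_upwards [hAF, q₁, q₂] with t b0 b1 b2
  have hpi : (Real.pi : ℂ) ≠ 0 := by exact_mod_cast Real.pi_ne_zero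
  rw [b0, invD, b1.pv_eq, b2.pv_eq]
  field_simp
  ring

/-- Parities are reversed relative to `hilbCos_eq_invD`: the cosh term is now odd and treated in
L²_d, the sinh term even and treated in L²_m. -/
theorem hilbCos_eq_invM (μ : ℂ) {B : L2m →L[ℂ] L2m}
    (hB : ∀ F, isWeight_abs_sinT.lift (B F) = -hilbCos μ (isWeight_sinT.lift F)) (F : L2m) :
    (∀ᵐ t ∂lebI, PVExists (kerMul μ F t) t ∧ PVExists (kerSinh μ F t) t) ∧
      B F =ᵐ[lebI] invM μ F := by
  have hr := continuous_root
  have hcr := continuous_coshRoot μ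
  have hsr : Continuous (sinhRoot μ) := by unfold sinhRoot; fun_prop
  have hF := aestronglyMeasurable_lebI isWeight_sinT (Lp.aestronglyMeasurable F)
  obtain ⟨G, hG⟩ : ∃ G, G = isWeight_sinT.lift F := ⟨_, rfl⟩
  have hGF := isWeight_sinT.coeFn_lift F
  rw [← hG] at hGF
  have g₁ : mulOp (coshMap μ) G =ᵐ[haarT] fun θ =>
      sgnT θ * (coshRoot μ (cosT θ) * (root (cosT θ) : ℂ) * F (cosT θ)) := by
    filter_upwards [coeFn_mulOp (coshMap μ) G, hGF, ae_sinT_ne_zero] with θ a1 a2 a3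
    rw [a1, a2, coshMap_apply, root_cosT, ← sgnT_mul_abs a3]
    ring
  have g₂ : mulOp (sinhMap μ) G =ᵐ[haarT] fun θ =>
      ((|sinT θ| : ℝ) : ℂ) * (sinhRoot μ (cosT θ) * F (cosT θ)) := by
    filter_upwards [coeFn_mulOp (sinhMap μ) G, hGF, ae_sinT_ne_zero] with θ a1 a2 a3
    rw [a1, a2, sinhMap_apply μ a3, ← sgnT_mul_sinT a3]
    ring
  have m₁ : MemLp (fun t => coshRoot μ t * (root t : ℂ) * F t) 2 measD :=
    isWeight_sgnT.memLp_of_ae_eq ((by fun_prop : Continuous fun t =>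
      coshRoot μ t * (root t : ℂ)).aestronglyMeasurable.mul hF) g₁
  have m₂ : MemLp (fun t => sinhRoot μ t * F t) 2 measM :=
    isWeight_abs_sinT.memLp_of_ae_eq (hsr.aestronglyMeasurable.mul hF) g₂
  obtain ⟨k₁, hk₁, e₁, p₁⟩ := hilbertPair_measD _ m₁ _ g₁
  obtain ⟨k₂, hk₂, e₂, p₂⟩ := hilbertPair_measM _ m₂ _ g₂
  have hBF : B F =ᵐ[lebI] fun t =>
      -(coshRoot μ t / (root t : ℂ) * k₁ t) + sinhRoot μ t * k₂ t := by
    have hk₁' := aestronglyMeasurable_lebI isWeight_one hk₁.1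
    have hk₂' := aestronglyMeasurable_lebI isWeight_sinT hk₂.1
    have hcm := hcr.measurable
    have hrm := hr.measurable
    refine ae_eq_of_mul_comp isWeight_abs_sinT
      (aestronglyMeasurable_lebI isWeight_abs_sinT (Lp.aestronglyMeasurable _)) ?_ ?_
    · exact ((by fun_prop : Measurable fun t => coshRoot μ t /
        (root t : ℂ)).aestronglyMeasurable.mul hk₁').neg.add (hsr.aestronglyMeasurable.mul hk₂')
    · have hl := hB F
      rw [← hG, hilbCos_apply] at hl
      filter_upwards [isWeight_abs_sinT.coeFn_lift (B F), e₁, e₂, ae_sinT_ne_zero,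
        Lp.coeFn_neg (mulOp (coshMap μ) (hilb (mulOp (coshMap μ) G))
          - mulOp (sinhMap μ) (hilb (mulOp (sinhMap μ) G))),
        Lp.coeFn_sub (mulOp (coshMap μ) (hilb (mulOp (coshMap μ) G)))
          (mulOp (sinhMap μ) (hilb (mulOp (sinhMap μ) G))),
        coeFn_mulOp (coshMap μ) (hilb (mulOp (coshMap μ) G)),
        coeFn_mulOp (sinhMap μ) (hilb (mulOp (sinhMap μ) G))] with θ a1 a2 a3 a4 a5 a6 a7 a8
      have h5 : ((|sinT θ| : ℝ) : ℂ) ≠ 0 := by exact_mod_cast abs_ne_zero.2 a4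
      rw [← a1, hl, a5, Pi.neg_apply, a6, Pi.sub_apply, a7, a8, a2, a3, coshMap_apply,
        sinhMap_apply μ a4, root_cosT]
      field_simp
      linear_combination (sinhRoot μ (cosT θ) * k₂ (cosT θ)) * sgnT_mul_sinT a4
  have q₁ : ∀ᵐ t ∂lebI, HasPV (kerMul μ F t) t (-(Real.pi * k₁ t)) := by
    filter_upwards [p₁] with t h
    convert h.neg_swap using 1
    ext s
    rw [kerMul]
    ring
  have q₂ : ∀ᵐ t ∂lebI, HasPV (kerSinh μ F t) t (-(Real.pi * k₂ t)) := by
    filter_upwards [p₂] with t h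
    convert h.neg_swap using 1
    ext s
    rw [kerSinh]
    ring
  refine ⟨by filter_upwards [q₁, q₂] with t b1 b2 using ⟨⟨_, b1⟩, ⟨_, b2⟩⟩, ?_⟩
  filter_upwards [hBF, q₁, q₂, ae_root_pos] with t b0 b1 b2 b3
  have hpi : (Real.pi : ℂ) ≠ 0 := by exact_mod_cast Real.pi_ne_zero
  have hr0 : (root t : ℂ) ≠ 0 := by exact_mod_cast b3.ne'
  rw [b0, invM, b1.pv_eq, b2.pv_eq]
  field_simp
  ring

/-! ### Kernels, ranges and inverses -/

/-- The input lift is odd, so its rank-one term vanishes and `Ad` is an exact left inverse. The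
other composition is the identity modulo `coshVec μ`. -/
theorem exists_bijection_measD {μ : ℂ} {Hd Ad : L2d →L[ℂ] L2d}
    (hH : ∀ f, isWeight_one.lift (Hd f) = hilbCosh μ (isWeight_sgnT.lift f))
    (hA : ∀ F, isWeight_sgnT.lift (Ad F) = -hilbCos μ (isWeight_one.lift F)) :
    LinearMap.ker Hd.toLinearMap = ⊥ ∧
      ∃ A : L2d ≃L[ℂ] E2d μ, (∀ f, (A f : L2d) = Hd f) ∧ ∀ F : E2d μ, A.symm F = Ad F := by
  have hleft : ∀ f, Ad (Hd f) = f := fun f => by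
    apply isWeight_sgnT.lift.injective
    rw [hA, hH, neg_hilbCos_hilbCosh,
      meanCosh_of_odd μ (reflT_lift isWeight_sgnT sgnT_neg f), zero_smul, sub_zero]
  have hright : ∀ F, isWeight_one.lift (Hd (Ad F)) = isWeight_one.lift F
      - meanCos μ (isWeight_one.lift F) • coshVec μ := fun F => by
    rw [hH, hA, map_neg, neg_hilbCosh_hilbCos]
  have hpi : (Real.pi : ℂ) ≠ 0 := by exact_mod_cast Real.pi_ne_zero
  have hmem : ∀ F : L2d, F ∈ E2d μ ↔ meanCos μ (isWeight_one.lift F) = 0 := fun F => by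
    rw [meanCos_lift, mul_eq_zero, or_iff_right (one_div_ne_zero hpi)]
    rfl
  have hrange : ∀ f, Hd f ∈ E2d μ := fun f => by
    -- Since Ad (Hd f) = f, the rank-one term at Hd f must be zero; as `coshVec μ` is nonzero, this
    -- is membership in E²_d.
    have h := hright (Hd f)
    rw [hleft, eq_comm, sub_eq_self, smul_eq_zero, or_iff_left (coshVec_ne_zero μ)] at h
    exact (hmem _).2 h
  refine ⟨LinearMap.ker_eq_bot.2 (Function.LeftInverse.injective hleft), ?_⟩
  refine ⟨ContinuousLinearEquiv.equivOfInverse (Hd.codRestrict (E2d μ) hrange)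
    (Ad ∘L (E2d μ).subtypeL) hleft fun F => ?_, fun f => rfl, fun F => rfl⟩
  refine Subtype.ext (isWeight_one.lift.injective ?_)
  have h := hright F
  rw [(hmem F).1 F.2, zero_smul, sub_zero] at h
  exact h

/-- Dual situation: F lifts to an odd function, so `Bm` is an exact right inverse. `Bm ∘ Hm` is the
projection onto E²_m along `nullVec μ`, whose image therefore contains the kernel of `Hm`'s
complementary summand only as multiples of `nullVec μ`. -/
theorem exists_bijection_measM {μ : ℂ} {Hm Bm : L2m →L[ℂ] L2m}
    (hH : ∀ f, isWeight_sinT.lift (Hm f) = hilbCosh μ (isWeight_abs_sinT.lift f))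
    (hB : ∀ F, isWeight_abs_sinT.lift (Bm F) = -hilbCos μ (isWeight_sinT.lift F)) :
    LinearMap.ker Hm.toLinearMap = Submodule.span ℂ {nullVec μ} ∧
      ∃ B : E2m μ ≃L[ℂ] L2m, (∀ f : E2m μ, B f = Hm f) ∧ ∀ F, (B.symm F : L2m) = Bm F := by
  have hright : ∀ F, Hm (Bm F) = F := fun F => by
    apply isWeight_sinT.lift.injective
    rw [hH, hB, map_neg, neg_hilbCosh_hilbCos, meanCos_of_odd μ (reflT_lift isWeight_sinT
      (fun θ => by rw [sinT_neg]; push_cast; ring) F), zero_smul, sub_zero]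
  have hleft : ∀ f, Bm (Hm f) = f - meanCosh μ (isWeight_abs_sinT.lift f) • nullVec μ :=
    fun f => by
      apply isWeight_abs_sinT.lift.injective
      rw [hB, hH, neg_hilbCos_hilbCosh, map_sub, map_smul, lift_nullVec]
  have hpi : (Real.pi : ℂ) ≠ 0 := by exact_mod_cast Real.pi_ne_zero
  have hmem : ∀ f : L2m, f ∈ E2m μ ↔ meanCosh μ (isWeight_abs_sinT.lift f) = 0 := fun f => by
    rw [meanCosh_lift, mul_eq_zero, or_iff_right (one_div_ne_zero hpi)]
    rfl
  have hnull : nullVec μ ≠ 0 := fun h => by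
    have := lift_nullVec μ
    rw [h, map_zero] at this
    exact cosVec_ne_zero μ this.symm
  have hrange : ∀ F, Bm F ∈ E2m μ := fun F => by
    have h := hleft (Bm F)
    rw [hright, eq_comm, sub_eq_self, smul_eq_zero, or_iff_left hnull] at h
    exact (hmem _).2 h
  constructor
  · ext f
    rw [Submodule.mem_span_singleton, LinearMap.mem_ker]
    constructor
    · intro hf
      have hf' : Hm f = 0 := hf
      have h := hleft f
      rw [hf', map_zero, eq_comm, sub_eq_zero] at h
      exact ⟨_, h.symm⟩
    · rintro ⟨c, rfl⟩
      -- The mean of cosh(μ cos θ) cosh(iμ sin θ) is 1, so Bm (Hm (nullVec μ)) = 0; applying Hm,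
      -- with Hm ∘ Bm = 1, gives Hm (nullVec μ) = 0.
      have h := hleft (nullVec μ)
      rw [lift_nullVec, meanCosh_cosVec, one_smul, sub_self] at h
      have h2 := hright (Hm (nullVec μ))
      rw [h, map_zero] at h2
      change Hm (c • nullVec μ) = 0
      rw [map_smul, ← h2, smul_zero]
  · refine ⟨ContinuousLinearEquiv.equivOfInverse (Hm ∘L (E2m μ).subtypeL)
      (Bm.codRestrict (E2m μ) hrange) (fun f => ?_) hright, fun f => rfl, fun F => rfl⟩
    refine Subtype.ext ?_
    have h := hleft f
    rw [(hmem f).1 f.2, zero_smul, sub_zero] at h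
    exact h

end

end CoshFHT

theorem theorem2 (μ : ℂ) :
    ∃ (Hd : CoshFHT.L2d →L[ℂ] CoshFHT.L2d) (Hm : CoshFHT.L2m →L[ℂ] CoshFHT.L2m),
      -- `Hd` and `Hm` are `H_μ` on `L²_d` and `L²_m`
      (∀ f : CoshFHT.L2d,
        (∀ᵐ s ∂CoshFHT.lebI, CoshFHT.PVExists (CoshFHT.coshKernel μ f s) s) ∧
        Hd f =ᵐ[CoshFHT.lebI] CoshFHT.H μ f) ∧
      (∀ f : CoshFHT.L2m,
        (∀ᵐ s ∂CoshFHT.lebI, CoshFHT.PVExists (CoshFHT.coshKernel μ f s) s) ∧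
        Hm f =ᵐ[CoshFHT.lebI] CoshFHT.H μ f) ∧
      -- null spaces
      LinearMap.ker Hd.toLinearMap = ⊥ ∧
      LinearMap.ker Hm.toLinearMap = Submodule.span ℂ {CoshFHT.nullVec μ} ∧
      -- `H_μ : L²_d → E²_d` is a continuous bijection, with the stated continuous inverse
      (∃ A : CoshFHT.L2d ≃L[ℂ] CoshFHT.E2d μ,
        (∀ f : CoshFHT.L2d, (A f : CoshFHT.L2d) = Hd f) ∧
        ∀ F : CoshFHT.E2d μ,
          (∀ᵐ t ∂CoshFHT.lebI,
            CoshFHT.PVExists (CoshFHT.kerDiv μ (F : CoshFHT.L2d) t) t ∧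
            CoshFHT.PVExists (CoshFHT.kerSinh μ (F : CoshFHT.L2d) t) t) ∧
          A.symm F =ᵐ[CoshFHT.lebI] CoshFHT.invD μ (F : CoshFHT.L2d)) ∧
      -- `H_μ : E²_m → L²_m` is a continuous bijection, with the stated continuous inverse
      (∃ B : CoshFHT.E2m μ ≃L[ℂ] CoshFHT.L2m,
        (∀ f : CoshFHT.E2m μ, B f = Hm (f : CoshFHT.L2m)) ∧
        ∀ F : CoshFHT.L2m,
          (∀ᵐ t ∂CoshFHT.lebI,
            CoshFHT.PVExists (CoshFHT.kerMul μ F t) t ∧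
            CoshFHT.PVExists (CoshFHT.kerSinh μ F t) t) ∧
          (B.symm F : CoshFHT.L2m) =ᵐ[CoshFHT.lebI] CoshFHT.invM μ F) := by
  -- Each descent pairs an input weight of parity κ with an output weight of parity -κ, since both
  -- circle operators reverse parity.
  obtain ⟨Hd, hHd⟩ := CoshFHT.exists_descent (CoshFHT.hilbCosh_reflT μ) CoshFHT.isWeight_sgnT CoshFHT.isWeight_one
    (κ := -1) (by simp) CoshFHT.sgnT_neg (by simp)
  obtain ⟨Ad, hAd⟩ := CoshFHT.exists_descent (T := -CoshFHT.hilbCos μ)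
    (fun f => by rw [neg_apply, neg_apply, CoshFHT.hilbCos_reflT, map_neg]) CoshFHT.isWeight_one CoshFHT.isWeight_sgnT
    (κ := 1) (by simp) (by simp) CoshFHT.sgnT_neg
  obtain ⟨Hm, hHm⟩ := CoshFHT.exists_descent (CoshFHT.hilbCosh_reflT μ) CoshFHT.isWeight_abs_sinT CoshFHT.isWeight_sinT
    (κ := 1) (by simp) (fun θ => by rw [CoshFHT.sinT_neg, abs_neg, one_mul])
    (fun θ => by rw [CoshFHT.sinT_neg]; push_cast; ring)
  obtain ⟨Bm, hBm⟩ := CoshFHT.exists_descent (T := -CoshFHT.hilbCos μ)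
    (fun f => by rw [neg_apply, neg_apply, CoshFHT.hilbCos_reflT, map_neg]) CoshFHT.isWeight_sinT
    CoshFHT.isWeight_abs_sinT (κ := -1) (by simp) (fun θ => by rw [CoshFHT.sinT_neg]; push_cast; ring)
    (fun θ => by rw [CoshFHT.sinT_neg, abs_neg, neg_neg, one_mul])
  obtain ⟨kd, A, hA, hA'⟩ := CoshFHT.exists_bijection_measD hHd hAd
  obtain ⟨km, B, hB, hB'⟩ := CoshFHT.exists_bijection_measM hHm hBm
  refine ⟨Hd, Hm, ?_, ?_, kd, km, ⟨A, hA, fun F => ?_⟩, ⟨B, hB, fun F => ?_⟩⟩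
  · exact CoshFHT.hilbCosh_eq_H CoshFHT.isWeight_sgnT CoshFHT.isWeight_one CoshFHT.hilbertPair_measD
      (fun f hf => CoshFHT.integrable_of_memLp_measD hf) μ hHd
  · exact CoshFHT.hilbCosh_eq_H CoshFHT.isWeight_abs_sinT CoshFHT.isWeight_sinT CoshFHT.hilbertPair_measM
      (fun f hf => CoshFHT.integrable_of_memLp_measM hf) μ hHm
  · rw [hA']
    exact CoshFHT.hilbCos_eq_invD μ hAd F
  · rw [hB']
    exact CoshFHT.hilbCos_eq_invM μ hBm F
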